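/- Let $\mathcal M\subseteq\mathbb R^{1+2}$ be open, with coordinates $(x^0,x^1,x^2)$; greek indices range over $\{0,1,2\}$, roman indices over $\{1,2\}$, and repeated indices are summed. For a Lorentzian metric $g=g_{\alpha\beta}\,dx^\alpha dx^\beta$ on $\mathcal M$ (signature $(-,+,+)$, components of class $C^2$) with inverse $g^{\alpha\beta}$ and with spacelike slices $\{x^0=\text{const}\}$, put $$\beta^i=-\frac{g^{0i}}{g^{00}},\qquad N=(-g^{00})^{-1/2},\qquad e_0=\partial_0-\beta^i\partial_i,\qquad \tilde g^{ij}=g^{ij}-\frac{g^{0i}g^{0j}}{g^{00}},\qquad \tilde g_{ij}=g_{ij},$$ so that $g=-N^2(dx^0)^2+\tilde g_{ij}(dx^i+\beta^i dx^0)(dx^j+\beta^j dx^0)$, and $$K_{ij}=-\frac1{2N}\left[e_0\tilde g_{ij}-\partial_j\beta^k\tilde g_{ki}-\partial_i\beta^k\tilde g_{kj}\right],\qquad \tau=\tilde g^{ij}K_{ij}.$$ Call $g$ spatially conformally flat if $\tilde g_{ij}=e^{2\gamma}\delta_{ij}$ on $\mathcal M$ for some function $\gamma$. Fix $T(x^0)$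 to be either $x^0$ or $0$, and let $(g_\varepsilon)_\varepsilon$ be a sequence of such metrics, and $g$ a further such metric, all spatially conformally flat and all with mean curvature $\tau=T(x^0)$ on $\mathcal M$. Suppose that * $g_\varepsilon\to g$ in $C^0_{\mathrm{loc}}(\mathcal M)$, and the components $(g_\varepsilon)_{\alpha\beta}$ are uniformly bounded in $W^{1,2}_{\mathrm{loc}}(\mathcal M)$; * the components of the Ricci tensor $\mathrm{Ric}(g_\varepsilon)$ are uniformly bounded in $L^2_{\mathrm{loc}}(\mathcal M)$. Then * for all $\alpha,\beta$, the functions $\delta^{ij}\partial^2_{ij}g_\varepsilon^{\alpha\beta}$ are uniformly bounded in $L^2_{\mathrm{loc}}(\mathcal M)$; * for all $i,j$, $e_{0,\varepsilon}\,\tilde g_\varepsilon^{ij}\to e_0\,\tilde g^{ij}$ strongly in $L^4_{\mathrm{loc}}(\mathcal M)$, where $e_{0,\varepsilon}$ and $e_0$ are the vector fields associated with $g_\varepsilon$ and $g$; * $\mathrm{Ric}(g_\varepsilon)\to\mathrm{Ric}(g)$ componentwise in the sense of distributions on $\mathcal M$. -/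

import Mathlib

open MeasureTheory Filter Topology
open scoped ENNReal NNReal ContDiff

noncomputable section

namespace EllipticGauge

/-- Points of the coordinate space `ℝ^{1+n}`; the coordinate `x 0` is the time `x⁰`, the
coordinates `x i.succ`, `i : Fin n`, are the spatial ones. Its `volume` is Lebesgue measure. -/
abbrev Coord (n : ℕ) : Type := Fin (n + 1) → ℝ

/-- A field of `(1+n) × (1+n)` matrices `g_{αβ}(x)`. Only its values on the spacetime domain
`M ⊆ ℝ^{1+n}` matter. -/
abbrev TensorField (n : ℕ) : Type := Coord n → Matrix (Fin (n + 1)) (Fin (n + 1)) ℝ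

/-- The partial derivative `∂_α f`. -/
def pd {n : ℕ} (α : Fin (n + 1)) (f : Coord n → ℝ) (x : Coord n) : ℝ :=
  fderiv ℝ f x (Pi.single α 1)

/-- The flat spatial Laplacian `δ^{ij} ∂_i ∂_j f`. -/
def spatialLaplacian {n : ℕ} (f : Coord n → ℝ) (x : Coord n) : ℝ :=
  ∑ i : Fin n, pd i.succ (pd i.succ f) x

/-- The matrix `diag(-1, 1, …, 1)`. -/
def minkowskiMatrix (n : ℕ) : Matrix (Fin (n + 1)) (Fin (n + 1)) ℝ :=
  Matrix.diagonal (Fin.cons (-1) (fun _ => 1))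

/-- Symmetric matrices of signature `(-, +, …, +)`. -/
def IsLorentzForm {n : ℕ} (A : Matrix (Fin (n + 1)) (Fin (n + 1)) ℝ) : Prop :=
  A.IsSymm ∧ ∃ P : Matrix (Fin (n + 1)) (Fin (n + 1)) ℝ,
    IsUnit P.det ∧ P.transpose * A * P = minkowskiMatrix n

/-- `g` is a Lorentzian metric on `M`, with components of class `C²` (so that its curvature is
classically defined; smooth metrics are included). -/
structure IsLorentzianMetric {n : ℕ} (M : Set (Coord n)) (g : TensorField n) : Prop where
  contDiffOn : ∀ α β, ContDiffOn ℝ 2 (fun x => g x α β) M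
  lorentz : ∀ x ∈ M, IsLorentzForm (g x)

/-- The components `g^{αβ}` of the inverse metric. -/
def invMetric {n : ℕ} (g : TensorField n) (α β : Fin (n + 1)) (x : Coord n) : ℝ :=
  (g x)⁻¹ α β

/-! ### The Cauchy frame and the second fundamental form -/

/-- The shift `β^i = - g^{0i} / g^{00}`. -/
def shift {n : ℕ} (g : TensorField n) (i : Fin n) (x : Coord n) : ℝ :=
  - (invMetric g 0 i.succ x / invMetric g 0 0 x)

/-- The lapse `N > 0`, determined by `g^{00} = - N⁻²`. -/
def lapse {n : ℕ} (g : TensorField n) (x : Coord n) : ℝ :=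
  1 / Real.sqrt (- invMetric g 0 0 x)

/-- The vector field `e₀ = ∂₀ - β^i ∂_i`, acting on functions. -/
def e0 {n : ℕ} (g : TensorField n) (f : Coord n → ℝ) (x : Coord n) : ℝ :=
  pd 0 f x - ∑ i : Fin n, shift g i x * pd i.succ f x

/-- `g̃^{ij} = g^{ij} - g^{0i} g^{0j} / g^{00}`. -/
def spatialInv {n : ℕ} (g : TensorField n) (i j : Fin n) (x : Coord n) : ℝ :=
  invMetric g i.succ j.succ x
    - invMetric g 0 i.succ x * invMetric g 0 j.succ x / invMetric g 0 0 x

/-- `g̃_{ij} = g_{ij}`, the metric induced on the slices `{x⁰ = constant}` (the inverse of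
`g̃^{ij}`). -/
def spatialMetric {n : ℕ} (g : TensorField n) (i j : Fin n) (x : Coord n) : ℝ :=
  g x i.succ j.succ

/-- The second fundamental form of the slices `{x⁰ = constant}`,
`K_{ij} = -(1/2N) [e₀ g̃_{ij} - ∂_j β^k g̃_{ki} - ∂_i β^k g̃_{kj}]`. -/
def secondFundamentalForm {n : ℕ} (g : TensorField n) (i j : Fin n) (x : Coord n) : ℝ :=
  - (1 / (2 * lapse g x)) *
    (e0 g (spatialMetric g i j) x
      - ∑ k : Fin n, pd j.succ (shift g k) x * spatialMetric g k i x
      - ∑ k : Fin n, pd i.succ (shift g k) x * spatialMetric g k j x)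

/-- The mean curvature `τ = g̃^{ij} K_{ij}` of the slices. -/
def meanCurvature {n : ℕ} (g : TensorField n) (x : Coord n) : ℝ :=
  ∑ i : Fin n, ∑ j : Fin n, spatialInv g i j x * secondFundamentalForm g i j x

/-- `g̃_{ij} = e^{2γ} δ_{ij}` on `M` for some function `γ`. -/
def IsSpatiallyConformallyFlat {n : ℕ} (M : Set (Coord n)) (g : TensorField n) : Prop :=
  ∃ γ : Coord n → ℝ, ∀ x ∈ M, ∀ i j : Fin n,
    spatialMetric g i j x = if i = j then Real.exp (2 * γ x) else 0

/-- The slices `{x⁰ = t}` have constant mean curvature `T t`. -/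
def HasSliceMeanCurvature {n : ℕ} (M : Set (Coord n)) (g : TensorField n) (T : ℝ → ℝ) : Prop :=
  ∀ x ∈ M, meanCurvature g x = T (x 0)

/-! ### Ricci curvature -/

/-- The Christoffel symbols
`Γ^l_{μν} = ½ g^{lσ} (∂_μ g_{σν} + ∂_ν g_{σμ} - ∂_σ g_{μν})`. -/
def christoffel {n : ℕ} (g : TensorField n) (l μ ν : Fin (n + 1)) (x : Coord n) : ℝ :=
  (1 / 2) * ∑ σ, invMetric g l σ x *
    (pd μ (fun y => g y σ ν) x + pd ν (fun y => g y σ μ) x - pd σ (fun y => g y μ ν) x)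

/-- The Ricci tensor
`R_{μν} = ∂_l Γ^l_{μν} - ∂_ν Γ^l_{μl} + Γ^l_{lσ} Γ^σ_{μν} - Γ^l_{νσ} Γ^σ_{μl}`. -/
def ricci {n : ℕ} (g : TensorField n) (μ ν : Fin (n + 1)) (x : Coord n) : ℝ :=
  (∑ l, pd l (christoffel g l μ ν) x) - (∑ l, pd ν (christoffel g l μ l) x)
    + (∑ l, ∑ σ, christoffel g l l σ x * christoffel g σ μ ν x)
    - ∑ l, ∑ σ, christoffel g l ν σ x * christoffel g σ μ l x

/-! ### Local function spaces and modes of convergence -/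

/-- The sequence `f_k` is bounded in `L^p_loc(M)`. -/
def BoundedInLpLoc {n : ℕ} (M : Set (Coord n)) (p : ℝ≥0∞) (f : ℕ → Coord n → ℝ) : Prop :=
  ∀ K ⊆ M, IsCompact K → ∃ C : ℝ≥0, ∀ k,
    MemLp (f k) p (volume.restrict K) ∧ eLpNorm (f k) p (volume.restrict K) ≤ C

/-- The sequence `f_k` of continuously differentiable functions is bounded in `W^{1,p}_loc(M)`. -/
def BoundedInW1pLoc {n : ℕ} (M : Set (Coord n)) (p : ℝ≥0∞) (f : ℕ → Coord n → ℝ) : Prop :=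
  BoundedInLpLoc M p f ∧ ∀ α, BoundedInLpLoc M p (fun k => pd α (f k))

/-- `f_k → f` in `C⁰_loc(M)`. -/
def TendstoInC0Loc {n : ℕ} (M : Set (Coord n)) (f : ℕ → Coord n → ℝ) (f₀ : Coord n → ℝ) : Prop :=
  ∀ K ⊆ M, IsCompact K → TendstoUniformlyOn f f₀ atTop K

/-- `f_k → f` strongly in `L^p_loc(M)`. -/
def TendstoInLpLoc {n : ℕ} (M : Set (Coord n)) (p : ℝ≥0∞) (f : ℕ → Coord n → ℝ)
    (f₀ : Coord n → ℝ) : Prop :=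
  ∀ K ⊆ M, IsCompact K →
    (∀ k, MemLp (f k) p (volume.restrict K)) ∧ MemLp f₀ p (volume.restrict K) ∧
      Tendsto (fun k => eLpNorm (f k - f₀) p (volume.restrict K)) atTop (𝓝 0)

/-- `f_k → f` in the sense of distributions on `M`, for locally integrable functions. -/
def TendstoInDistributions {n : ℕ} (M : Set (Coord n)) (f : ℕ → Coord n → ℝ)
    (f₀ : Coord n → ℝ) : Prop :=
  (∀ k, LocallyIntegrableOn (f k) M) ∧ LocallyIntegrableOn f₀ M ∧
    ∀ φ : Coord n → ℝ, ContDiff ℝ ∞ φ → HasCompactSupport φ → tsupport φ ⊆ M →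
      Tendsto (fun k => ∫ x, f k x * φ x) atTop (𝓝 (∫ x, f₀ x * φ x))

end EllipticGauge

end

open EllipticGauge

namespace EllipticGauge

noncomputable section

/-! A metric of this class is encoded by four functions: the lapse `N`, the shift `β = (b, c)` and
the conformal factor `a = e^{2γ}`. The mean curvature condition reads `e₀ a = a div β - N a T`: it
trades the derivative of `a` along `e₀` for spatial derivatives of the shift. Inserted, together
with its first derivatives, into the Ricci components in the frame `e₀, ∂₁, ∂₂`, it leaves no second
derivatives but flat spatial Laplacians: `R₀₁` and `R₀₂` determine `Δβ`, `R₀₀` determines `ΔN`, and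
`R₁₁ + R₂₂` then determines `Δa` (`frameRicci_eqs`). The other terms are quadratic in the spatial
gradients of the four functions, or locally bounded.

To bound the Laplacians in `L²` one therefore needs the spatial gradients in `L⁴`. Integrating the
divergence of `ζ² w (∂ᵢ w)³` bounds `∫ ζ² (∂ᵢ w)⁴` by `sup |w|` times the same quantity, `∫ ζ²
(Δw)²` and harmless terms (`exists_gagliardo_nirenberg`). By convergence in `C⁰_loc`, near a given
point and for large `k` each function is as close to a constant as desired, so the quadratic terms
can be absorbed (`convLap_of_quadratic_system`, `convLap_gaugeFunction`). The class `ConvLap` so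
obtained is closed under products and inverses, hence contains the inverse metric.

Applied to the difference from the limit, which tends to zero uniformly on compact sets, the same
inequality yields strong `L⁴_loc` convergence of spatial gradients (`ConvLap.strongL4_pd`). The mean
curvature equation extends this to `e₀ a`, and so to `∂₀ a`.

The time derivatives of lapse and shift converge only weakly in `L²_loc`. They enter the Christoffel
symbols `Γ^l_{μν}` only when `μ = ν = 0`; the others converge strongly in `L⁴_loc`. A strongly
convergent factor times a weakly convergent one passes to the limit. The only product of two weak
factors in the Ricci tensor is `Γ^0_{00} Γ^0_{00}`, and it occurs twice with opposite signs
(`convDistrib_ricci`). -/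

/-- Christoffel symbols of the first kind, from the first derivatives `D l α β = ∂_l g_{αβ}`. -/
def christoffelJet {n : ℕ} (D : Fin n → Fin n → Fin n → ℝ) (A B C : Fin n) : ℝ :=
  (1 / 2) * (D B A C + D C A B - D A B C)

/-- The Ricci tensor as a function of the inverse metric `G`, the first derivatives `D` and the
second derivatives `H` of the metric. -/
def ricciJet {n : ℕ} (G : Fin n → Fin n → ℝ) (D : Fin n → Fin n → Fin n → ℝ)
    (H : Fin n → Fin n → Fin n → Fin n → ℝ) (B C : Fin n) : ℝ :=
  (∑ l, ∑ s, G l s * (christoffelJet (H l) s B C - christoffelJet (H C) s B l))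
    + ∑ l, ∑ s, G l s * ∑ p, ∑ q, G p q *
      (christoffelJet D p C s * christoffelJet D q B l
        - christoffelJet D p l s * christoffelJet D q B C)

/-- The inverse metric in the frame `e₀, ∂₁, ∂₂`. -/
def diagJet (N a : ℝ) (A B : Fin 3) : ℝ := 
  if A = B then (if A = 0 then -(N^2)⁻¹ else a⁻¹) else 0

/-- First derivatives of `-N² dt² + a |dx + β dt|²` where `β = (b, c)` vanishes. -/
def admJet₁ (N a : ℝ) (n b c s : Fin 3 → ℝ) (A B C : Fin 3) : ℝ :=
  !![-2 * N * n A, a * b A, a * c A; a * b A, s A, 0; a * c A, 0, s A] B C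

/-- Second derivatives of `-N² dt² + a |dx + β dt|²` where `β = (b, c)` vanishes. -/
def admJet₂ (N a : ℝ) (n b c s : Fin 3 → ℝ) (nn bb cc ss : Fin 3 → Fin 3 → ℝ)
    (A B C D : Fin 3) : ℝ :=
  !![-2 * (n A * n B + N * nn A B) + 2 * a * (b A * b B + c A * c B),
      a * bb A B + s A * b B + s B * b A, a * cc A B + s A * c B + s B * c A;
    a * bb A B + s A * b B + s B * b A, ss A B, 0;
    a * cc A B + s A * c B + s B * c A, 0, ss A B] C D

/-! ### Ricci identities at a point in the frame `e₀, ∂₁, ∂₂` -/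

variable {N a : ℝ} {n b c s : Fin 3 → ℝ} {nn bb cc ss : Fin 3 → Fin 3 → ℝ}


/-- This is the momentum constraint. Since the slices are conformally flat, the trace-free part of
`K` is `a / 2N` times the conformal Killing operator of the shift, with components `b 1 - c 2` and
`b 2 + c 1`. In two dimensions the divergence of that operator is exactly the flat Laplacian. The
hypothesis `hs` is the mean curvature condition and `hss` its derivative along `∂₁`, used to
eliminate the mixed derivative of the conformal factor. -/
theorem ricciJet_adm_zero_one (hN : N ≠ 0) (ha : a ≠ 0) {T : ℝ}
    (hcc : cc 1 2 = cc 2 1) (hnn : nn 0 1 = nn 1 0)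
    (hs : s 0 = a * (b 1 + c 2) - N * a * T)
    (hss : ss 1 0 = b 1 * s 1 + c 1 * s 2 + s 1 * (b 1 + c 2) + a * (bb 1 1 + cc 1 2)
      - (n 1 * a + N * s 1) * T) :
    ricciJet (diagJet N a) (admJet₁ N a n b c s) (admJet₂ N a n b c s nn bb cc ss) 0 1
      = -(bb 1 1 + bb 2 2) / 2
        - ((s 1 / a - n 1 / N) * (b 1 - c 2) + (s 2 / a - n 2 / N) * (b 2 + c 1)) / 2 := by
  simp [ricciJet, christoffelJet, diagJet, admJet₁, admJet₂, Fin.sum_univ_three]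
  rw [hss, hs, hcc, hnn]
  field_simp
  ring

theorem ricciJet_adm_zero_two (hN : N ≠ 0) (ha : a ≠ 0) {T : ℝ}
    (hbb : bb 1 2 = bb 2 1) (hnn : nn 0 2 = nn 2 0)
    (hs : s 0 = a * (b 1 + c 2) - N * a * T)
    (hss : ss 2 0 = b 2 * s 1 + c 2 * s 2 + s 2 * (b 1 + c 2) + a * (bb 2 1 + cc 2 2)
      - (n 2 * a + N * s 2) * T) :
    ricciJet (diagJet N a) (admJet₁ N a n b c s) (admJet₂ N a n b c s nn bb cc ss) 0 2
      = -(cc 1 1 + cc 2 2) / 2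
        - ((s 1 / a - n 1 / N) * (b 2 + c 1) - (s 2 / a - n 2 / N) * (b 1 - c 2)) / 2 := by
  simp [ricciJet, christoffelJet, diagJet, admJet₁, admJet₂, Fin.sum_univ_three]
  rw [hss, hs, hbb, hnn]
  field_simp
  ring

/-- This is the lapse equation. The last two terms are `-N² |K|²`, split into trace-free part and
trace. `T'` enters through the derivative of the mean curvature condition along `e₀`. -/
theorem ricciJet_adm_zero_zero (hN : N ≠ 0) (ha : a ≠ 0) {T T' : ℝ}
    (hbb : bb 0 1 = bb 1 0) (hcc : cc 0 2 = cc 2 0)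
    (hs : s 0 = a * (b 1 + c 2) - N * a * T)
    (hss : ss 0 0 = b 0 * s 1 + c 0 * s 2 + s 0 * (b 1 + c 2) + a * (bb 0 1 + cc 0 2)
      - (n 0 * a + N * s 0) * T - N * a * T') :
    ricciJet (diagJet N a) (admJet₁ N a n b c s) (admJet₂ N a n b c s nn bb cc ss) 0 0
      = N * T' + N / a * (nn 1 1 + nn 2 2) - ((b 1 - c 2) ^ 2 + (b 2 + c 1) ^ 2) / 2
        - N ^ 2 * T ^ 2 / 2 := by
  simp [ricciJet, christoffelJet, diagJet, admJet₁, admJet₂, Fin.sum_univ_three]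
  rw [hss, hs, hbb, hcc]
  field_simp
  ring

/-- The terms without `T`, `T'` and lapse are `-Δ log a`, the trace of the Ricci tensor of the slice
metric `a |dx|²`. The Laplacian of the lapse is present too, so this identity controls `Δa` only
after the lapse equation has been used. -/
theorem ricciJet_adm_trace (hN : N ≠ 0) (ha : a ≠ 0) {T T' : ℝ}
    (hbb : bb 0 1 = bb 1 0) (hcc : cc 0 2 = cc 2 0)
    (hs : s 0 = a * (b 1 + c 2) - N * a * T)
    (hss : ss 0 0 = b 0 * s 1 + c 0 * s 2 + s 0 * (b 1 + c 2) + a * (bb 0 1 + cc 0 2)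
      - (n 0 * a + N * s 0) * T - N * a * T') :
    ricciJet (diagJet N a) (admJet₁ N a n b c s) (admJet₂ N a n b c s nn bb cc ss) 1 1
      + ricciJet (diagJet N a) (admJet₁ N a n b c s) (admJet₂ N a n b c s nn bb cc ss) 2 2
      = - (ss 1 1 + ss 2 2) / a + (s 1 ^ 2 + s 2 ^ 2) / a ^ 2 + a * T ^ 2
        - a * T' / N - (nn 1 1 + nn 2 2) / N := by
  simp [ricciJet, christoffelJet, diagJet, admJet₁, admJet₂, Fin.sum_univ_three]
  rw [hss, hs, hbb, hcc]
  field_simp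
  ring

/-! ### Partial derivatives -/

section PartialDerivatives

variable {n : ℕ} {M : Set (Coord n)} {f g : Coord n → ℝ} {x : Coord n} {α β : Fin (n + 1)}

theorem pd_congr (h : f =ᶠ[𝓝 x] g) : pd α f x = pd α g x := by
  simp only [pd, h.fderiv_eq]

theorem pd_congr_of_eqOn (hM : IsOpen M) (h : Set.EqOn f g M) (hx : x ∈ M) :
    pd α f x = pd α g x :=
  pd_congr (h.eventuallyEq_of_mem (hM.mem_nhds hx))

theorem pd_const (c : ℝ) : pd α (fun _ : Coord n => c) x = 0 := by
  simp [pd]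

theorem pd_add (hf : DifferentiableAt ℝ f x) (hg : DifferentiableAt ℝ g x) :
    pd α (fun y => f y + g y) x = pd α f x + pd α g x := by
  simp [pd, fderiv_fun_add hf hg]

theorem pd_sub (hf : DifferentiableAt ℝ f x) (hg : DifferentiableAt ℝ g x) :
    pd α (fun y => f y - g y) x = pd α f x - pd α g x := by
  simp [pd, fderiv_fun_sub hf hg]

theorem pd_neg : pd α (fun y => - f y) x = - pd α f x := by
  simp [pd, fderiv_fun_neg]

theorem pd_mul (hf : DifferentiableAt ℝ f x) (hg : DifferentiableAt ℝ g x) :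
    pd α (fun y => f y * g y) x = f x * pd α g x + pd α f x * g x := by
  simp [pd, fderiv_fun_mul hf hg]
  ring

theorem pd_const_mul (c : ℝ) (hf : DifferentiableAt ℝ f x) :
    pd α (fun y => c * f y) x = c * pd α f x := by
  rw [pd_mul (differentiableAt_const c) hf, pd_const, zero_mul, add_zero]

theorem pd_sum {ι : Type*} (s : Finset ι) {F : ι → Coord n → ℝ}
    (hF : ∀ i ∈ s, DifferentiableAt ℝ (F i) x) :
    pd α (fun y => ∑ i ∈ s, F i y) x = ∑ i ∈ s, pd α (F i) x := by
  simp [pd, fderiv_fun_sum hF]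

theorem pd_comp {φ : ℝ → ℝ} (hφ : DifferentiableAt ℝ φ (f x)) (hf : DifferentiableAt ℝ f x) :
    pd α (fun y => φ (f y)) x = deriv φ (f x) * pd α f x := by
  have := fderiv_comp x hφ hf
  simp only [Function.comp_def] at this
  simp only [pd, this, ContinuousLinearMap.comp_apply]
  rw [fderiv_eq_deriv_mul]

theorem pd_apply (μ : Fin (n + 1)) : pd α (fun y : Coord n => y μ) x = if μ = α then 1 else 0 := by
  have : (fun y : Coord n => y μ) = ContinuousLinearMap.proj (R := ℝ) (φ := fun _ => ℝ) μ := rfl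
  rw [pd, this, ContinuousLinearMap.fderiv]
  simp [Pi.single_apply]

theorem contDiffOn_pd {k m : ℕ∞ω} (hM : IsOpen M) (hf : ContDiffOn ℝ k f M) (h : m + 1 ≤ k) :
    ContDiffOn ℝ m (pd α f) M :=
  (hf.fderiv_of_isOpen hM h).clm_apply contDiffOn_const

theorem contDiff_pd {k m : ℕ∞ω} (hf : ContDiff ℝ k f) (h : m + 1 ≤ k) : ContDiff ℝ m (pd α f) :=
  (hf.fderiv_right h).clm_apply contDiff_const

theorem contDiffOn_one_pd (hM : IsOpen M) (hf : ContDiffOn ℝ 2 f M) :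
    ContDiffOn ℝ 1 (pd α f) M :=
  contDiffOn_pd hM hf (by norm_num)

theorem continuousOn_pd (hM : IsOpen M) (hf : ContDiffOn ℝ 1 f M) : ContinuousOn (pd α f) M :=
  (contDiffOn_pd (m := 0) hM hf (by norm_num)).continuousOn

theorem continuousOn_pd_pd (hM : IsOpen M) (hf : ContDiffOn ℝ 2 f M) :
    ContinuousOn (pd α (pd β f)) M :=
  continuousOn_pd hM (contDiffOn_one_pd hM hf)

theorem differentiableAt_of_contDiffOn {k : ℕ∞ω} (hM : IsOpen M) (hf : ContDiffOn ℝ k f M)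
    (hk : 1 ≤ k) (hx : x ∈ M) : DifferentiableAt ℝ f x :=
  (hf.contDiffAt (hM.mem_nhds hx)).differentiableAt (by positivity)

theorem pd_comm (hM : IsOpen M) (hf : ContDiffOn ℝ 2 f M) (hx : x ∈ M) :
    pd α (pd β f) x = pd β (pd α f) x := by
  have hd : DifferentiableAt ℝ (fderiv ℝ f) x :=
    ((hf.fderiv_of_isOpen hM (m := 1) (by norm_num)).contDiffAt
      (hM.mem_nhds hx)).differentiableAt (by norm_num)
  have key : ∀ γ δ : Fin (n + 1), pd γ (pd δ f) x
      = fderiv ℝ (fderiv ℝ f) x (Pi.single γ 1) (Pi.single δ 1) := by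
    intro γ δ
    have : pd δ f = fun y => fderiv ℝ f y (Pi.single δ 1) := rfl
    rw [pd, this, fderiv_clm_apply hd (differentiableAt_const _)]
    simp
  rw [key, key]
  exact ((hf.contDiffAt (hM.mem_nhds hx)).isSymmSndFDerivAt (by simp)).eq _ _

theorem continuousOn_spatialLaplacian (hM : IsOpen M) (hf : ContDiffOn ℝ 2 f M) :
    ContinuousOn (spatialLaplacian f) M :=
  continuousOn_finsetSum _ fun _ _ => continuousOn_pd_pd hM hf

theorem hasCompactSupport_pd (hf : HasCompactSupport f) : HasCompactSupport (pd α f) :=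
  hf.fderiv_apply ℝ _

theorem tsupport_pd_subset : tsupport (pd α f) ⊆ tsupport f := by
  refine closure_minimal (fun x hx => ?_) (isClosed_tsupport f)
  exact support_fderiv_subset ℝ (fun h => hx (by simp [pd, h]))

/-- The product of a cutoff function supported in `M` with a function smooth on `M`. -/
theorem contDiff_mul_of_tsupport_subset {k : ℕ∞ω} {ζ : Coord n → ℝ} (hM : IsOpen M)
    (hζ : ContDiff ℝ k ζ) (hs : tsupport ζ ⊆ M) (hf : ContDiffOn ℝ k f M) :
    ContDiff ℝ k (fun y => ζ y * f y) := by
  rw [contDiff_iff_contDiffAt]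
  intro x
  by_cases hx : x ∈ tsupport ζ
  · exact hζ.contDiffAt.mul (hf.contDiffAt (hM.mem_nhds (hs hx)))
  · refine (contDiffAt_const (c := (0 : ℝ))).congr_of_eventuallyEq ?_
    filter_upwards [notMem_tsupport_iff_eventuallyEq.1 hx] with y hy
    simp [hy]

theorem continuous_mul_of_tsupport_subset {ζ : Coord n → ℝ} (hM : IsOpen M)
    (hζ : Continuous ζ) (hs : tsupport ζ ⊆ M) (hf : ContinuousOn f M) :
    Continuous (fun y => ζ y * f y) := by
  have := contDiff_mul_of_tsupport_subset (k := 0) hM (contDiff_zero.2 hζ) hs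
    (contDiffOn_zero.2 hf)
  exact this.continuous

theorem integrable_mul_of_tsupport_subset {ζ : Coord n → ℝ} (hM : IsOpen M)
    (hζ : Continuous ζ) (hc : HasCompactSupport ζ) (hs : tsupport ζ ⊆ M) (hf : ContinuousOn f M) :
    Integrable (fun y => ζ y * f y) :=
  (continuous_mul_of_tsupport_subset hM hζ hs hf).integrable_of_hasCompactSupport hc.mul_right

/-- The integral of a partial derivative of a compactly supported function vanishes. -/
theorem integral_pd_eq_zero (hf : ContDiff ℝ 1 f) (hc : HasCompactSupport f) :
    ∫ x, pd α f x = 0 := by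
  have hi : Integrable f := hf.continuous.integrable_of_hasCompactSupport hc
  have hi' : Integrable (pd α f) :=
    (contDiff_pd (m := 0) hf (by norm_num)).continuous.integrable_of_hasCompactSupport
      (hasCompactSupport_pd hc)
  have := integral_mul_fderiv_eq_neg_fderiv_mul_of_integrable (μ := (volume : Measure (Coord n)))
    (f := fun _ => (1 : ℝ)) (g := f) (v := Pi.single α 1) (by simp)
    (by simp only [one_mul]; exact hi') (by simp only [one_mul]; exact hi)
    (fun x _ => differentiableAt_const _) (fun x _ => hf.differentiable (by norm_num) x)
  simpa [pd] using this

/-- Integration by parts against a cutoff function supported in `M`. -/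
theorem integral_pd_mul_of_tsupport_subset (hM : IsOpen M) (hf : ContDiffOn ℝ 1 f M)
    (hg : ContDiff ℝ 1 g) (hc : HasCompactSupport g) (hs : tsupport g ⊆ M) :
    ∫ x, pd α f x * g x = - ∫ x, f x * pd α g x := by
  have h0 := integral_pd_eq_zero (α := α)
    (contDiff_mul_of_tsupport_subset hM hg hs hf) hc.mul_right
  have e : ∀ x, pd α (fun y => g y * f y) x = g x * pd α f x + pd α g x * f x := by
    intro x
    by_cases hx : x ∈ tsupport g
    · exact pd_mul (hg.differentiable (by norm_num) x)
        (differentiableAt_of_contDiffOn hM hf le_rfl (hs hx))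
    · have h1 : pd α g x = 0 := image_eq_zero_of_notMem_tsupport
        (fun h => hx (tsupport_pd_subset h))
      have h2 : pd α (fun y => g y * f y) x = pd α (fun _ => (0 : ℝ)) x := by
        refine pd_congr ?_
        filter_upwards [notMem_tsupport_iff_eventuallyEq.1 hx] with y hy
        simp [hy]
      rw [h2, h1, image_eq_zero_of_notMem_tsupport hx, pd_const]
      ring
  have h1 := integrable_mul_of_tsupport_subset hM hg.continuous hc hs
    (continuousOn_pd (α := α) hM hf)
  have h2 := integrable_mul_of_tsupport_subset hM
    (contDiff_pd (α := α) (m := 0) hg (by norm_num)).continuous (hasCompactSupport_pd hc)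
    (tsupport_pd_subset.trans hs) hf.continuousOn
  simp_rw [e] at h0
  rw [integral_add h1 h2] at h0
  simp_rw [mul_comm (pd α f _), mul_comm (f _)]
  linarith

theorem integral_mul_pd (hf : ContDiff ℝ 1 f) (hg : ContDiff ℝ 1 g) (hc : HasCompactSupport f) :
    ∫ x, f x * pd α g x = - ∫ x, pd α f x * g x := by
  have := integral_pd_mul_of_tsupport_subset (α := α) isOpen_univ hg.contDiffOn hf hc
    (Set.subset_univ _)
  simp_rw [mul_comm (f _), mul_comm _ (g _)]
  exact this

/-- Differentiating a translate replaces a second integration by parts, which would need a second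
derivative of one of the functions. -/
theorem hasDerivAt_integral_mul_translate (γ : Fin (n + 1)) (hf : Continuous f)
    (hcf : HasCompactSupport f) (hg : ContDiff ℝ 1 g) (hcg : HasCompactSupport g) :
    HasDerivAt (fun t : ℝ => ∫ x, f x * g (x + t • Pi.single γ 1)) (∫ x, f x * pd γ g x) 0 := by
  have hg' : Continuous (pd γ g) := (contDiff_pd (m := 0) hg (by norm_num)).continuous
  have hgc : Continuous g := hg.continuous
  obtain ⟨C, hC⟩ := (hasCompactSupport_pd (α := γ) hcg).exists_bound_of_continuous hg'
  have hd : ∀ x : Coord n, ∀ t : ℝ, HasDerivAt (fun t : ℝ => f x * g (x + t • Pi.single γ 1))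
      (f x * pd γ g (x + t • Pi.single γ 1)) t := by
    intro x t
    refine HasDerivAt.const_mul _ ?_
    have h1 : HasDerivAt (fun t : ℝ => x + t • (Pi.single γ 1 : Coord n)) (Pi.single γ 1) t := by
      simpa using ((hasDerivAt_id t).smul_const (Pi.single γ 1 : Coord n)).const_add x
    have h2 := (hg.differentiable (by norm_num) (x + t • Pi.single γ 1)).hasFDerivAt
    exact h2.comp_hasDerivAt t h1
  have hint : Integrable (fun x => f x * g (x + (0 : ℝ) • Pi.single γ 1)) :=
    Continuous.integrable_of_hasCompactSupport (by fun_prop) hcf.mul_right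
  have hmeas : ∀ t : ℝ, AEStronglyMeasurable (fun x => f x * g (x + t • Pi.single γ 1)) volume :=
    fun t => Continuous.aestronglyMeasurable (by fun_prop)
  have hmeas' : AEStronglyMeasurable (fun x => f x * pd γ g (x + (0 : ℝ) • Pi.single γ 1))
      volume := Continuous.aestronglyMeasurable (by fun_prop)
  have hb : Integrable (fun x => ‖f x‖ * C) :=
    Continuous.integrable_of_hasCompactSupport (by fun_prop) hcf.norm.mul_right
  have hle : ∀ᵐ x : Coord n, ∀ t ∈ (Set.univ : Set ℝ),
      ‖f x * pd γ g (x + t • (Pi.single γ 1 : Coord n))‖ ≤ ‖f x‖ * C :=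
    ae_of_all _ fun x t _ => by
      rw [norm_mul]; exact mul_le_mul_of_nonneg_left (hC _) (norm_nonneg _)
  have hda : ∀ᵐ x : Coord n, ∀ t ∈ (Set.univ : Set ℝ),
      HasDerivAt (fun t : ℝ => f x * g (x + t • (Pi.single γ 1 : Coord n)))
        (f x * pd γ g (x + t • Pi.single γ 1)) t := ae_of_all _ fun x t _ => hd x t
  have := (hasDerivAt_integral_of_dominated_loc_of_deriv_le univ_mem
    (Eventually.of_forall hmeas) hint hmeas' hle hb hda).2
  simp only [zero_smul, add_zero] at this
  exact this

/-- The integral of the Jacobian of two compactly supported functions vanishes. -/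
theorem integral_pd_mul_pd_comm (hf : ContDiff ℝ 1 f) (hg : ContDiff ℝ 1 g)
    (hcf : HasCompactSupport f) (hcg : HasCompactSupport g) :
    ∫ x, pd α f x * pd β g x = ∫ x, pd β f x * pd α g x := by
  have cont : ∀ {h : Coord n → ℝ} (γ : Fin (n + 1)), ContDiff ℝ 1 h → Continuous (pd γ h) :=
    fun γ hh => (contDiff_pd (m := 0) hh (by norm_num)).continuous
  -- With `f` and `g` only `C¹`, the mixed second derivatives are unavailable. Instead `g` is
  -- translated along `β`, one integration by parts moves `∂_α` onto it, and a change of variables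
  -- moves the translation onto `f`. Comparing the derivatives at `t = 0` gives the claim.
  have key : ∀ t : ℝ, ∫ x, pd α f x * g (x + t • Pi.single β 1)
      = - ∫ x, pd α g x * f (x + (-t) • Pi.single β 1) := by
    intro t
    have hsh : ContDiff ℝ 1 (fun x => g (x + t • Pi.single β 1)) :=
      hg.comp (contDiff_id.add contDiff_const)
    have h1 := integral_mul_pd (α := α) hf hsh hcf
    have h2 : ∀ x, pd α (fun x => g (x + t • Pi.single β 1)) x
        = pd α g (x + t • Pi.single β 1) := by
      intro x
      simp only [pd]
      rw [fderiv_comp_add_right]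
    simp_rw [h2] at h1
    have h3 := integral_add_right_eq_self (μ := (volume : Measure (Coord n)))
      (fun x => pd α g x * f (x + (-t) • Pi.single β 1)) (t • Pi.single β 1)
    have h4 : ∀ x : Coord n, x + t • Pi.single β 1 + (-t) • Pi.single β 1 = x := by
      intro x; simp
    simp_rw [h4] at h3
    rw [← h3]
    simp_rw [mul_comm (pd α g _)]
    linarith
  have d1 := hasDerivAt_integral_mul_translate β (cont α hf) (hasCompactSupport_pd hcf) hg hcg
  have d2 := hasDerivAt_integral_mul_translate β (cont α hg) (hasCompactSupport_pd hcg) hf hcf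
  have d3 : HasDerivAt (fun t : ℝ => - ∫ x, pd α g x * f (x + (-t) • Pi.single β 1))
      (∫ x, pd α g x * pd β f x) 0 := by
    have d2' : HasDerivAt (fun t : ℝ => ∫ x, pd α g x * f (x + t • Pi.single β 1))
        (∫ x, pd α g x * pd β f x) (-(0 : ℝ)) := by simpa using d2
    have := (HasDerivAt.comp (0 : ℝ) d2' (hasDerivAt_neg (0 : ℝ))).neg
    have e : (-((fun t : ℝ => ∫ x, pd α g x * f (x + t • Pi.single β 1)) ∘ Neg.neg))
        = fun t : ℝ => - ∫ x, pd α g x * f (x + (-t) • Pi.single β 1) := rfl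
    rw [e] at this
    simpa only [mul_neg, mul_one, neg_neg] using this
  have := d1.unique (d3.congr_of_eventuallyEq (Eventually.of_forall key))
  rw [this]
  simp_rw [mul_comm (pd α g _)]

end PartialDerivatives

/-! ### A local Gagliardo–Nirenberg inequality in the spatial variables -/

section GagliardoNirenberg

variable {n : ℕ} {M : Set (Coord n)}

/-- The pure second derivatives are controlled by the Laplacian. -/
theorem sum_integral_sq_pd_pd_le {z : Coord n → ℝ} (hz : ContDiff ℝ 2 z)
    (hc : HasCompactSupport z) :
    ∑ i : Fin n, ∫ x, pd i.succ (pd i.succ z) x ^ 2 ≤ ∫ x, spatialLaplacian z x ^ 2 := by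
  have h1 : ∀ α, ContDiff ℝ 1 (pd α z) := fun α => contDiff_pd hz (by norm_num)
  have hc1 : ∀ α, HasCompactSupport (pd α z) := fun α => hasCompactSupport_pd hc
  have h2 : ∀ α β, Continuous (pd α (pd β z)) := fun α β =>
    (contDiff_pd (m := 0) (h1 β) (by norm_num)).continuous
  have hc2 : ∀ α β, HasCompactSupport (pd α (pd β z)) := fun α β => hasCompactSupport_pd (hc1 β)
  have hint : ∀ α β γ δ, Integrable (fun x => pd α (pd β z) x * pd γ (pd δ z) x) :=
    fun α β γ δ => ((h2 α β).mul (h2 γ δ)).integrable_of_hasCompactSupport (hc2 α β).mul_right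
  have e : ∫ x, spatialLaplacian z x ^ 2
      = ∑ i : Fin n, ∑ j : Fin n, ∫ x, pd j.succ (pd i.succ z) x ^ 2 := by
    have : ∀ x, spatialLaplacian z x ^ 2
        = ∑ i : Fin n, ∑ j : Fin n, pd i.succ (pd i.succ z) x * pd j.succ (pd j.succ z) x := by
      intro x
      rw [spatialLaplacian, sq, Finset.sum_mul_sum]
    simp_rw [this]
    rw [integral_finsetSum _ fun i _ => integrable_finsetSum _ fun j _ => hint _ _ _ _]
    refine Finset.sum_congr rfl fun i _ => ?_
    rw [integral_finsetSum _ fun j _ => hint _ _ _ _]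
    refine Finset.sum_congr rfl fun j _ => ?_
    -- The exchange turns `∂ᵢ∂ᵢz ∂ⱼ∂ⱼz` into `∂ⱼ∂ᵢz ∂ᵢ∂ⱼz`, a square by symmetry of second
    -- derivatives.
    rw [integral_pd_mul_pd_comm (h1 _) (h1 _) (hc1 _) (hc1 _)]
    refine integral_congr_ae (ae_of_all _ fun x => ?_)
    simp only
    rw [pd_comm isOpen_univ hz.contDiffOn (Set.mem_univ x) (α := i.succ) (β := j.succ), sq]
  rw [e]
  refine Finset.sum_le_sum fun i _ => ?_
  exact Finset.single_le_sum (f := fun j : Fin n => ∫ x, pd j.succ (pd i.succ z) x ^ 2)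
    (fun j _ => integral_nonneg fun x => sq_nonneg _) (Finset.mem_univ i)

theorem pd_pd_mul (hM : IsOpen M) {f g : Coord n → ℝ} (hf : ContDiffOn ℝ 2 f M)
    (hg : ContDiffOn ℝ 2 g M) {x : Coord n} (hx : x ∈ M) (α β : Fin (n + 1)) :
    pd α (pd β (fun y => f y * g y)) x = f x * pd α (pd β g) x + pd α f x * pd β g x
      + pd β f x * pd α g x + pd α (pd β f) x * g x := by
  have d : ∀ {h : Coord n → ℝ}, ContDiffOn ℝ 2 h M → ∀ y ∈ M, DifferentiableAt ℝ h y :=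
    fun hh y hy => differentiableAt_of_contDiffOn hM hh (by norm_num) hy
  have d' : ∀ {h : Coord n → ℝ} γ, ContDiffOn ℝ 2 h M → DifferentiableAt ℝ (pd γ h) x :=
    fun γ hh => differentiableAt_of_contDiffOn hM (contDiffOn_one_pd hM hh) le_rfl hx
  have e : Set.EqOn (pd β (fun y => f y * g y)) (fun y => f y * pd β g y + pd β f y * g y) M :=
    fun y hy => pd_mul (d hf y hy) (d hg y hy)
  rw [pd_congr_of_eqOn hM e hx, pd_add (f := fun y => f y * pd β g y)
    (g := fun y => pd β f y * g y) ((d hf x hx).mul (d' β hg)) ((d' β hf).mul (d hg x hx)),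
    pd_mul (d hf x hx) (d' β hg), pd_mul (d' β hf) (d hg x hx)]
  ring

theorem spatialLaplacian_mul (hM : IsOpen M) {f g : Coord n → ℝ} (hf : ContDiffOn ℝ 2 f M)
    (hg : ContDiffOn ℝ 2 g M) {x : Coord n} (hx : x ∈ M) :
    spatialLaplacian (fun y => f y * g y) x = f x * spatialLaplacian g x
      + 2 * ∑ i : Fin n, pd i.succ f x * pd i.succ g x + spatialLaplacian f x * g x := by
  simp only [spatialLaplacian, pd_pd_mul hM hf hg hx, Finset.sum_add_distrib, ← Finset.mul_sum,
    ← Finset.sum_mul]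
  ring

variable {ζ : Coord n → ℝ}

theorem setIntegral_tsupport_eq {f : Coord n → ℝ} (h : tsupport f ⊆ tsupport ζ) :
    ∫ x in tsupport ζ, f x = ∫ x, f x :=
  setIntegral_eq_integral_of_forall_compl_eq_zero fun _ hx =>
    image_eq_zero_of_notMem_tsupport fun h' => hx (h h')

theorem tsupport_mul_subset' {f : Coord n → ℝ} : tsupport (fun x => ζ x * f x) ⊆ tsupport ζ :=
  closure_mono fun x hx => by
    simp only [Function.mem_support] at hx ⊢
    exact left_ne_zero_of_mul hx

theorem exists_bound_cutoff (hζ : ContDiff ℝ 2 ζ) (hc : HasCompactSupport ζ) :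
    ∃ B : ℝ, 0 ≤ B ∧ ∀ x, (∑ i : Fin n, pd i.succ ζ x ^ 2) ≤ B ∧ spatialLaplacian ζ x ^ 2 ≤ B ∧
      ∀ i : Fin n, |ζ x * pd i.succ (pd i.succ ζ) x| ≤ B := by
  have h1 : ∀ α, ContDiff ℝ 1 (pd α ζ) := fun α => contDiff_pd hζ (by norm_num)
  have h2 : ∀ α β, Continuous (pd α (pd β ζ)) := fun α β =>
    (contDiff_pd (m := 0) (h1 β) (by norm_num)).continuous
  have h3 : Continuous (spatialLaplacian ζ) := continuous_finsetSum _ fun _ _ => h2 _ _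
  have key : ∀ f : Coord n → ℝ, Continuous f → ∃ B : ℝ, 0 ≤ B ∧ ∀ x ∈ tsupport ζ, |f x| ≤ B := by
    intro f hf
    obtain ⟨B, hB⟩ := hc.isCompact.exists_bound_of_continuousOn hf.continuousOn
    exact ⟨|B|, abs_nonneg _, fun x hx => (hB x hx).trans (le_abs_self B)⟩
  obtain ⟨B, hB0, hB⟩ := key (fun x => (∑ i : Fin n, pd i.succ ζ x ^ 2)
      + spatialLaplacian ζ x ^ 2 + ∑ i : Fin n, |ζ x * pd i.succ (pd i.succ ζ) x|) (by
    have hζc := hζ.continuous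
    have := fun α => (h1 α).continuous
    fun_prop)
  refine ⟨B, hB0, fun x => ?_⟩
  have p1 : 0 ≤ ∑ i : Fin n, pd i.succ ζ x ^ 2 := Finset.sum_nonneg fun _ _ => sq_nonneg _
  have p2 : 0 ≤ ∑ i : Fin n, |ζ x * pd i.succ (pd i.succ ζ) x| :=
    Finset.sum_nonneg fun _ _ => abs_nonneg _
  have p3 := sq_nonneg (spatialLaplacian ζ x)
  by_cases hx : x ∈ tsupport ζ
  · have := (le_abs_self _).trans (hB x hx)
    refine ⟨by linarith, by linarith, fun i => ?_⟩
    have := Finset.single_le_sum (f := fun i : Fin n => |ζ x * pd i.succ (pd i.succ ζ) x|)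
      (fun j _ => abs_nonneg _) (Finset.mem_univ i)
    linarith
  · have z0 : ζ x = 0 := image_eq_zero_of_notMem_tsupport hx
    have z1 : ∀ α, pd α ζ x = 0 := fun α =>
      image_eq_zero_of_notMem_tsupport fun h => hx (tsupport_pd_subset h)
    have z2 : ∀ α, pd α (pd α ζ) x = 0 := fun α => image_eq_zero_of_notMem_tsupport fun h =>
      hx (tsupport_pd_subset (tsupport_pd_subset h))
    simp [z0, z1, z2, spatialLaplacian, hB0]

/-- The pointwise identity behind the Gagliardo–Nirenberg inequality. -/
theorem pd_mul_sq_mul_cube (hM : IsOpen M) (hζ : ContDiff ℝ 2 ζ) {w : Coord n → ℝ}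
    (hw : ContDiffOn ℝ 2 w M) {x : Coord n} (hx : x ∈ M) (i : Fin (n + 1)) :
    pd i (fun y => ζ y * (ζ y * (w y * (pd i w y * (pd i w y * pd i w y))))) x
      = ζ x ^ 2 * pd i w x ^ 4 + 3 * w x * ζ x * pd i w x ^ 2 * pd i (pd i (fun y => ζ y * w y)) x
        - 4 * w x * ζ x * pd i ζ x * pd i w x ^ 3
        - 3 * w x ^ 2 * (ζ x * pd i (pd i ζ) x) * pd i w x ^ 2 := by
  have dζ : DifferentiableAt ℝ ζ x := hζ.differentiable (by norm_num) x
  have dw : DifferentiableAt ℝ w x := differentiableAt_of_contDiffOn hM hw (by norm_num) hx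
  have dw' : DifferentiableAt ℝ (pd i w) x :=
    differentiableAt_of_contDiffOn hM (contDiffOn_one_pd hM hw) le_rfl hx
  rw [pd_mul dζ (by fun_prop), pd_mul dζ (by fun_prop), pd_mul dw (by fun_prop),
    pd_mul dw' (by fun_prop), pd_mul dw' dw', pd_pd_mul hM hζ.contDiffOn hw hx]
  ring

/-- Here `p = ∂ᵢw`, `z = ∂ᵢ∂ᵢ(ζw)`, `q = ∂ᵢζ` and `r = ζ ∂ᵢ∂ᵢζ`. The first bracket on the right is
the derivative of `ζ² w (∂ᵢw)³`. Each error term carries a factor `w`, hence a factor `δ`; what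
multiplies it is split by Young's inequality. The constants add up as `3/2 + 2 = 7/2` and `2B + 3B =
5B`, and `δ ≤ 1` serves to bound `w²` by `δ`. -/
theorem cutoff_pointwise_bound {ζ w p z q r B δ : ℝ} (hδ : |w| ≤ δ) (hδ1 : δ ≤ 1)
    (hq : q ^ 2 ≤ B) (hr : |r| ≤ B) :
    ζ ^ 2 * p ^ 4 ≤ (ζ ^ 2 * p ^ 4 + 3 * w * ζ * p ^ 2 * z - 4 * w * ζ * q * p ^ 3
        - 3 * w ^ 2 * r * p ^ 2)
      + δ * (7 / 2 * (ζ ^ 2 * p ^ 4) + 3 / 2 * z ^ 2 + 5 * B * p ^ 2) := by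
  have hδ0 : 0 ≤ δ := (abs_nonneg w).trans hδ
  have h1 : -(3 * w * ζ * p ^ 2 * z) ≤ δ * (3 / 2 * (ζ ^ 2 * p ^ 4) + 3 / 2 * z ^ 2) := by
    have : |ζ * p ^ 2 * z| ≤ (ζ ^ 2 * p ^ 4 + z ^ 2) / 2 := by
      rw [abs_le]
      constructor <;> nlinarith [sq_nonneg (ζ * p ^ 2 - z), sq_nonneg (ζ * p ^ 2 + z)]
    have h2 : |w * (ζ * p ^ 2 * z)| ≤ δ * ((ζ ^ 2 * p ^ 4 + z ^ 2) / 2) := by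
      rw [abs_mul]; exact mul_le_mul hδ this (abs_nonneg _) hδ0
    have := (abs_le.1 h2).1
    nlinarith
  have h2 : 4 * w * ζ * q * p ^ 3 ≤ δ * (2 * (ζ ^ 2 * p ^ 4) + 2 * B * p ^ 2) := by
    have : |ζ * q * p ^ 3| ≤ (ζ ^ 2 * p ^ 4 + B * p ^ 2) / 2 := by
      have : q ^ 2 * p ^ 2 ≤ B * p ^ 2 := mul_le_mul_of_nonneg_right hq (sq_nonneg p)
      rw [abs_le]
      constructor <;> nlinarith [sq_nonneg (ζ * p ^ 2 - q * p), sq_nonneg (ζ * p ^ 2 + q * p)]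
    have h2 : |w * (ζ * q * p ^ 3)| ≤ δ * ((ζ ^ 2 * p ^ 4 + B * p ^ 2) / 2) := by
      rw [abs_mul]; exact mul_le_mul hδ this (abs_nonneg _) hδ0
    have := (abs_le.1 h2).2
    nlinarith
  have h3 : 3 * w ^ 2 * r * p ^ 2 ≤ δ * (3 * B * p ^ 2) := by
    have hw : w ^ 2 ≤ δ := by
      rw [← sq_abs]
      nlinarith [abs_nonneg w]
    have : w ^ 2 * r ≤ δ * B := by
      calc w ^ 2 * r ≤ w ^ 2 * |r| := mul_le_mul_of_nonneg_left (le_abs_self r) (sq_nonneg w)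
        _ ≤ δ * B := mul_le_mul hw hr (abs_nonneg r) hδ0
    nlinarith [mul_le_mul_of_nonneg_right this (sq_nonneg p)]
  nlinarith

/-- If `w` is small on the support of the cutoff function `ζ`, then its spatial gradient is small
in `L⁴`, relative to its Laplacian in `L²`. -/
theorem exists_gagliardo_nirenberg (hM : IsOpen M) (hζ : ContDiff ℝ 2 ζ)
    (hc : HasCompactSupport ζ) (hs : tsupport ζ ⊆ M) :
    ∃ C : ℝ, 0 ≤ C ∧ ∀ w : Coord n → ℝ, ContDiffOn ℝ 2 w M → ∀ δ ≤ 1,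
      0 ≤ δ → (∀ x ∈ tsupport ζ, |w x| ≤ δ) →
      ∑ i : Fin n, ∫ x in tsupport ζ, ζ x ^ 2 * pd i.succ w x ^ 4
        ≤ δ * (10 * (∑ i : Fin n, (∫ x in tsupport ζ, ζ x ^ 2 * pd i.succ w x ^ 4)
          + (∫ x in tsupport ζ, ζ x ^ 2 * spatialLaplacian w x ^ 2))
          + C * (∑ i : Fin n, (∫ x in tsupport ζ, pd i.succ w x ^ 2) + 1)) := by
  obtain ⟨B, hB0, hB⟩ := exists_bound_cutoff hζ hc
  set K := tsupport ζ with hK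
  have hKc : IsCompact K := hc.isCompact
  have hKm : MeasurableSet K := hKc.measurableSet
  set V := (volume K).toReal with hV
  have hV0 : 0 ≤ V := ENNReal.toReal_nonneg
  -- Inserting the Hessian estimate below into the sum of the directional estimates produces `5B +
  -- 3/2 · 12B = 23B` in front of the gradients and the constant `3/2 · 3BV = 9/2 · BV`. Both are
  -- majorised by this choice, and `7/2` and `9/2` by `10`.
  refine ⟨30 * B + 5 * B * V, by positivity, fun w hw δ hδ1 hδ0 hwδ => ?_⟩
  have hζc : ContinuousOn ζ M := hζ.continuous.continuousOn
  have hwc : ContinuousOn w M := hw.continuousOn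
  have hwi : ∀ i, ContinuousOn (pd i w) M := fun i => continuousOn_pd hM (hw.of_le (by norm_num))
  have hΔ : ContinuousOn (spatialLaplacian w) M := continuousOn_spatialLaplacian hM hw
  have hz : ContDiff ℝ 2 (fun y => ζ y * w y) := contDiff_mul_of_tsupport_subset hM hζ hs hw
  have hzc : HasCompactSupport (fun y => ζ y * w y) := hc.mul_right
  have hzii : ∀ i, Continuous (pd i (pd i (fun y => ζ y * w y))) := fun i =>
    (contDiff_pd (m := 0) (contDiff_pd (m := 1) hz (by norm_num)) (by norm_num)).continuous
  have hzs : ∀ i, tsupport (pd i (pd i (fun y => ζ y * w y))) ⊆ K := fun i =>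
    tsupport_pd_subset.trans (tsupport_pd_subset.trans tsupport_mul_subset')
  have hI : ∀ f : Coord n → ℝ, ContinuousOn f M → IntegrableOn f K := fun f hf =>
    (hf.mono hs).integrableOn_compact hKc
  set z := fun y => ζ y * w y with hzdef
  have hi4 : ∀ i, IntegrableOn (fun x => ζ x ^ 2 * pd i w x ^ 4) K := fun i =>
    hI _ ((hζc.pow 2).mul ((hwi i).pow 4))
  have hi2 : ∀ i, IntegrableOn (fun x => pd i w x ^ 2) K := fun i => hI _ ((hwi i).pow 2)
  have hiz : ∀ i, IntegrableOn (fun x => pd i (pd i z) x ^ 2) K := fun i =>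
    hI _ ((hzii i).continuousOn.pow 2)
  have hiL : IntegrableOn (fun x => ζ x ^ 2 * spatialLaplacian w x ^ 2) K :=
    hI _ ((hζc.pow 2).mul (hΔ.pow 2))
  have step : ∀ i : Fin n, ∫ x in K, ζ x ^ 2 * pd i.succ w x ^ 4 ≤
      δ * (7 / 2 * (∫ x in K, ζ x ^ 2 * pd i.succ w x ^ 4)
        + 3 / 2 * (∫ x in K, pd i.succ (pd i.succ z) x ^ 2)
        + 5 * B * ∫ x in K, pd i.succ w x ^ 2) := by
    intro i
    have hw1 := contDiffOn_one_pd (α := i.succ) hM hw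
    have hh : ContDiff ℝ 1 (fun y => ζ y * (ζ y * (w y * (pd i.succ w y *
        (pd i.succ w y * pd i.succ w y))))) :=
      contDiff_mul_of_tsupport_subset hM (hζ.of_le (by norm_num)) hs
        ((hζ.of_le (by norm_num)).contDiffOn.mul ((hw.of_le (by norm_num)).mul
          (hw1.mul (hw1.mul hw1))))
    -- The integral of `∂ᵢ(ζ² w (∂ᵢw)³)` vanishes, so the pointwise bound leaves only terms with the
    -- factor `δ`.
    have h0 := integral_pd_eq_zero (α := i.succ) hh hc.mul_right
    rw [← setIntegral_tsupport_eq (ζ := ζ) (tsupport_pd_subset.trans tsupport_mul_subset')] at h0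
    have hint := hI _ (contDiff_pd (α := i.succ) (m := 0) hh
      (by norm_num)).continuous.continuousOn
    have hR : IntegrableOn (fun x => 7 / 2 * (ζ x ^ 2 * pd i.succ w x ^ 4)
        + 3 / 2 * pd i.succ (pd i.succ z) x ^ 2 + 5 * B * pd i.succ w x ^ 2) K :=
      (((hi4 _).const_mul _).add ((hiz _).const_mul _)).add ((hi2 _).const_mul _)
    have hR' : IntegrableOn (fun x => 7 / 2 * (ζ x ^ 2 * pd i.succ w x ^ 4)
        + 3 / 2 * pd i.succ (pd i.succ z) x ^ 2) K :=
      ((hi4 _).const_mul _).add ((hiz _).const_mul _)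
    calc ∫ x in K, ζ x ^ 2 * pd i.succ w x ^ 4
        ≤ ∫ x in K, (pd i.succ (fun y => ζ y * (ζ y * (w y * (pd i.succ w y *
            (pd i.succ w y * pd i.succ w y))))) x
          + δ * (7 / 2 * (ζ x ^ 2 * pd i.succ w x ^ 4)
            + 3 / 2 * pd i.succ (pd i.succ z) x ^ 2 + 5 * B * pd i.succ w x ^ 2)) := by
          refine setIntegral_mono_on (hi4 _) (hint.add (hR.const_mul δ)) hKm fun x hx => ?_
          rw [pd_mul_sq_mul_cube hM hζ hw (hs hx)]
          refine cutoff_pointwise_bound (hwδ x hx) hδ1 ?_ ((hB x).2.2 i)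
          exact (Finset.single_le_sum (f := fun i : Fin n => pd i.succ ζ x ^ 2)
            (fun j _ => sq_nonneg _) (Finset.mem_univ i)).trans (hB x).1
      _ = _ := by
          rw [integral_add hint (hR.const_mul δ), h0, zero_add, integral_const_mul,
            integral_add hR' ((hi2 _).const_mul _),
              integral_add ((hi4 _).const_mul _) ((hiz _).const_mul _), integral_const_mul,
            integral_const_mul, integral_const_mul]
  -- The second derivatives of `ζw` are controlled by `Δ(ζw) = ζ Δw + 2 ∇ζ·∇w + w Δζ`. The constants
  -- come from `(x + y + z)² ≤ 3(x² + y² + z²)`, Cauchy–Schwarz for the middle term, and `|w| ≤ 1`.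
  have hess : ∑ i : Fin n, ∫ x in K, pd i.succ (pd i.succ z) x ^ 2
      ≤ 3 * (∫ x in K, ζ x ^ 2 * spatialLaplacian w x ^ 2)
        + 12 * B * (∑ i : Fin n, ∫ x in K, pd i.succ w x ^ 2) + 3 * B * V := by
    have e1 : ∀ i : Fin n, ∫ x in K, pd i.succ (pd i.succ z) x ^ 2
        = ∫ x, pd i.succ (pd i.succ z) x ^ 2 := fun i =>
      setIntegral_eq_integral_of_forall_compl_eq_zero fun x hx => by
        rw [image_eq_zero_of_notMem_tsupport fun h => hx (hzs _ h)]; norm_num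
    have e2 : ∫ x in K, spatialLaplacian z x ^ 2 = ∫ x, spatialLaplacian z x ^ 2 :=
      setIntegral_eq_integral_of_forall_compl_eq_zero fun x hx => by
        have : spatialLaplacian z x = 0 := Finset.sum_eq_zero fun i _ =>
          image_eq_zero_of_notMem_tsupport fun h => hx (hzs _ h)
        rw [this]; norm_num
    simp_rw [e1]
    refine (sum_integral_sq_pd_pd_le hz hzc).trans ?_
    rw [← e2]
    have hG : IntegrableOn (fun x => ∑ i : Fin n, pd i.succ w x ^ 2) K :=
      integrable_finsetSum _ fun i _ => hi2 _
    have hconst : IntegrableOn (fun _ : Coord n => 3 * B) K :=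
      continuousOn_const.integrableOn_compact hKc
    have hLG : IntegrableOn (fun x => 3 * (ζ x ^ 2 * spatialLaplacian w x ^ 2)
        + 12 * B * ∑ i : Fin n, pd i.succ w x ^ 2) K :=
      (hiL.const_mul _).add (hG.const_mul _)
    calc ∫ x in K, spatialLaplacian z x ^ 2
        ≤ ∫ x in K, (3 * (ζ x ^ 2 * spatialLaplacian w x ^ 2)
          + 12 * B * (∑ i : Fin n, pd i.succ w x ^ 2) + 3 * B) := by
          refine setIntegral_mono_on (hI _ ((continuousOn_spatialLaplacian hM
            hz.contDiffOn).pow 2)) (((hiL.const_mul _).add (hG.const_mul _)).add hconst) hKm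
            fun x hx => ?_
          rw [hzdef, spatialLaplacian_mul hM hζ.contDiffOn hw (hs hx)]
          have cs := Finset.sum_mul_sq_le_sq_mul_sq Finset.univ
            (fun i : Fin n => pd i.succ ζ x) (fun i => pd i.succ w x)
          set S := ∑ i : Fin n, pd i.succ ζ x * pd i.succ w x
          have hG0 : 0 ≤ ∑ i : Fin n, pd i.succ w x ^ 2 := Finset.sum_nonneg fun _ _ => sq_nonneg _
          have cs' : S ^ 2 ≤ B * ∑ i : Fin n, pd i.succ w x ^ 2 :=
            cs.trans (mul_le_mul_of_nonneg_right (hB x).1 hG0)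
          have hw1 : w x ^ 2 ≤ 1 := by
            rw [← sq_abs]
            nlinarith [abs_nonneg (w x), hwδ x hx]
          have hl : (spatialLaplacian ζ x * w x) ^ 2 ≤ B := by
            rw [mul_pow]
            nlinarith [(hB x).2.1, sq_nonneg (spatialLaplacian ζ x), sq_nonneg (w x)]
          nlinarith [sq_nonneg (ζ x * spatialLaplacian w x - 2 * S),
            sq_nonneg (ζ x * spatialLaplacian w x - spatialLaplacian ζ x * w x),
            sq_nonneg (2 * S - spatialLaplacian ζ x * w x)]
      _ = _ := by
          rw [integral_add hLG hconst,
            integral_add (hiL.const_mul _) (hG.const_mul _), integral_const_mul,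
            integral_const_mul, integral_finsetSum _ fun i _ => hi2 _]
          simp [hV, Measure.real]
          ring
  have total := Finset.sum_le_sum fun i (_ : i ∈ Finset.univ) => step i
  simp only [Finset.sum_add_distrib, ← Finset.mul_sum] at total
  set I := ∑ i : Fin n, ∫ x in K, ζ x ^ 2 * pd i.succ w x ^ 4
  set G := ∑ i : Fin n, ∫ x in K, pd i.succ w x ^ 2
  set H := ∑ i : Fin n, ∫ x in K, pd i.succ (pd i.succ z) x ^ 2
  set Λ := ∫ x in K, ζ x ^ 2 * spatialLaplacian w x ^ 2
  have hI0 : 0 ≤ I := Finset.sum_nonneg fun i _ => integral_nonneg fun x => by positivity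
  have hG0 : 0 ≤ G := Finset.sum_nonneg fun i _ => integral_nonneg fun x => by positivity
  have hΛ0 : 0 ≤ Λ := integral_nonneg fun x => by positivity
  refine total.trans ?_
  refine mul_le_mul_of_nonneg_left ?_ hδ0
  have hBG := mul_nonneg hB0 hG0
  have hBV := mul_nonneg hB0 hV0
  have hBVG := mul_nonneg hBV hG0
  nlinarith

end GagliardoNirenberg

/-! ### Sequences bounded or convergent in local function spaces -/

section LocalSpaces

variable {n : ℕ} {M : Set (Coord n)} {f g : ℕ → Coord n → ℝ} {f₀ g₀ : Coord n → ℝ}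

/-- The integrals of `f k` over each compact subset of `M` are bounded above. -/
def BddIntegrals (M : Set (Coord n)) (f : ℕ → Coord n → ℝ) : Prop :=
  ∀ K ⊆ M, IsCompact K → ∃ C : ℝ, ∀ k, ∫ x in K, f k x ≤ C

theorem BddIntegrals.of_le (hg : BddIntegrals M g) (hf : ∀ k, ContinuousOn (f k) M)
    (hgc : ∀ k, ContinuousOn (g k) M)
    (h : ∀ K ⊆ M, IsCompact K → ∃ C : ℝ, 0 ≤ C ∧ ∀ k, ∀ x ∈ K, f k x ≤ C * g k x) :
    BddIntegrals M f := by
  intro K hK hc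
  obtain ⟨C, hC0, hC⟩ := h K hK hc
  obtain ⟨D, hD⟩ := hg K hK hc
  refine ⟨C * D, fun k => ?_⟩
  calc ∫ x in K, f k x ≤ ∫ x in K, C * g k x :=
        setIntegral_mono_on (((hf k).mono hK).integrableOn_compact hc)
          ((((hgc k).mono hK).integrableOn_compact hc).const_mul C) hc.measurableSet (hC k)
    _ = C * ∫ x in K, g k x := integral_const_mul _ _
    _ ≤ C * D := mul_le_mul_of_nonneg_left (hD k) hC0

theorem BddIntegrals.add (hf : BddIntegrals M f) (hg : BddIntegrals M g)
    (hfc : ∀ k, ContinuousOn (f k) M) (hgc : ∀ k, ContinuousOn (g k) M) :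
    BddIntegrals M (fun k x => f k x + g k x) := by
  intro K hK hc
  obtain ⟨C, hC⟩ := hf K hK hc
  obtain ⟨D, hD⟩ := hg K hK hc
  refine ⟨C + D, fun k => ?_⟩
  rw [integral_add (((hfc k).mono hK).integrableOn_compact hc)
    (((hgc k).mono hK).integrableOn_compact hc)]
  exact add_le_add (hC k) (hD k)

theorem BddIntegrals.sum {ι : Type*} (s : Finset ι) {F : ι → ℕ → Coord n → ℝ}
    (hF : ∀ i, BddIntegrals M (F i)) (hFc : ∀ i k, ContinuousOn (F i k) M) :
    BddIntegrals M (fun k x => ∑ i ∈ s, F i k x) := by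
  intro K hK hc
  choose C hC using fun i => hF i K hK hc
  refine ⟨∑ i ∈ s, C i, fun k => ?_⟩
  rw [integral_finsetSum _ fun i _ => ((hFc i k).mono hK).integrableOn_compact hc]
  exact Finset.sum_le_sum fun i _ => hC i k

theorem BddIntegrals.const (c : ℝ) : BddIntegrals M (fun _ _ => c) :=
  fun _ _ _ => ⟨_, fun _ => le_rfl⟩

theorem BddIntegrals.congr (hf : BddIntegrals M f) (h : ∀ k, Set.EqOn (f k) (g k) M) :
    BddIntegrals M g := by
  intro K hK hc
  obtain ⟨C, hC⟩ := hf K hK hc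
  refine ⟨C, fun k => ?_⟩
  rw [← setIntegral_congr_fun hc.measurableSet fun x hx => h k (hK hx)]
  exact hC k

theorem memLp_of_continuousOn {K : Set (Coord n)} (hK : IsCompact K) {u : Coord n → ℝ}
    (hu : ContinuousOn u K) (p : ℝ≥0∞) : MemLp u p (volume.restrict K) := by
  obtain ⟨C, hC⟩ := hK.exists_bound_of_continuousOn hu
  have : IsFiniteMeasure (volume.restrict K) := ⟨by simpa using hK.measure_lt_top⟩
  exact MemLp.of_bound (hu.aestronglyMeasurable hK.measurableSet) C
    ((ae_restrict_iff' hK.measurableSet).2 (ae_of_all _ hC))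

theorem eLpNorm_eq_integral_pow {K : Set (Coord n)} (hK : IsCompact K) {u : Coord n → ℝ}
    (hu : ContinuousOn u K) {p : ℕ} (hp : Even p) (hp0 : p ≠ 0) :
    eLpNorm u p (volume.restrict K)
      = ENNReal.ofReal ((∫ x in K, u x ^ p) ^ ((p : ℝ)⁻¹)) := by
  rw [(memLp_of_continuousOn hK hu p).eLpNorm_eq_integral_rpow_norm (by simpa using hp0) (by simp)]
  simp [hp.pow_abs]

/-- For even exponents the absolute value can be dropped, so the estimates can be carried out with
integrals of polynomial expressions. -/
theorem boundedInLpLoc_iff {p : ℕ} (hp : Even p) (hp0 : p ≠ 0)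
    (hf : ∀ k, ContinuousOn (f k) M) :
    BoundedInLpLoc M p f ↔ BddIntegrals M (fun k x => f k x ^ p) := by
  have hpr : (0 : ℝ) < p := by exact_mod_cast Nat.pos_of_ne_zero hp0
  constructor
  · intro h K hK hc
    obtain ⟨C, hC⟩ := h K hK hc
    refine ⟨(C : ℝ) ^ p, fun k => ?_⟩
    have h1 := (hC k).2
    rw [eLpNorm_eq_integral_pow hc ((hf k).mono hK) hp hp0, ← ENNReal.ofReal_coe_nnreal,
      ENNReal.ofReal_le_ofReal_iff C.coe_nonneg] at h1
    have h0 : 0 ≤ ∫ x in K, f k x ^ p := integral_nonneg fun x => hp.pow_nonneg _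
    have := pow_le_pow_left₀ (by positivity) h1 p
    rwa [← Real.rpow_natCast _ p, ← Real.rpow_mul h0, inv_mul_cancel₀ hpr.ne',
      Real.rpow_one] at this
  · intro h K hK hc
    obtain ⟨C, hC⟩ := h K hK hc
    refine ⟨(C ^ ((p : ℝ)⁻¹)).toNNReal, fun k =>
      ⟨memLp_of_continuousOn hc ((hf k).mono hK) p, ?_⟩⟩
    rw [eLpNorm_eq_integral_pow hc ((hf k).mono hK) hp hp0]
    refine ENNReal.ofReal_le_ofReal (Real.rpow_le_rpow ?_ (hC k) (by positivity))
    exact integral_nonneg fun x => hp.pow_nonneg _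

/-- Convergence of continuous functions in `C⁰_loc(M)`, as continuous convergence. -/
structure ConvC0 (M : Set (Coord n)) (f : ℕ → Coord n → ℝ) (f₀ : Coord n → ℝ) : Prop where
  cont : ∀ k, ContinuousOn (f k) M
  contLim : ContinuousOn f₀ M
  tendsto : ∀ x ∈ M, Tendsto (fun q : ℕ × Coord n => f q.1 q.2) (atTop ×ˢ 𝓝 x) (𝓝 (f₀ x))

/-- For a continuous limit on an open set, locally uniform convergence is the same as continuous
convergence. The latter form makes stability under sums, products and compositions a matter of
composing limits. -/
theorem ConvC0.of_tendstoInC0Loc (hM : IsOpen M) (hf : ∀ k, ContinuousOn (f k) M)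
    (hf₀ : ContinuousOn f₀ M) (h : TendstoInC0Loc M f f₀) : ConvC0 M f f₀ := by
  refine ⟨hf, hf₀, fun x hx => ?_⟩
  obtain ⟨K, hK, hKM, hc⟩ := local_compact_nhds (hM.mem_nhds hx)
  rw [Metric.tendsto_nhds]
  intro ε hε
  have h1 := Metric.tendstoUniformlyOn_iff.1 (h K hKM hc) (ε / 2) (half_pos hε)
  have h2 : ∀ᶠ y in 𝓝 x, dist (f₀ y) (f₀ x) < ε / 2 :=
    Metric.tendsto_nhds.1 (hf₀.continuousAt (hM.mem_nhds hx)) _ (half_pos hε)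
  filter_upwards [h1.prod_mk (h2.and hK)] with q hq
  have h3 := hq.1 q.2 hq.2.2
  rw [dist_comm] at h3
  calc dist (f q.1 q.2) (f₀ x) ≤ dist (f q.1 q.2) (f₀ q.2) + dist (f₀ q.2) (f₀ x) :=
        dist_triangle _ _ _
    _ < ε := by linarith [hq.2.1]

theorem ConvC0.tendstoUniformlyOn (hM : IsOpen M) (h : ConvC0 M f f₀) {K : Set (Coord n)}
    (hK : K ⊆ M) (hc : IsCompact K) : TendstoUniformlyOn f f₀ atTop K := by
  rw [← tendstoLocallyUniformlyOn_iff_tendstoUniformlyOn_of_compact hc,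
    tendstoLocallyUniformlyOn_iff_forall_tendsto]
  intro x hx
  have h1 : Tendsto (fun q : ℕ × Coord n => f q.1 q.2) (atTop ×ˢ 𝓝[K] x) (𝓝 (f₀ x)) :=
    (h.tendsto x (hK hx)).mono_left (Filter.prod_mono le_rfl nhdsWithin_le_nhds)
  have h2 : Tendsto (fun q : ℕ × Coord n => f₀ q.2) (atTop ×ˢ 𝓝[K] x) (𝓝 (f₀ x)) :=
    (Tendsto.mono_left (h.contLim.continuousAt (hM.mem_nhds (hK hx)))
      nhdsWithin_le_nhds).comp tendsto_snd
  exact (h2.prodMk_nhds h1).mono_right (nhds_le_uniformity _)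

theorem ConvC0.exists_bound (hM : IsOpen M) (h : ConvC0 M f f₀) {K : Set (Coord n)}
    (hK : K ⊆ M) (hc : IsCompact K) : ∃ C : ℝ, 0 ≤ C ∧ ∀ k, ∀ x ∈ K, |f k x| ≤ C := by
  have h1 := Metric.tendstoUniformlyOn_iff.1 (h.tendstoUniformlyOn hM hK hc) 1 one_pos
  obtain ⟨m, hm⟩ := eventually_atTop.1 h1
  obtain ⟨B, hB⟩ := hc.exists_bound_of_continuousOn (h.contLim.mono hK)
  choose D hD using fun k => hc.exists_bound_of_continuousOn ((h.cont k).mono hK)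
  have hS : 0 ≤ ∑ k ∈ Finset.range m, |D k| := Finset.sum_nonneg fun _ _ => abs_nonneg _
  refine ⟨|B| + 1 + ∑ k ∈ Finset.range m, |D k|, by positivity, fun k x hx => ?_⟩
  rcases lt_or_ge k m with hk | hk
  · have := Finset.single_le_sum (f := fun k => |D k|) (fun _ _ => abs_nonneg _)
      (Finset.mem_range.2 hk)
    have h2 := hD k x hx
    rw [Real.norm_eq_abs] at h2
    linarith [le_abs_self (D k), abs_nonneg B]
  · have h2 := hm k hk x hx
    have h3 := hB x hx
    rw [Real.norm_eq_abs] at h3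
    rw [Real.dist_eq] at h2
    have h4 : |f k x| ≤ |f₀ x| + |f₀ x - f k x| := by
      have := abs_sub (f₀ x) (f₀ x - f k x)
      simpa using this
    linarith [le_abs_self B]

theorem ConvC0.const (hf : ContinuousOn f₀ M) (hM : IsOpen M) : ConvC0 M (fun _ => f₀) f₀ :=
  ⟨fun _ => hf, hf, fun _ hx => (hf.continuousAt (hM.mem_nhds hx)).tendsto.comp tendsto_snd⟩

theorem ConvC0.add (hf : ConvC0 M f f₀) (hg : ConvC0 M g g₀) :
    ConvC0 M (fun k x => f k x + g k x) (fun x => f₀ x + g₀ x) :=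
  ⟨fun k => (hf.cont k).add (hg.cont k), hf.contLim.add hg.contLim,
    fun x hx => (hf.tendsto x hx).add (hg.tendsto x hx)⟩

theorem ConvC0.mul (hf : ConvC0 M f f₀) (hg : ConvC0 M g g₀) :
    ConvC0 M (fun k x => f k x * g k x) (fun x => f₀ x * g₀ x) :=
  ⟨fun k => (hf.cont k).mul (hg.cont k), hf.contLim.mul hg.contLim,
    fun x hx => (hf.tendsto x hx).mul (hg.tendsto x hx)⟩

theorem ConvC0.comp {φ : ℝ → ℝ} {Ω : Set ℝ} (hΩ : IsOpen Ω) (hφ : ContinuousOn φ Ω)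
    (hf : ConvC0 M f f₀) (h : ∀ k, Set.MapsTo (f k) M Ω) (h₀ : Set.MapsTo f₀ M Ω) :
    ConvC0 M (fun k x => φ (f k x)) (fun x => φ (f₀ x)) :=
  ⟨fun k => hφ.comp (hf.cont k) (h k), hφ.comp hf.contLim h₀,
    fun x hx => (hφ.continuousAt (hΩ.mem_nhds (h₀ hx))).tendsto.comp (hf.tendsto x hx)⟩

theorem ConvC0.congr (hM : IsOpen M) (hf : ConvC0 M f f₀) (h : ∀ k, Set.EqOn (g k) (f k) M)
    (h₀ : Set.EqOn g₀ f₀ M) : ConvC0 M g g₀ := by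
  refine ⟨fun k => (hf.cont k).congr (h k), hf.contLim.congr h₀, fun x hx => ?_⟩
  rw [h₀ hx]
  refine (hf.tendsto x hx).congr' ?_
  filter_upwards [(Eventually.of_forall fun _ => trivial : ∀ᶠ k : ℕ in atTop, True).prod_mk
    (hM.mem_nhds hx)] with q hq
  exact (h q.1 hq.2).symm

/-- A sequence of `C²` functions which converges in `C⁰_loc(M)` to a `C²` function and is bounded
in `W^{1,2}_loc(M)`. -/
structure ConvW12 (M : Set (Coord n)) (f : ℕ → Coord n → ℝ) (f₀ : Coord n → ℝ) : Prop where
  contDiffOn : ∀ k, ContDiffOn ℝ 2 (f k) M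
  contDiffOnLim : ContDiffOn ℝ 2 f₀ M
  tendsto : ∀ x ∈ M, Tendsto (fun q : ℕ × Coord n => f q.1 q.2) (atTop ×ˢ 𝓝 x) (𝓝 (f₀ x))
  bdd : ∀ α, BddIntegrals M (fun k x => pd α (f k) x ^ 2)

theorem ConvW12.convC0 (h : ConvW12 M f f₀) : ConvC0 M f f₀ :=
  ⟨fun k => (h.contDiffOn k).continuousOn, h.contDiffOnLim.continuousOn, h.tendsto⟩

theorem ConvW12.continuousOn_pd (hM : IsOpen M) (h : ConvW12 M f f₀) (k : ℕ) (α : Fin (n + 1)) :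
    ContinuousOn (pd α (f k)) M :=
  EllipticGauge.continuousOn_pd hM ((h.contDiffOn k).of_le (by norm_num))

theorem ConvW12.differentiableAt (hM : IsOpen M) (h : ConvW12 M f f₀) (k : ℕ) {x : Coord n}
    (hx : x ∈ M) : DifferentiableAt ℝ (f k) x :=
  differentiableAt_of_contDiffOn hM (h.contDiffOn k) (by norm_num) hx

theorem ConvW12.const (hf : ContDiffOn ℝ 2 f₀ M) (hM : IsOpen M) : ConvW12 M (fun _ => f₀) f₀ :=
  ⟨fun _ => hf, hf, (ConvC0.const hf.continuousOn hM).tendsto,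
    fun _ _ _ _ => ⟨_, fun _ => le_rfl⟩⟩

theorem ConvW12.congr (hM : IsOpen M) (hf : ConvW12 M f f₀) (h : ∀ k, Set.EqOn (g k) (f k) M)
    (h₀ : Set.EqOn g₀ f₀ M) : ConvW12 M g g₀ :=
  ⟨fun k => (hf.contDiffOn k).congr (h k), hf.contDiffOnLim.congr h₀,
    (hf.convC0.congr hM h h₀).tendsto, fun α => (hf.bdd α).congr fun k x hx => by
      simp only [pd_congr_of_eqOn hM (h k) hx]⟩

theorem ConvW12.add (hM : IsOpen M) (hf : ConvW12 M f f₀) (hg : ConvW12 M g g₀) :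
    ConvW12 M (fun k x => f k x + g k x) (fun x => f₀ x + g₀ x) := by
  refine ⟨fun k => (hf.contDiffOn k).add (hg.contDiffOn k),
    hf.contDiffOnLim.add hg.contDiffOnLim, (hf.convC0.add hg.convC0).tendsto, fun α => ?_⟩
  have c1 := fun k => (hf.continuousOn_pd hM k α).pow 2
  have c2 := fun k => (hg.continuousOn_pd hM k α).pow 2
  refine ((hf.bdd α).add (hg.bdd α) c1 c2).of_le
    (fun k => ((EllipticGauge.continuousOn_pd hM (((hf.contDiffOn k).add
      (hg.contDiffOn k)).of_le (by norm_num)))).pow 2) (fun k => (c1 k).add (c2 k))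
    fun K hK hc => ⟨2, by norm_num, fun k x hx => ?_⟩
  rw [pd_add (hf.differentiableAt hM k (hK hx)) (hg.differentiableAt hM k (hK hx))]
  nlinarith [sq_nonneg (pd α (f k) x - pd α (g k) x)]

/-- By `C⁰` convergence the undifferentiated factors in the Leibniz rule are bounded on compact sets
uniformly in `k`. -/
theorem ConvW12.mul (hM : IsOpen M) (hf : ConvW12 M f f₀) (hg : ConvW12 M g g₀) :
    ConvW12 M (fun k x => f k x * g k x) (fun x => f₀ x * g₀ x) := by
  refine ⟨fun k => (hf.contDiffOn k).mul (hg.contDiffOn k),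
    hf.contDiffOnLim.mul hg.contDiffOnLim, (hf.convC0.mul hg.convC0).tendsto, fun α => ?_⟩
  have c1 := fun k => (hf.continuousOn_pd hM k α).pow 2
  have c2 := fun k => (hg.continuousOn_pd hM k α).pow 2
  refine ((hf.bdd α).add (hg.bdd α) c1 c2).of_le
    (fun k => ((EllipticGauge.continuousOn_pd hM (((hf.contDiffOn k).mul
      (hg.contDiffOn k)).of_le (by norm_num)))).pow 2) (fun k => (c1 k).add (c2 k))
    fun K hK hc => ?_
  obtain ⟨C, hC0, hC⟩ := hf.convC0.exists_bound hM hK hc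
  obtain ⟨D, hD0, hD⟩ := hg.convC0.exists_bound hM hK hc
  refine ⟨2 * (C ^ 2 + D ^ 2), by positivity, fun k x hx => ?_⟩
  rw [pd_mul (hf.differentiableAt hM k (hK hx)) (hg.differentiableAt hM k (hK hx))]
  have h1 : f k x ^ 2 ≤ C ^ 2 := sq_le_sq' (abs_le.1 (hC k x hx)).1 (abs_le.1 (hC k x hx)).2
  have h2 : g k x ^ 2 ≤ D ^ 2 := sq_le_sq' (abs_le.1 (hD k x hx)).1 (abs_le.1 (hD k x hx)).2
  set a := pd α (f k) x
  set b := pd α (g k) x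
  have h3 : (f k x * b) ^ 2 ≤ C ^ 2 * b ^ 2 := by
    rw [mul_pow]; exact mul_le_mul_of_nonneg_right h1 (sq_nonneg b)
  have h4 : (a * g k x) ^ 2 ≤ D ^ 2 * a ^ 2 := by
    rw [mul_pow, mul_comm]; exact mul_le_mul_of_nonneg_right h2 (sq_nonneg a)
  nlinarith [sq_nonneg (f k x * b - a * g k x), mul_nonneg (sq_nonneg C) (sq_nonneg a),
    mul_nonneg (sq_nonneg D) (sq_nonneg b)]

theorem ConvW12.comp (hM : IsOpen M) {φ : ℝ → ℝ} {Ω : Set ℝ} (hΩ : IsOpen Ω)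
    (hφ : ContDiffOn ℝ 2 φ Ω) (hf : ConvW12 M f f₀) (h : ∀ k, Set.MapsTo (f k) M Ω)
    (h₀ : Set.MapsTo f₀ M Ω) : ConvW12 M (fun k x => φ (f k x)) (fun x => φ (f₀ x)) := by
  have hφ' : ContinuousOn (deriv φ) Ω := hφ.continuousOn_deriv_of_isOpen hΩ (by norm_num)
  have hcd : ∀ k, ContDiffOn ℝ 2 (fun x => φ (f k x)) M := fun k =>
    hφ.comp (hf.contDiffOn k) (h k)
  refine ⟨hcd, hφ.comp hf.contDiffOnLim h₀,
    (hf.convC0.comp hΩ hφ.continuousOn h h₀).tendsto, fun α => ?_⟩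
  refine (hf.bdd α).of_le
    (fun k => (EllipticGauge.continuousOn_pd hM ((hcd k).of_le (by norm_num))).pow 2)
    (fun k => (hf.continuousOn_pd hM k α).pow 2) fun K hK hc => ?_
  -- The factor `φ'(f k)` in the chain rule converges in `C⁰_loc` as well, hence is uniformly
  -- bounded on `K`.
  obtain ⟨C, hC0, hC⟩ := (hf.convC0.comp hΩ hφ' h h₀).exists_bound hM hK hc
  refine ⟨C ^ 2, by positivity, fun k x hx => ?_⟩
  have hd : DifferentiableAt ℝ φ (f k x) :=
    ((hφ.contDiffAt (hΩ.mem_nhds (h k (hK hx)))).differentiableAt (by norm_num))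
  rw [pd_comp hd (hf.differentiableAt hM k (hK hx)), mul_pow]
  exact mul_le_mul_of_nonneg_right
    (sq_le_sq' (abs_le.1 (hC k x hx)).1 (abs_le.1 (hC k x hx)).2) (sq_nonneg _)

theorem ConvW12.neg (hM : IsOpen M) (hf : ConvW12 M f f₀) :
    ConvW12 M (fun k x => - f k x) (fun x => - f₀ x) := by
  have := (ConvW12.const (f₀ := fun _ : Coord n => (-1 : ℝ)) contDiffOn_const hM).mul hM hf
  simpa using this

theorem ConvW12.inv (hM : IsOpen M) (hf : ConvW12 M f f₀) (h : ∀ k, ∀ x ∈ M, f k x ≠ 0)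
    (h₀ : ∀ x ∈ M, f₀ x ≠ 0) : ConvW12 M (fun k x => (f k x)⁻¹) (fun x => (f₀ x)⁻¹) :=
  hf.comp hM (φ := fun t => t⁻¹) (Ω := {0}ᶜ) isOpen_compl_singleton
    (fun _ ht => (contDiffAt_inv ℝ ht).contDiffWithinAt) h h₀

theorem ConvW12.sqrt (hM : IsOpen M) (hf : ConvW12 M f f₀) (h : ∀ k, ∀ x ∈ M, f k x ≠ 0)
    (h₀ : ∀ x ∈ M, f₀ x ≠ 0) :
    ConvW12 M (fun k x => √(f k x)) (fun x => √(f₀ x)) :=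
  -- The real square root is zero on the negative axis, hence smooth off the origin; nonvanishing of
  -- the argument suffices.
  hf.comp hM (φ := fun t => √t) (Ω := {0}ᶜ) isOpen_compl_singleton
    (fun _ ht => (Real.contDiffAt_sqrt ht).contDiffWithinAt) h h₀

end LocalSpaces

/-! ### Sequences with Laplacian bounded in `L²_loc` -/

section Laplacian

variable {n : ℕ} {M : Set (Coord n)} {f g : ℕ → Coord n → ℝ} {f₀ g₀ : Coord n → ℝ}

/-- In addition to `ConvW12`, the spatial Laplacians are bounded in `L²_loc(M)` and the spatial
gradients are bounded in `L⁴_loc(M)`. -/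
structure ConvLap (M : Set (Coord n)) (f : ℕ → Coord n → ℝ) (f₀ : Coord n → ℝ) : Prop
    extends ConvW12 M f f₀ where
  lap : BddIntegrals M (fun k x => spatialLaplacian (f k) x ^ 2)
  grad : ∀ i : Fin n, BddIntegrals M (fun k x => pd i.succ (f k) x ^ 4)

theorem ConvLap.continuousOn_lap (hM : IsOpen M) (h : ConvLap M f f₀) (k : ℕ) :
    ContinuousOn (spatialLaplacian (f k)) M :=
  continuousOn_spatialLaplacian hM (h.contDiffOn k)

theorem spatialLaplacian_congr (hM : IsOpen M) {u v : Coord n → ℝ} (h : Set.EqOn u v M)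
    {x : Coord n} (hx : x ∈ M) : spatialLaplacian u x = spatialLaplacian v x :=
  Finset.sum_congr rfl fun _ _ =>
    pd_congr_of_eqOn hM (fun _ hy => pd_congr_of_eqOn hM h hy) hx

theorem pd_pd_add (hM : IsOpen M) {u v : Coord n → ℝ} (hu : ContDiffOn ℝ 2 u M)
    (hv : ContDiffOn ℝ 2 v M) {x : Coord n} (hx : x ∈ M) (α β : Fin (n + 1)) :
    pd α (pd β (fun y => u y + v y)) x = pd α (pd β u) x + pd α (pd β v) x := by
  have e : Set.EqOn (pd β (fun y => u y + v y)) (fun y => pd β u y + pd β v y) M := fun y hy =>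
    pd_add (differentiableAt_of_contDiffOn hM hu (by norm_num) hy)
      (differentiableAt_of_contDiffOn hM hv (by norm_num) hy)
  rw [pd_congr_of_eqOn hM e hx]
  exact pd_add (differentiableAt_of_contDiffOn hM (contDiffOn_one_pd hM hu) le_rfl hx)
      (differentiableAt_of_contDiffOn hM (contDiffOn_one_pd hM hv) le_rfl hx)

theorem spatialLaplacian_add (hM : IsOpen M) {u v : Coord n → ℝ} (hu : ContDiffOn ℝ 2 u M)
    (hv : ContDiffOn ℝ 2 v M) {x : Coord n} (hx : x ∈ M) :
    spatialLaplacian (fun y => u y + v y) x = spatialLaplacian u x + spatialLaplacian v x := by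
  simp only [spatialLaplacian, pd_pd_add hM hu hv hx, Finset.sum_add_distrib]

/-- The formula is solved from the Leibniz rule for the Laplacian of `u · u⁻¹ = 1`. -/
theorem spatialLaplacian_inv (hM : IsOpen M) {u : Coord n → ℝ} (hu : ContDiffOn ℝ 2 u M)
    (h0 : ∀ x ∈ M, u x ≠ 0) {x : Coord n} (hx : x ∈ M) :
    spatialLaplacian (fun y => (u y)⁻¹) x = (u x)⁻¹ ^ 2 *
      (2 * (u x)⁻¹ * (∑ i : Fin n, pd i.succ u x ^ 2) - spatialLaplacian u x) := by
  have hv : ContDiffOn ℝ 2 (fun y => (u y)⁻¹) M := hu.inv h0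
  have hpd : ∀ α, pd α (fun y => (u y)⁻¹) x = -((u x)⁻¹ ^ 2 * pd α u x) := by
    intro α
    rw [pd_comp (φ := fun t => t⁻¹) (differentiableAt_inv (h0 x hx))
      (differentiableAt_of_contDiffOn hM hu (by norm_num) hx)]
    simp
  have h1 := spatialLaplacian_mul hM hu hv hx
  have e : Set.EqOn (fun y => u y * (u y)⁻¹) (fun _ => (1 : ℝ)) M := fun y hy =>
    mul_inv_cancel₀ (h0 y hy)
  have hc : ∀ α, pd α (fun _ : Coord n => (1 : ℝ)) = fun _ => 0 := fun α =>
    funext fun y => pd_const 1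
  have h2 : spatialLaplacian (fun _ : Coord n => (1 : ℝ)) x = 0 := by
    simp [spatialLaplacian, hc, pd_const]
  rw [spatialLaplacian_congr hM e hx, h2] at h1
  simp only [hpd] at h1
  have h3 : ∑ i : Fin n, pd i.succ u x * -((u x)⁻¹ ^ 2 * pd i.succ u x)
      = -((u x)⁻¹ ^ 2 * ∑ i : Fin n, pd i.succ u x ^ 2) := by
    rw [Finset.mul_sum, ← Finset.sum_neg_distrib]
    exact Finset.sum_congr rfl fun i _ => by ring
  rw [h3] at h1
  have hu0 := h0 x hx
  field_simp at h1 ⊢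
  linarith

theorem ConvLap.const (hf : ContDiffOn ℝ 2 f₀ M) (hM : IsOpen M) : ConvLap M (fun _ => f₀) f₀ :=
  ⟨ConvW12.const hf hM, fun _ _ _ => ⟨_, fun _ => le_rfl⟩, fun _ _ _ _ => ⟨_, fun _ => le_rfl⟩⟩

theorem ConvLap.congr (hM : IsOpen M) (hf : ConvLap M f f₀) (h : ∀ k, Set.EqOn (g k) (f k) M)
    (h₀ : Set.EqOn g₀ f₀ M) : ConvLap M g g₀ :=
  ⟨hf.toConvW12.congr hM h h₀, hf.lap.congr fun k x hx => by
    simp only [spatialLaplacian_congr hM (h k) hx], fun i => (hf.grad i).congr fun k x hx => by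
      simp only [pd_congr_of_eqOn hM (h k) hx]⟩

theorem add_pow_four_le (a b : ℝ) : (a + b) ^ 4 ≤ 8 * (a ^ 4 + b ^ 4) := by
  nlinarith [sq_nonneg (a - b), sq_nonneg (a ^ 2 - b ^ 2), sq_nonneg (a + b),
    mul_nonneg (sq_nonneg (a - b)) (sq_nonneg (a + b)), sq_nonneg ((a - b) ^ 2)]

theorem ConvLap.add (hM : IsOpen M) (hf : ConvLap M f f₀) (hg : ConvLap M g g₀) :
    ConvLap M (fun k x => f k x + g k x) (fun x => f₀ x + g₀ x) := by
  have hfg := hf.toConvW12.add hM hg.toConvW12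
  refine ⟨hfg, ?_, fun i => ?_⟩
  · have c1 := fun k => (hf.continuousOn_lap hM k).pow 2
    have c2 := fun k => (hg.continuousOn_lap hM k).pow 2
    refine (hf.lap.add hg.lap c1 c2).of_le
      (fun k => (continuousOn_spatialLaplacian hM (hfg.contDiffOn k)).pow 2)
      (fun k => (c1 k).add (c2 k)) fun K hK hc => ⟨2, by norm_num, fun k x hx => ?_⟩
    rw [spatialLaplacian_add hM (hf.contDiffOn k) (hg.contDiffOn k) (hK hx)]
    nlinarith [sq_nonneg (spatialLaplacian (f k) x - spatialLaplacian (g k) x)]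
  · have c1 := fun k => (hf.continuousOn_pd hM k i.succ).pow 4
    have c2 := fun k => (hg.continuousOn_pd hM k i.succ).pow 4
    refine ((hf.grad i).add (hg.grad i) c1 c2).of_le
      (fun k => (hfg.continuousOn_pd hM k i.succ).pow 4)
      (fun k => (c1 k).add (c2 k)) fun K hK hc => ⟨8, by norm_num, fun k x hx => ?_⟩
    rw [pd_add (hf.differentiableAt hM k (hK hx)) (hg.differentiableAt hM k (hK hx))]
    exact add_pow_four_le _ _


/-- The cross term `2 ∇f·∇g` of the Laplacian is in `L²` because both gradients are in `L⁴`. This is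
why the `L⁴` bound belongs to the class `ConvLap`. -/
theorem ConvLap.mul (hM : IsOpen M) (hf : ConvLap M f f₀) (hg : ConvLap M g g₀) :
    ConvLap M (fun k x => f k x * g k x) (fun x => f₀ x * g₀ x) := by
  have hfg := hf.toConvW12.mul hM hg.toConvW12
  have cl := fun k => (hf.continuousOn_lap hM k).pow 2
  have cl' := fun k => (hg.continuousOn_lap hM k).pow 2
  have cg := fun (i : Fin n) k => (hf.continuousOn_pd hM k i.succ).pow 4
  have cg' := fun (i : Fin n) k => (hg.continuousOn_pd hM k i.succ).pow 4
  refine ⟨hfg, ?_, fun i => ?_⟩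
  · have b1 := hf.lap.add hg.lap cl cl'
    have b2 := (BddIntegrals.sum Finset.univ hf.grad cg).add
      (BddIntegrals.sum Finset.univ hg.grad cg')
      (fun k => continuousOn_finsetSum _ fun i _ => cg i k)
      (fun k => continuousOn_finsetSum _ fun i _ => cg' i k)
    have c1 := fun k => (cl k).add (cl' k)
    have c2 := fun k => (continuousOn_finsetSum Finset.univ fun i _ => cg i k).add
      (continuousOn_finsetSum Finset.univ fun i _ => cg' i k)
    refine (b1.add b2 c1 c2).of_le
      (fun k => (continuousOn_spatialLaplacian hM (hfg.contDiffOn k)).pow 2)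
      (fun k => (c1 k).add (c2 k)) fun K hK hc => ?_
    obtain ⟨C, hC0, hC⟩ := hf.convC0.exists_bound hM hK hc
    obtain ⟨D, hD0, hD⟩ := hg.convC0.exists_bound hM hK hc
    refine ⟨3 * C ^ 2 + 3 * D ^ 2 + 12 * n, by positivity, fun k x hx => ?_⟩
    rw [spatialLaplacian_mul hM (hf.contDiffOn k) (hg.contDiffOn k) (hK hx)]
    have h1 : f k x ^ 2 ≤ C ^ 2 := sq_le_sq' (abs_le.1 (hC k x hx)).1 (abs_le.1 (hC k x hx)).2
    have h2 : g k x ^ 2 ≤ D ^ 2 := sq_le_sq' (abs_le.1 (hD k x hx)).1 (abs_le.1 (hD k x hx)).2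
    have h3 : (∑ i : Fin n, pd i.succ (f k) x * pd i.succ (g k) x) ^ 2
        ≤ n * (∑ i : Fin n, pd i.succ (f k) x ^ 4 + ∑ i : Fin n, pd i.succ (g k) x ^ 4) := by
      refine sq_sum_le_card_mul_sum_sq.trans ?_
      rw [Finset.card_univ, Fintype.card_fin, ← Finset.sum_add_distrib]
      refine mul_le_mul_of_nonneg_left (Finset.sum_le_sum fun i _ => ?_) (Nat.cast_nonneg _)
      nlinarith [sq_nonneg (pd i.succ (f k) x ^ 2 - pd i.succ (g k) x ^ 2),
        sq_nonneg (pd i.succ (f k) x ^ 2), sq_nonneg (pd i.succ (g k) x ^ 2)]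
    have g1 : 0 ≤ ∑ i : Fin n, pd i.succ (f k) x ^ 4 := Finset.sum_nonneg fun _ _ => by positivity
    have g2 : 0 ≤ ∑ i : Fin n, pd i.succ (g k) x ^ 4 := Finset.sum_nonneg fun _ _ => by positivity
    set S := ∑ i : Fin n, pd i.succ (f k) x * pd i.succ (g k) x
    set P := ∑ i : Fin n, pd i.succ (f k) x ^ 4
    set Q := ∑ i : Fin n, pd i.succ (g k) x ^ 4
    set a := spatialLaplacian (f k) x
    set b := spatialLaplacian (g k) x
    have h4 : (f k x * b) ^ 2 ≤ C ^ 2 * b ^ 2 := by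
      rw [mul_pow]; exact mul_le_mul_of_nonneg_right h1 (sq_nonneg b)
    have h5 : (a * g k x) ^ 2 ≤ D ^ 2 * a ^ 2 := by
      rw [mul_pow, mul_comm]; exact mul_le_mul_of_nonneg_right h2 (sq_nonneg a)
    have h6 : (f k x * b + 2 * S + a * g k x) ^ 2
        ≤ 3 * (f k x * b) ^ 2 + 12 * S ^ 2 + 3 * (a * g k x) ^ 2 := by
      nlinarith [sq_nonneg (f k x * b - 2 * S), sq_nonneg (f k x * b - a * g k x),
        sq_nonneg (2 * S - a * g k x)]
    have n1 : 0 ≤ (n : ℝ) * a ^ 2 := by positivity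
    have n2 : 0 ≤ (n : ℝ) * b ^ 2 := by positivity
    have n3 : 0 ≤ (C ^ 2 + D ^ 2) * (P + Q) := by positivity
    have n4 : 0 ≤ C ^ 2 * a ^ 2 := by positivity
    have n5 : 0 ≤ D ^ 2 * b ^ 2 := by positivity
    nlinarith
  · refine ((hf.grad i).add (hg.grad i) (cg i) (cg' i)).of_le
      (fun k => (hfg.continuousOn_pd hM k i.succ).pow 4)
      (fun k => (cg i k).add (cg' i k)) fun K hK hc => ?_
    obtain ⟨C, hC0, hC⟩ := hf.convC0.exists_bound hM hK hc
    obtain ⟨D, hD0, hD⟩ := hg.convC0.exists_bound hM hK hc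
    refine ⟨8 * (C ^ 4 + D ^ 4), by positivity, fun k x hx => ?_⟩
    rw [pd_mul (hf.differentiableAt hM k (hK hx)) (hg.differentiableAt hM k (hK hx))]
    have h1 : f k x ^ 4 ≤ C ^ 4 := by
      rw [← (show Even 4 by decide).pow_abs]
      exact pow_le_pow_left₀ (abs_nonneg _) (hC k x hx) 4
    have h2 : g k x ^ 4 ≤ D ^ 4 := by
      rw [← (show Even 4 by decide).pow_abs]
      exact pow_le_pow_left₀ (abs_nonneg _) (hD k x hx) 4
    refine (add_pow_four_le _ _).trans ?_
    rw [mul_pow, mul_pow, mul_assoc]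
    have p1 : 0 ≤ pd i.succ (f k) x ^ 4 := by positivity
    have p2 : 0 ≤ pd i.succ (g k) x ^ 4 := by positivity
    have h3 := mul_le_mul_of_nonneg_right h1 p2
    have h4 := mul_le_mul_of_nonneg_right h2 p1
    have n1 : 0 ≤ C ^ 4 * pd i.succ (f k) x ^ 4 := by positivity
    have n2 : 0 ≤ D ^ 4 * pd i.succ (g k) x ^ 4 := by positivity
    nlinarith

theorem ConvLap.inv (hM : IsOpen M) (hf : ConvLap M f f₀) (h : ∀ k, ∀ x ∈ M, f k x ≠ 0)
    (h₀ : ∀ x ∈ M, f₀ x ≠ 0) : ConvLap M (fun k x => (f k x)⁻¹) (fun x => (f₀ x)⁻¹) := by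
  have hi := hf.toConvW12.inv hM h h₀
  have cl := fun k => (hf.continuousOn_lap hM k).pow 2
  have cg := fun (i : Fin n) k => (hf.continuousOn_pd hM k i.succ).pow 4
  refine ⟨hi, ?_, fun i => ?_⟩
  · have cg2 := fun k => continuousOn_finsetSum Finset.univ fun i _ => cg i k
    refine ((BddIntegrals.sum Finset.univ hf.grad cg).add hf.lap cg2 cl).of_le
      (fun k => (continuousOn_spatialLaplacian hM (hi.contDiffOn k)).pow 2)
      (fun k => (cg2 k).add (cl k)) fun K hK hc => ?_
    obtain ⟨C, hC0, hC⟩ := hi.convC0.exists_bound hM hK hc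
    refine ⟨C ^ 4 * (8 * C ^ 2 * n + 2), by positivity, fun k x hx => ?_⟩
    rw [spatialLaplacian_inv hM (hf.contDiffOn k) (h k) (hK hx)]
    set v := (f k x)⁻¹
    have h1 : v ^ 2 ≤ C ^ 2 := sq_le_sq' (abs_le.1 (hC k x hx)).1 (abs_le.1 (hC k x hx)).2
    have h2 : (v ^ 2) ^ 2 ≤ (C ^ 2) ^ 2 := pow_le_pow_left₀ (sq_nonneg v) h1 2
    have h3 : (∑ i : Fin n, pd i.succ (f k) x ^ 2) ^ 2
        ≤ n * ∑ i : Fin n, pd i.succ (f k) x ^ 4 := by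
      refine sq_sum_le_card_mul_sum_sq.trans ?_
      rw [Finset.card_univ, Fintype.card_fin]
      refine mul_le_mul_of_nonneg_left (Finset.sum_le_sum fun i _ => ?_) (Nat.cast_nonneg _)
      rw [← pow_mul]
    have g1 : 0 ≤ ∑ i : Fin n, pd i.succ (f k) x ^ 4 := Finset.sum_nonneg fun _ _ => by positivity
    set G := ∑ i : Fin n, pd i.succ (f k) x ^ 2
    set P := ∑ i : Fin n, pd i.succ (f k) x ^ 4
    set a := spatialLaplacian (f k) x
    have h4 : (2 * v * G - a) ^ 2 ≤ 8 * (v ^ 2 * G ^ 2) + 2 * a ^ 2 := by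
      nlinarith [sq_nonneg (2 * v * G + a)]
    have h5 : v ^ 2 * G ^ 2 ≤ C ^ 2 * (n * P) := mul_le_mul h1 h3 (sq_nonneg _) (sq_nonneg _)
    have h6 : (2 * v * G - a) ^ 2 ≤ (8 * C ^ 2 * n + 2) * (P + a ^ 2) := by
      have : 0 ≤ C ^ 2 * n * a ^ 2 := by positivity
      nlinarith
    calc (v ^ 2 * (2 * v * G - a)) ^ 2 = (v ^ 2) ^ 2 * (2 * v * G - a) ^ 2 := by ring
      _ ≤ (C ^ 2) ^ 2 * ((8 * C ^ 2 * n + 2) * (P + a ^ 2)) :=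
        mul_le_mul h2 h6 (sq_nonneg _) (sq_nonneg _)
      _ = _ := by ring
  · refine (hf.grad i).of_le (fun k => (hi.continuousOn_pd hM k i.succ).pow 4) (cg i)
      fun K hK hc => ?_
    obtain ⟨C, hC0, hC⟩ := hi.convC0.exists_bound hM hK hc
    refine ⟨C ^ 8, by positivity, fun k x hx => ?_⟩
    rw [pd_comp (φ := fun t => t⁻¹) (differentiableAt_inv (h k x (hK hx)))
      (hf.differentiableAt hM k (hK hx)), mul_pow]
    refine mul_le_mul_of_nonneg_right ?_ (by positivity)
    have h1 : |(f k x)⁻¹| ^ 8 ≤ C ^ 8 := pow_le_pow_left₀ (abs_nonneg _) (hC k x hx) 8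
    rw [(show Even 8 by decide).pow_abs] at h1
    refine le_of_eq_of_le ?_ h1
    simp only [deriv_inv]
    rw [← inv_pow]
    ring

theorem ConvLap.neg (hM : IsOpen M) (hf : ConvLap M f f₀) :
    ConvLap M (fun k x => - f k x) (fun x => - f₀ x) := by
  have := (ConvLap.const (f₀ := fun _ : Coord n => (-1 : ℝ)) contDiffOn_const hM).mul hM hf
  simpa using this

theorem exists_cutoff {K U : Set (Coord n)} (hK : IsCompact K) (hU : IsOpen U) (hKU : K ⊆ U) :
    ∃ ζ : Coord n → ℝ, ContDiff ℝ ∞ ζ ∧ HasCompactSupport ζ ∧ tsupport ζ ⊆ U ∧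
      ∀ x ∈ K, ζ x = 1 := by
  obtain ⟨L, hL, hKL, hLU⟩ := exists_compact_between hK hU hKU
  obtain ⟨ζ, h1, h0, -⟩ := exists_contMDiffMap_one_nhds_of_subset_interior
    (modelWithCornersSelf ℝ (Coord n)) (n := ⊤) hK.isClosed hKL
  have hs : tsupport ζ ⊆ L := closure_minimal
    (fun x hx => by_contra fun h => hx (h0 x h)) hL.isClosed
  exact ⟨ζ, ζ.contMDiff.contDiff, hL.of_isClosed_subset (isClosed_tsupport _) hs,
    hs.trans hLU, fun x hx => h1.self_of_nhdsSet x hx⟩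

/-- A finite cover reduces the bound to small neighbourhoods. This is needed because the oscillation
of the unknowns can be made small only near a point. -/
theorem bddIntegrals_of_local (hf : ∀ k, ContinuousOn (f k) M) (h0 : ∀ k x, 0 ≤ f k x)
    (h : ∀ x ∈ M, ∃ L ∈ 𝓝 x, L ⊆ M ∧ IsCompact L ∧ ∃ C : ℝ, ∀ k, ∫ y in L, f k y ≤ C) :
    BddIntegrals M f := by
  intro K hK hc
  choose! L hL hLM hLc C hC using h
  obtain ⟨t, htK, ht⟩ := hc.elim_nhds_subcover L fun x hx => hL x (hK hx)
  refine ⟨∑ x ∈ t, C x, fun k => ?_⟩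
  have hi : ∀ x ∈ t, IntegrableOn ((L x).indicator (f k)) K := fun x hx =>
    (((hf k).mono hK).integrableOn_compact hc).indicator (hLc x (hK (htK x hx))).measurableSet
  calc ∫ y in K, f k y ≤ ∫ y in K, ∑ x ∈ t, (L x).indicator (f k) y := by
        refine setIntegral_mono_on (((hf k).mono hK).integrableOn_compact hc)
          (integrable_finsetSum _ hi) hc.measurableSet fun y hy => ?_
        obtain ⟨x, hx, hyx⟩ := Set.mem_iUnion₂.1 (ht hy)
        have := Finset.single_le_sum (f := fun x => (L x).indicator (f k) y)
          (fun x _ => Set.indicator_nonneg (fun y _ => h0 k y) y) hx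
        simpa only [Set.indicator_of_mem hyx] using this
    _ = ∑ x ∈ t, ∫ y in K, (L x).indicator (f k) y := integral_finsetSum _ hi
    _ ≤ ∑ x ∈ t, C x := by
        refine Finset.sum_le_sum fun x hx => ?_
        have hx' := hK (htK x hx)
        rw [setIntegral_indicator (hLc x hx').measurableSet]
        refine le_trans (setIntegral_mono_set
          (((hf k).mono (hLM x hx')).integrableOn_compact (hLc x hx')) (ae_of_all _ (h0 k))
          (LE.le.eventuallyLE Set.inter_subset_right)) (hC x hx' k)

theorem exists_bound_of_eventually {a : ℕ → ℝ} {C : ℝ} (h : ∀ᶠ k in atTop, a k ≤ C) :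
    ∃ D, ∀ k, a k ≤ D := by
  obtain ⟨m, hm⟩ := eventually_atTop.1 h
  have hS : 0 ≤ ∑ k ∈ Finset.range m, |a k| := Finset.sum_nonneg fun _ _ => abs_nonneg _
  refine ⟨|C| + ∑ k ∈ Finset.range m, |a k|, fun k => ?_⟩
  rcases lt_or_ge k m with hk | hk
  · have := Finset.single_le_sum (f := fun k => |a k|) (fun _ _ => abs_nonneg _)
      (Finset.mem_range.2 hk)
    linarith [le_abs_self (a k), abs_nonneg C]
  · linarith [hm k hk, le_abs_self C]

end Laplacian

/-! ### Quadratic systems and strong convergence of gradients -/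

section QuadraticSystem

variable {n : ℕ} {M : Set (Coord n)} {f g : ℕ → Coord n → ℝ} {f₀ g₀ : Coord n → ℝ}

theorem pd_sub_const (u : Coord n → ℝ) (c : ℝ) (α : Fin (n + 1)) :
    pd α (fun y => u y - c) = pd α u := by
  funext x
  simp only [pd, fderiv_sub_const]

theorem BddIntegrals.cutoff_sq_mul (hg : BddIntegrals M g) (hgc : ∀ k, ContinuousOn (g k) M)
    (h0 : ∀ k x, 0 ≤ g k x) {ζ : Coord n → ℝ} (hζ : Continuous ζ) (hc : HasCompactSupport ζ)
    (hs : tsupport ζ ⊆ M) : ∃ C : ℝ, 0 ≤ C ∧ ∀ k, ∫ x in tsupport ζ, ζ x ^ 2 * g k x ≤ C := by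
  obtain ⟨B, hB⟩ := hζ.bounded_above_of_compact_support hc
  have : BddIntegrals M (fun k x => ζ x ^ 2 * g k x) := by
    refine hg.of_le (fun k => (hζ.continuousOn.pow 2).mul (hgc k)) hgc
      fun K _ _ => ⟨B ^ 2, sq_nonneg B, fun k x _ => mul_le_mul_of_nonneg_right ?_ (h0 k x)⟩
    have := hB x
    rw [Real.norm_eq_abs] at this
    exact sq_le_sq' (abs_le.1 this).1 (abs_le.1 this).2
  obtain ⟨C, hC⟩ := this _ hs hc.isCompact
  exact ⟨|C|, abs_nonneg C, fun k => (hC k).trans (le_abs_self C)⟩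

/-- A sequence of solutions of a system whose spatial Laplacians are quadratic in the spatial
gradients, up to a term bounded in `L²_loc`, has Laplacians bounded in `L²_loc`, provided it
converges in `C⁰_loc`. -/
theorem convLap_of_quadratic_system {ι : Type*} [Fintype ι] {u : ι → ℕ → Coord n → ℝ}
    {u₀ : ι → Coord n → ℝ} {F : ℕ → Coord n → ℝ} (hM : IsOpen M)
    (hu : ∀ c, ConvW12 M (u c) (u₀ c)) (hF : BddIntegrals M (fun k x => F k x ^ 2))
    (hFc : ∀ k, ContinuousOn (F k) M)
    (H : ∀ K ⊆ M, IsCompact K → ∃ C : ℝ, 0 ≤ C ∧ ∀ c k, ∀ x ∈ K, |spatialLaplacian (u c k) x|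
      ≤ C * (∑ p : ι × Fin n, pd p.2.succ (u p.1 k) x ^ 2 + F k x)) (c : ι) :
    ConvLap M (u c) (u₀ c) := by
  -- `m` counts the unknowns and `N` the pairs of an unknown and a spatial direction; `N` is the
  -- Cauchy–Schwarz constant for the sum of squared gradients.
  obtain ⟨N, hN⟩ : ∃ N : ℝ, N = (Fintype.card (ι × Fin n) : ℕ) := ⟨_, rfl⟩
  obtain ⟨m, hm⟩ : ∃ m : ℝ, m = (Fintype.card ι : ℕ) := ⟨_, rfl⟩
  have hN0 : 0 ≤ N := hN ▸ Nat.cast_nonneg _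
  have hm0 : 0 ≤ m := hm ▸ Nat.cast_nonneg _
  have cg : ∀ (p : ι × Fin n) k, ContinuousOn (pd p.2.succ (u p.1 k)) M := fun p k =>
    (hu p.1).continuousOn_pd hM k _
  have cg4 : ∀ (p : ι × Fin n) k, ContinuousOn (fun x => pd p.2.succ (u p.1 k) x ^ 4) M :=
    fun p k => (cg p k).pow 4
  have cΔ : ∀ c k, ContinuousOn (spatialLaplacian (u c k)) M := fun c k =>
    continuousOn_spatialLaplacian hM ((hu c).contDiffOn k)
  have H2 : ∀ K ⊆ M, IsCompact K → ∃ C : ℝ, 0 ≤ C ∧ ∀ c k, ∀ x ∈ K,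
      spatialLaplacian (u c k) x ^ 2
        ≤ C * (N * (∑ p : ι × Fin n, pd p.2.succ (u p.1 k) x ^ 4) + F k x ^ 2) := by
    intro K hK hc
    obtain ⟨C, hC0, hC⟩ := H K hK hc
    refine ⟨2 * C ^ 2, by positivity, fun c k x hx => ?_⟩
    have h1 := hC c k x hx
    have h2 : (∑ p : ι × Fin n, pd p.2.succ (u p.1 k) x ^ 2) ^ 2
        ≤ N * ∑ p : ι × Fin n, pd p.2.succ (u p.1 k) x ^ 4 := by
      refine sq_sum_le_card_mul_sum_sq.trans (le_of_eq ?_)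
      rw [Finset.card_univ, ← hN]
      norm_num [← pow_mul]
    set S := ∑ p : ι × Fin n, pd p.2.succ (u p.1 k) x ^ 2
    set Q := ∑ p : ι × Fin n, pd p.2.succ (u p.1 k) x ^ 4
    calc spatialLaplacian (u c k) x ^ 2 = |spatialLaplacian (u c k) x| ^ 2 := (sq_abs _).symm
      _ ≤ (C * (S + F k x)) ^ 2 := pow_le_pow_left₀ (abs_nonneg _) h1 2
      _ = C ^ 2 * (S + F k x) ^ 2 := by ring
      _ ≤ C ^ 2 * (2 * (N * Q + F k x ^ 2)) := by
          refine mul_le_mul_of_nonneg_left ?_ (sq_nonneg C)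
          nlinarith [sq_nonneg (S - F k x)]
      _ = _ := by ring
  have grad : ∀ p : ι × Fin n, BddIntegrals M (fun k x => pd p.2.succ (u p.1 k) x ^ 4) := by
    intro p
    refine bddIntegrals_of_local (cg4 p) (fun k x => by positivity) fun x₀ hx₀ => ?_
    obtain ⟨K, hK, hKM, hKc⟩ := local_compact_nhds (hM.mem_nhds hx₀)
    obtain ⟨C, hC0, hC⟩ := H2 K hKM hKc
    -- Chosen so that `δ · 10 (1 + mCN) = 1/2`: half of `I k` can then be absorbed into the
    -- left-hand side.
    set δ : ℝ := 1 / (20 * (1 + m * C * N)) with hδ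
    have hmCN : 0 ≤ m * C * N := by positivity
    have hδ0 : 0 < δ := by positivity
    have hδ1 : δ ≤ 1 := by
      rw [hδ, div_le_one (by positivity)]
      linarith
    -- For `k` large and `y` near `x₀` all unknowns lie within `δ` of the constants `u₀ c x₀`. This
    -- is where convergence in `C⁰_loc` enters the absorption.
    have hsmall : ∀ᶠ q : ℕ × Coord n in atTop ×ˢ 𝓝 x₀, ∀ c, |u c q.1 q.2 - u₀ c x₀| < δ :=
      eventually_all.2 fun c => by
        simpa [Real.dist_eq] using Metric.tendsto_nhds.1 ((hu c).tendsto x₀ hx₀) δ hδ0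
    obtain ⟨pa, hpa, pb, hpb, hab⟩ := eventually_prod_iff.1 hsmall
    obtain ⟨V, hV, hVo, hxV⟩ := mem_nhds_iff.1 (inter_mem hpb hK)
    obtain ⟨L, hL, hLV, hLc⟩ := local_compact_nhds (hVo.mem_nhds hxV)
    obtain ⟨ζ, hζ, hζc, hζs, hζ1⟩ := exists_cutoff hLc hVo hLV
    have hsK : tsupport ζ ⊆ K := hζs.trans fun y hy => (hV hy).2
    have hsM := hsK.trans hKM
    have hζ2 : ContDiff ℝ 2 ζ := by exact_mod_cast contDiff_infty.1 hζ 2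
    obtain ⟨Cζ, hCζ0, hCζ⟩ := exists_gagliardo_nirenberg hM hζ2 hζc hsM
    obtain ⟨DF, hDF0, hDF⟩ := hF.cutoff_sq_mul (fun k => (hFc k).pow 2)
      (fun k x => sq_nonneg _) hζ.continuous hζc hsM
    have hG := (BddIntegrals.sum Finset.univ (F := fun (p : ι × Fin n) k x =>
      pd p.2.succ (u p.1 k) x ^ 2) (fun p => (hu p.1).bdd _) fun p k => (cg p k).pow 2)
      _ hsM hζc.isCompact
    obtain ⟨DG, hDG⟩ := hG
    have hint : ∀ v : Coord n → ℝ, ContinuousOn v M → IntegrableOn v (tsupport ζ) := fun v hv =>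
      (hv.mono hsM).integrableOn_compact hζc.isCompact
    have hζM := hζ.continuous.continuousOn (s := M)
    set I : ℕ → ℝ := fun k => ∑ c, ∑ i : Fin n,
      ∫ x in tsupport ζ, ζ x ^ 2 * pd i.succ (u c k) x ^ 4 with hI
    have hI' : ∀ k, I k = ∫ x in tsupport ζ, ζ x ^ 2 *
        ∑ p : ι × Fin n, pd p.2.succ (u p.1 k) x ^ 4 := by
      intro k
      simp only [Finset.mul_sum]
      have hi : ∀ p : ι × Fin n, IntegrableOn (fun x => ζ x ^ 2 * pd p.2.succ (u p.1 k) x ^ 4)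
        (tsupport ζ) := fun p => hint _ ((hζM.pow 2).mul (cg4 p k))
      rw [integral_finsetSum _ fun p _ => hi p, Fintype.sum_prod_type]
    -- The factor `2` comes from absorbing `I k / 2`, which is legitimate because each `I k` is a
    -- finite number.
    have hev : ∀ᶠ k in atTop, I k ≤ 2 * (10 * (m * C * DF) + Cζ * (DG + m)) := by
      filter_upwards [hpa] with k hk
      have hlap : ∀ c, ∫ x in tsupport ζ, ζ x ^ 2 * spatialLaplacian (u c k) x ^ 2
          ≤ C * (N * I k + DF) := by
        intro c
        have i1 : IntegrableOn (fun x => ζ x ^ 2 *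
            ∑ p : ι × Fin n, pd p.2.succ (u p.1 k) x ^ 4) (tsupport ζ) :=
          hint _ ((hζM.pow 2).mul (continuousOn_finsetSum _ fun p _ => cg4 p k))
        have i2 : IntegrableOn (fun x => ζ x ^ 2 * F k x ^ 2) (tsupport ζ) :=
          hint _ ((hζM.pow 2).mul ((hFc k).pow 2))
        have i3 : IntegrableOn (fun x => ζ x ^ 2 * spatialLaplacian (u c k) x ^ 2) (tsupport ζ) :=
          hint _ ((hζM.pow 2).mul ((cΔ c k).pow 2))
        calc ∫ x in tsupport ζ, ζ x ^ 2 * spatialLaplacian (u c k) x ^ 2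
            ≤ ∫ x in tsupport ζ, C * (N * (ζ x ^ 2 *
                ∑ p : ι × Fin n, pd p.2.succ (u p.1 k) x ^ 4) + ζ x ^ 2 * F k x ^ 2) := by
              refine setIntegral_mono_on i3 (((i1.const_mul N).add i2).const_mul C)
                hζc.isCompact.measurableSet fun x hx => ?_
              have := mul_le_mul_of_nonneg_left (hC c k x (hsK hx)) (sq_nonneg (ζ x))
              refine this.trans (le_of_eq ?_)
              ring
          _ = C * (N * I k + ∫ x in tsupport ζ, ζ x ^ 2 * F k x ^ 2) := by
              rw [integral_const_mul, integral_add (i1.const_mul N) i2, integral_const_mul, hI']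
          _ ≤ C * (N * I k + DF) := by
              refine mul_le_mul_of_nonneg_left ?_ hC0
              linarith [hDF k]
      have hGN : ∀ c, ∑ i : Fin n, ∫ x in tsupport ζ, ζ x ^ 2 * pd i.succ (u c k) x ^ 4
          ≤ δ * (10 * (∑ i : Fin n, (∫ x in tsupport ζ, ζ x ^ 2 * pd i.succ (u c k) x ^ 4)
            + C * (N * I k + DF))
            + Cζ * (∑ i : Fin n, (∫ x in tsupport ζ, pd i.succ (u c k) x ^ 2) + 1)) := by
        intro c
        -- Subtracting the constant makes the function small without changing its derivatives.
        have := hCζ (fun y => u c k y - u₀ c x₀) (((hu c).contDiffOn k).sub contDiffOn_const)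
          δ hδ1 hδ0.le fun x hx => (hab hk (hV (hζs hx)).1 c).le
        simp only [spatialLaplacian, pd_sub_const] at this
        refine this.trans (mul_le_mul_of_nonneg_left ?_ hδ0.le)
        have hl := hlap c
        simp only [spatialLaplacian] at hl
        linarith
      have hsum := Finset.sum_le_sum fun c (_ : c ∈ Finset.univ) => hGN c
      have hDG' : ∑ c, ∑ i : Fin n, ∫ x in tsupport ζ, pd i.succ (u c k) x ^ 2 ≤ DG := by
        have hi : ∀ p : ι × Fin n, IntegrableOn (fun x => pd p.2.succ (u p.1 k) x ^ 2)
          (tsupport ζ) := fun p => hint _ ((cg p k).pow 2)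
        have := hDG k
        simp only at this
        rwa [integral_finsetSum _ fun p _ => hi p, Fintype.sum_prod_type] at this
      simp only [← Finset.mul_sum, Finset.sum_add_distrib, Finset.sum_const, Finset.card_univ,
        nsmul_eq_mul, mul_one, ← hm] at hsum
      change I k ≤ δ * (10 * (I k + C * (N * (m * I k) + m * DF)) + Cζ * (_ + m)) at hsum
      have hI0 : 0 ≤ I k := Finset.sum_nonneg fun c _ => Finset.sum_nonneg fun i _ =>
        integral_nonneg fun x => by positivity
      have e1 : δ * (10 * (1 + m * C * N)) = 1 / 2 := by
        rw [hδ]; field_simp; norm_num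
      have hR : δ * (10 * (m * C * DF) + Cζ * (DG + m)) ≤ 10 * (m * C * DF) + Cζ * (DG + m) := by
        have hDG0 : 0 ≤ DG := le_trans (Finset.sum_nonneg fun c _ => Finset.sum_nonneg fun i _ =>
          integral_nonneg fun x => by positivity) hDG'
        refine mul_le_of_le_one_left (by positivity) hδ1
      have h3 := mul_le_mul_of_nonneg_left (mul_le_mul_of_nonneg_left
        (add_le_add_left hDG' m) hCζ0) hδ0.le
      have e2 : δ * (10 * (I k + C * (N * (m * I k) + m * DF))) = 1 / 2 * I k
          + δ * (10 * (m * C * DF)) := by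
        rw [← e1]; ring
      nlinarith
    obtain ⟨D, hD⟩ := exists_bound_of_eventually hev
    refine ⟨L, hL, hLV.trans fun y hy => hKM (hV hy).2, hLc, D, fun k => ?_⟩
    have hLs : L ⊆ tsupport ζ := fun y hy => subset_tsupport _ (by simp [hζ1 y hy])
    calc ∫ y in L, pd p.2.succ (u p.1 k) y ^ 4
        = ∫ y in L, ζ y ^ 2 * pd p.2.succ (u p.1 k) y ^ 4 :=
          setIntegral_congr_fun hLc.measurableSet fun y hy => by simp [hζ1 y hy]
      _ ≤ ∫ y in tsupport ζ, ζ y ^ 2 * pd p.2.succ (u p.1 k) y ^ 4 :=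
          setIntegral_mono_set (hint _ ((hζM.pow 2).mul (cg4 p k)))
            (ae_of_all _ fun y => by positivity) (LE.le.eventuallyLE hLs)
      _ ≤ I k := by
          refine le_trans ?_ (Finset.single_le_sum (f := fun c => ∑ i : Fin n,
            ∫ x in tsupport ζ, ζ x ^ 2 * pd i.succ (u c k) x ^ 4) (fun c _ =>
            Finset.sum_nonneg fun i _ => integral_nonneg fun x => by positivity)
            (Finset.mem_univ p.1))
          exact Finset.single_le_sum (f := fun i : Fin n =>
            ∫ x in tsupport ζ, ζ x ^ 2 * pd i.succ (u p.1 k) x ^ 4) (fun i _ =>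
            integral_nonneg fun x => by positivity) (Finset.mem_univ p.2)
      _ ≤ D := hD k
  refine ⟨hu c, ?_, fun i => grad (c, i)⟩
  have cS : ∀ k, ContinuousOn (fun x => ∑ p : ι × Fin n, pd p.2.succ (u p.1 k) x ^ 4) M :=
    fun k => continuousOn_finsetSum _ fun p _ => cg4 p k
  refine ((BddIntegrals.sum Finset.univ grad cg4).add hF cS fun k => (hFc k).pow 2).of_le
    (fun k => (cΔ c k).pow 2) (fun k => (cS k).add ((hFc k).pow 2)) fun K hK hc => ?_
  obtain ⟨C, hC0, hC⟩ := H2 K hK hc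
  refine ⟨C * (N + 1), by positivity, fun k x hx => (hC c k x hx).trans ?_⟩
  rw [mul_assoc]
  refine mul_le_mul_of_nonneg_left ?_ hC0
  have h1 : 0 ≤ ∑ p : ι × Fin n, pd p.2.succ (u p.1 k) x ^ 4 :=
    Finset.sum_nonneg fun _ _ => by positivity
  have h2 := mul_nonneg hN0 (sq_nonneg (F k x))
  nlinarith

/-- Strong convergence in `L⁴_loc(M)` of continuous functions. -/
structure StrongL4 (M : Set (Coord n)) (f : ℕ → Coord n → ℝ) (f₀ : Coord n → ℝ) : Prop where
  cont : ∀ k, ContinuousOn (f k) M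
  contLim : ContinuousOn f₀ M
  tendsto : ∀ K ⊆ M, IsCompact K → Tendsto (fun k => ∫ x in K, (f k x - f₀ x) ^ 4) atTop (𝓝 0)

/-- Interpolation: the difference `f k - f₀` tends to zero uniformly on the support of the cutoff,
while its Laplacian in `L²` and its gradient in `L⁴` and `L²` stay bounded. The bound of
`exists_gagliardo_nirenberg` is then a quantity tending to zero times a bounded one. -/
theorem ConvLap.strongL4_pd (hM : IsOpen M) (hf : ConvLap M f f₀) (i : Fin n) :
    StrongL4 M (fun k => pd i.succ (f k)) (pd i.succ f₀) := by
  refine ⟨fun k => hf.continuousOn_pd hM k _,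
    continuousOn_pd hM (hf.contDiffOnLim.of_le (by norm_num)), fun K hK hc => ?_⟩
  have hd := hf.add hM ((ConvLap.const hf.contDiffOnLim hM).neg hM)
  set d : ℕ → Coord n → ℝ := fun k x => f k x + - f₀ x with hdd
  obtain ⟨ζ, hζ, hζc, hζs, hζ1⟩ := exists_cutoff hc hM hK
  have hζ2 : ContDiff ℝ 2 ζ := by exact_mod_cast contDiff_infty.1 hζ 2
  obtain ⟨C, hC0, hC⟩ := exists_gagliardo_nirenberg hM hζ2 hζc hζs
  have cd4 : ∀ (i : Fin n) k, ContinuousOn (fun x => pd i.succ (d k) x ^ 4) M := fun i k =>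
    (hd.continuousOn_pd hM k _).pow 4
  choose D4 hD40 hD4 using fun i : Fin n => (hd.grad i).cutoff_sq_mul (cd4 i)
    (fun k x => by positivity) hζ.continuous hζc hζs
  obtain ⟨DL, hDL0, hDL⟩ := hd.lap.cutoff_sq_mul (fun k => (hd.continuousOn_lap hM k).pow 2)
    (fun k x => by positivity) hζ.continuous hζc hζs
  choose D2 hD2 using fun i : Fin n => hd.bdd i.succ _ hζs hζc.isCompact
  set E : ℝ := |10 * (∑ i, D4 i + DL) + C * (∑ i, D2 i + 1)| + 1 with hE
  have hE0 : 0 < E := by positivity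
  rw [Metric.tendsto_nhds]
  intro ε hε
  -- `δ ≤ 1` is required by the inequality, and `δ E ≤ ε / 2` closes the estimate.
  set δ : ℝ := min 1 (ε / (2 * E)) with hδ
  have hδ0 : 0 < δ := lt_min one_pos (by positivity)
  filter_upwards [Metric.tendstoUniformlyOn_iff.1
    (hd.convC0.tendstoUniformlyOn hM hζs hζc.isCompact) δ hδ0] with k hk
  have hle := hC (d k) (hd.contDiffOn k) δ (min_le_left _ _) hδ0.le fun x hx => by
    have := hk x hx
    rw [Real.dist_eq, add_neg_cancel, zero_sub, abs_neg] at this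
    exact this.le
  have h1 : ∑ i : Fin n, ∫ x in tsupport ζ, ζ x ^ 2 * pd i.succ (d k) x ^ 4 ≤ δ * E := by
    refine hle.trans (mul_le_mul_of_nonneg_left ?_ hδ0.le)
    have s1 := Finset.sum_le_sum fun i (_ : i ∈ Finset.univ) => hD4 i k
    have s2 := Finset.sum_le_sum fun i (_ : i ∈ Finset.univ) => hD2 i k
    have s3 := mul_le_mul_of_nonneg_left (add_le_add_left s2 1) hC0
    have := le_abs_self (10 * (∑ i, D4 i + DL) + C * (∑ i, D2 i + 1))
    linarith [hDL k]
  have hint : IntegrableOn (fun x => ζ x ^ 2 * pd i.succ (d k) x ^ 4) (tsupport ζ) :=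
    (((hζ.continuous.continuousOn.pow 2).mul (cd4 i k)).mono hζs).integrableOn_compact
      hζc.isCompact
  have hKs : K ⊆ tsupport ζ := fun y hy => subset_tsupport _ (by simp [hζ1 y hy])
  have h2 : ∫ x in K, (pd i.succ (f k) x - pd i.succ f₀ x) ^ 4 ≤ δ * E := by
    calc ∫ x in K, (pd i.succ (f k) x - pd i.succ f₀ x) ^ 4
        = ∫ x in K, ζ x ^ 2 * pd i.succ (d k) x ^ 4 :=
          setIntegral_congr_fun hc.measurableSet fun x hx => by
            have hn : DifferentiableAt ℝ (fun x => - f₀ x) x :=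
              (differentiableAt_of_contDiffOn hM hf.contDiffOnLim (by norm_num) (hK hx)).neg
            simp only [hζ1 x hx, hdd, pd_add (hf.differentiableAt hM k (hK hx)) hn, pd_neg]
            ring
      _ ≤ ∫ x in tsupport ζ, ζ x ^ 2 * pd i.succ (d k) x ^ 4 :=
          setIntegral_mono_set hint (ae_of_all _ fun y => by positivity)
            (LE.le.eventuallyLE hKs)
      _ ≤ ∑ i : Fin n, ∫ x in tsupport ζ, ζ x ^ 2 * pd i.succ (d k) x ^ 4 :=
          Finset.single_le_sum (f := fun i : Fin n =>
            ∫ x in tsupport ζ, ζ x ^ 2 * pd i.succ (d k) x ^ 4) (fun i _ =>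
            integral_nonneg fun x => by positivity) (Finset.mem_univ i)
      _ ≤ δ * E := h1
  have h0 : 0 ≤ ∫ x in K, (pd i.succ (f k) x - pd i.succ f₀ x) ^ 4 :=
    integral_nonneg fun x => by positivity
  rw [Real.dist_eq, sub_zero, abs_of_nonneg h0]
  have h3 : δ * E ≤ ε / (2 * E) * E := mul_le_mul_of_nonneg_right (min_le_right _ _) hE0.le
  have h4 : ε / (2 * E) * E = ε / 2 := by field_simp
  linarith

theorem StrongL4.congr (hf : StrongL4 M f f₀) (h : ∀ k, Set.EqOn (g k) (f k) M)
    (h₀ : Set.EqOn g₀ f₀ M) : StrongL4 M g g₀ := by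
  refine ⟨fun k => (hf.cont k).congr (h k), hf.contLim.congr h₀, fun K hK hc => ?_⟩
  refine (hf.tendsto K hK hc).congr fun k => ?_
  exact setIntegral_congr_fun hc.measurableSet fun x hx => by
    simp only [h k (hK hx), h₀ (hK hx)]

theorem StrongL4.of_le {ι : Type*} [Fintype ι] {F : ι → ℕ → Coord n → ℝ}
    (hf : ∀ k, ContinuousOn (f k) M) (hf₀ : ContinuousOn f₀ M) (hFc : ∀ i k, ContinuousOn (F i k) M)
    (hF : ∀ i, ∀ K ⊆ M, IsCompact K → Tendsto (fun k => ∫ x in K, F i k x) atTop (𝓝 0))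
    (h : ∀ K ⊆ M, IsCompact K → ∃ C : ℝ, ∀ k, ∀ x ∈ K,
      (f k x - f₀ x) ^ 4 ≤ C * ∑ i, F i k x) : StrongL4 M f f₀ := by
  refine ⟨hf, hf₀, fun K hK hc => ?_⟩
  obtain ⟨C, hC⟩ := h K hK hc
  have hi : ∀ i k, IntegrableOn (F i k) K := fun i k =>
    ((hFc i k).mono hK).integrableOn_compact hc
  refine squeeze_zero (fun k => integral_nonneg fun x => by positivity) (fun k => ?_)
    (g := fun k => C * ∑ i, ∫ x in K, F i k x) ?_
  · rw [← integral_finsetSum _ fun i _ => hi i k, ← integral_const_mul]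
    exact setIntegral_mono_on (((((hf k).sub hf₀).pow 4).mono hK).integrableOn_compact hc)
      ((integrable_finsetSum _ fun i _ => hi i k).const_mul C) hc.measurableSet (hC k)
  · have := (tendsto_finsetSum Finset.univ fun i _ => hF i K hK hc).const_mul C
    simpa using this

theorem StrongL4.add (hf : StrongL4 M f f₀) (hg : StrongL4 M g g₀) :
    StrongL4 M (fun k x => f k x + g k x) (fun x => f₀ x + g₀ x) := by
  refine StrongL4.of_le (F := ![fun k x => (f k x - f₀ x) ^ 4, fun k x => (g k x - g₀ x) ^ 4])
    (fun k => (hf.cont k).add (hg.cont k)) (hf.contLim.add hg.contLim) ?_ ?_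
    fun K hK hc => ⟨8, fun k x hx => ?_⟩
  · intro i k
    fin_cases i
    · exact ((hf.cont k).sub hf.contLim).pow 4
    · exact ((hg.cont k).sub hg.contLim).pow 4
  · intro i
    fin_cases i
    · exact hf.tendsto
    · exact hg.tendsto
  · have := add_pow_four_le (f k x - f₀ x) (g k x - g₀ x)
    simp only [Fin.sum_univ_two, Matrix.cons_val_zero, Matrix.cons_val_one]
    refine le_trans (le_of_eq ?_) this
    ring

theorem ConvC0.tendsto_integral_pow (hM : IsOpen M) (h : ConvC0 M f f₀) {K : Set (Coord n)}
    (hK : K ⊆ M) (hc : IsCompact K) :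
    Tendsto (fun k => ∫ x in K, (f k x - f₀ x) ^ 4) atTop (𝓝 0) := by
  rw [Metric.tendsto_nhds]
  intro ε hε
  set V := (volume K).toReal
  have hV : 0 ≤ V := ENNReal.toReal_nonneg
  set δ : ℝ := min 1 (ε / (2 * (V + 1)))
  have hδ0 : 0 < δ := lt_min one_pos (by positivity)
  filter_upwards [Metric.tendstoUniformlyOn_iff.1 (h.tendstoUniformlyOn hM hK hc) δ hδ0] with k hk
  have h0 : 0 ≤ ∫ x in K, (f k x - f₀ x) ^ 4 := integral_nonneg fun x => by positivity
  rw [Real.dist_eq, sub_zero, abs_of_nonneg h0]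
  have h1 : ∫ x in K, (f k x - f₀ x) ^ 4 ≤ ∫ _ in K, δ := by
    refine setIntegral_mono_on (((((h.cont k).sub h.contLim).pow 4).mono hK).integrableOn_compact
      hc) (continuousOn_const.integrableOn_compact hc) hc.measurableSet fun x hx => ?_
    have h2 := hk x hx
    rw [dist_comm, Real.dist_eq] at h2
    rw [← (show Even 4 by decide).pow_abs]
    calc |f k x - f₀ x| ^ 4 ≤ δ ^ 4 := pow_le_pow_left₀ (abs_nonneg _) h2.le 4
      _ ≤ δ ^ 1 := pow_le_pow_of_le_one hδ0.le (min_le_left _ _) (by norm_num)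
      _ = δ := pow_one δ
  have h3 : ∫ _ in K, δ = V * δ := by simp [V, Measure.real]
  have h4 : V * δ ≤ (V + 1) * (ε / (2 * (V + 1))) :=
    mul_le_mul (by linarith) (min_le_right _ _) hδ0.le (by positivity)
  have h5 : (V + 1) * (ε / (2 * (V + 1))) = ε / 2 := by field_simp
  linarith

theorem StrongL4.of_convC0 (hM : IsOpen M) (h : ConvC0 M f f₀) : StrongL4 M f f₀ :=
  ⟨h.cont, h.contLim, fun _ hK hc => h.tendsto_integral_pow hM hK hc⟩

/-- The error is `f (g - g₀) + (f - f₀) g₀` with the index `k` on `f` and `g`: the factors `f` are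
uniformly bounded on compact sets and `g₀` is continuous. -/
theorem StrongL4.mul (hM : IsOpen M) (hf : ConvC0 M f f₀) (hg : StrongL4 M g g₀) :
    StrongL4 M (fun k x => f k x * g k x) (fun x => f₀ x * g₀ x) := by
  refine StrongL4.of_le (F := ![fun k x => (f k x - f₀ x) ^ 4, fun k x => (g k x - g₀ x) ^ 4])
    (fun k => (hf.cont k).mul (hg.cont k)) (hf.contLim.mul hg.contLim) ?_ ?_
    fun K hK hc => ?_
  · intro i k
    fin_cases i
    · exact ((hf.cont k).sub hf.contLim).pow 4
    · exact ((hg.cont k).sub hg.contLim).pow 4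
  · intro i
    fin_cases i
    · exact fun K hK hc => hf.tendsto_integral_pow hM hK hc
    · exact hg.tendsto
  · obtain ⟨C, hC0, hC⟩ := hf.exists_bound hM hK hc
    obtain ⟨D, hD⟩ := hc.exists_bound_of_continuousOn (hg.contLim.mono hK)
    refine ⟨8 * (C ^ 4 + D ^ 4), fun k x hx => ?_⟩
    simp only [Fin.sum_univ_two, Matrix.cons_val_zero, Matrix.cons_val_one]
    have h1 : f k x ^ 4 ≤ C ^ 4 := by
      rw [← (show Even 4 by decide).pow_abs]
      exact pow_le_pow_left₀ (abs_nonneg _) (hC k x hx) 4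
    have h2 : g₀ x ^ 4 ≤ D ^ 4 := by
      rw [← (show Even 4 by decide).pow_abs]
      exact pow_le_pow_left₀ (abs_nonneg _) (hD x hx) 4
    have h3 := add_pow_four_le (f k x * (g k x - g₀ x)) ((f k x - f₀ x) * g₀ x)
    have e : f k x * (g k x - g₀ x) + (f k x - f₀ x) * g₀ x
      = f k x * g k x - f₀ x * g₀ x := by ring
    rw [e, mul_pow, mul_pow] at h3
    have p1 : 0 ≤ (g k x - g₀ x) ^ 4 := by positivity
    have p2 : 0 ≤ (f k x - f₀ x) ^ 4 := by positivity
    have q1 := mul_le_mul_of_nonneg_right h1 p1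
    have q2 := mul_le_mul_of_nonneg_left h2 p2
    have n1 : 0 ≤ C ^ 4 * (f k x - f₀ x) ^ 4 := by positivity
    have n2 : 0 ≤ D ^ 4 * (g k x - g₀ x) ^ 4 := by positivity
    nlinarith

end QuadraticSystem

/-! ### Spatially conformally flat metrics in lapse-shift form -/

section LapseShift

/-- The metric `-N² dt² + a |dx + β dt|²` with shift `β = (b, c)`. -/
def admMatrix (N b c a : ℝ) : Matrix (Fin 3) (Fin 3) ℝ :=
  !![-N ^ 2 + a * (b ^ 2 + c ^ 2), a * b, a * c; a * b, a, 0; a * c, 0, a]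

/-- The inverse of `admMatrix N b c a`. -/
def admInverse (N b c a : ℝ) : Matrix (Fin 3) (Fin 3) ℝ :=
  !![-(N⁻¹ * N⁻¹), b * (N⁻¹ * N⁻¹), c * (N⁻¹ * N⁻¹);
    b * (N⁻¹ * N⁻¹), a⁻¹ + -(b * b * (N⁻¹ * N⁻¹)), -(b * c * (N⁻¹ * N⁻¹));
    c * (N⁻¹ * N⁻¹), -(b * c * (N⁻¹ * N⁻¹)), a⁻¹ + -(c * c * (N⁻¹ * N⁻¹))]

theorem inv_admMatrix {N b c a : ℝ} (hN : N ≠ 0) (ha : a ≠ 0) :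
    (admMatrix N b c a)⁻¹ = admInverse N b c a := by
  refine Matrix.inv_eq_right_inv ?_
  ext i j
  fin_cases i <;> fin_cases j <;>
    simp [admMatrix, admInverse, Matrix.mul_apply, Fin.sum_univ_three] <;> field_simp <;> ring

/-- Taking determinants in `Pᵀ A P = diag(-1, 1, 1)` gives `det A · (det P)² = -1`. The sign of `det
A` will yield positivity of the squared lapse. -/
theorem det_neg_of_isLorentzForm {A : Matrix (Fin 3) (Fin 3) ℝ} (h : IsLorentzForm (n := 2) A) :
    A.det < 0 := by
  obtain ⟨-, P, hP, hPA⟩ := h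
  have h1 := congrArg Matrix.det hPA
  rw [Matrix.det_mul, Matrix.det_mul, Matrix.det_transpose, minkowskiMatrix,
    Matrix.det_diagonal] at h1
  simp [Fin.prod_univ_succ] at h1
  have h2 : 0 < P.det ^ 2 := by positivity [hP.ne_zero]
  nlinarith

variable {M : Set (Coord 2)} {g : TensorField 2} {x : Coord 2}

/-- The square of the lapse in terms of the covariant components. -/
def lapseSq (g : TensorField 2) (x : Coord 2) : ℝ :=
  (g x 0 1 * g x 0 1 + g x 0 2 * g x 0 2) * (g x 1 1)⁻¹ + -(g x 0 0)

/-- Positivity of `lapseSq` follows from `det g = -lapseSq · (g₁₁)²`, the conformal factor being an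
exponential. -/
theorem metric_components (hg : IsLorentzianMetric M g) (hf : IsSpatiallyConformallyFlat M g)
    (hx : x ∈ M) : 0 < g x 1 1 ∧ g x 2 2 = g x 1 1 ∧ g x 1 2 = 0 ∧ g x 2 1 = 0 ∧
      g x 1 0 = g x 0 1 ∧ g x 2 0 = g x 0 2 ∧ 0 < lapseSq g x := by
  obtain ⟨γ, hγ⟩ := hf
  have h11 := hγ x hx 0 0
  have h12 := hγ x hx 0 1
  have h21 := hγ x hx 1 0
  have h22 := hγ x hx 1 1
  simp [spatialMetric] at h11 h12 h21 h22
  have hs := (hg.lorentz x hx).1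
  have h10 : g x 1 0 = g x 0 1 := hs.apply 0 1
  have h20 : g x 2 0 = g x 0 2 := hs.apply 0 2
  have ha : 0 < g x 1 1 := by rw [h11]; positivity
  have hd := det_neg_of_isLorentzForm (hg.lorentz x hx)
  refine ⟨ha, h22.trans h11.symm, h12, h21, h10, h20, ?_⟩
  rw [Matrix.det_fin_three, h10, h20, h12, h21, h22, ← h11] at hd
  have : lapseSq g x * g x 1 1 ^ 2 = -(g x 0 0 * g x 1 1 * g x 1 1 - g x 0 0 * 0 * 0
      - g x 0 1 * g x 0 1 * g x 1 1 + g x 0 1 * 0 * g x 0 2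
    + g x 0 2 * g x 0 1 * 0 - g x 0 2 * g x 1 1 * g x 0 2) := by
    simp only [lapseSq]
    field_simp
    ring
  have h3 : 0 < lapseSq g x * g x 1 1 ^ 2 := by rw [this]; linarith
  exact (mul_pos_iff_of_pos_right (by positivity)).1 h3

/-- The conformal factor `e^{2γ}` of the induced metric. -/
def conformalFactor (g : TensorField 2) (x : Coord 2) : ℝ := g x 1 1

theorem conformalFactor_pos (hg : IsLorentzianMetric M g) (hf : IsSpatiallyConformallyFlat M g)
    (hx : x ∈ M) : 0 < conformalFactor g x :=
  (metric_components hg hf hx).1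

theorem metric_eq_admMatrix (hg : IsLorentzianMetric M g) (hf : IsSpatiallyConformallyFlat M g)
    (hx : x ∈ M) : g x = admMatrix (√(lapseSq g x)) (g x 0 1 * (g x 1 1)⁻¹)
      (g x 0 2 * (g x 1 1)⁻¹) (conformalFactor g x) := by
  obtain ⟨ha, h22, h12, h21, h10, h20, hP⟩ := metric_components hg hf hx
  ext i j
  fin_cases i <;> fin_cases j <;>
    simp [admMatrix, conformalFactor, h22, h12, h21, h10, h20, Real.sq_sqrt hP.le] <;>
    first | done | (rw [lapseSq]; field_simp; ring) | field_simp

/-- Lapse and shift are defined through the inverse metric. Inverting the normal form explicitly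
expresses them by the covariant components, for which convergence and bounds are assumed. -/
theorem lapse_shift_eq (hg : IsLorentzianMetric M g) (hf : IsSpatiallyConformallyFlat M g)
    (hx : x ∈ M) : lapse g x = √(lapseSq g x) ∧ shift g 0 x = g x 0 1 * (g x 1 1)⁻¹ ∧
      shift g 1 x = g x 0 2 * (g x 1 1)⁻¹ := by
  obtain ⟨ha, -, -, -, -, -, hP⟩ := metric_components hg hf hx
  have hN : √(lapseSq g x) ≠ 0 := (Real.sqrt_pos.2 hP).ne'
  have hi : (g x)⁻¹ = _ := (congrArg _ (metric_eq_admMatrix hg hf hx)).trans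
    (inv_admMatrix hN (conformalFactor_pos hg hf hx).ne')
  refine ⟨?_, ?_, ?_⟩
  · simp only [lapse, invMetric, hi]
    simp [admInverse, Real.sqrt_mul_self]
  · simp only [shift, invMetric, hi]
    simp [admInverse]
    field_simp
  · simp only [shift, invMetric, hi]
    simp [admInverse]
    field_simp

theorem lapse_pos (hg : IsLorentzianMetric M g) (hf : IsSpatiallyConformallyFlat M g)
    (hx : x ∈ M) : 0 < lapse g x := by
  rw [(lapse_shift_eq hg hf hx).1]
  exact Real.sqrt_pos.2 (metric_components hg hf hx).2.2.2.2.2.2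

theorem metric_eq (hg : IsLorentzianMetric M g) (hf : IsSpatiallyConformallyFlat M g)
    (hx : x ∈ M) : g x = admMatrix (lapse g x) (shift g 0 x) (shift g 1 x)
      (conformalFactor g x) := by
  obtain ⟨h1, h2, h3⟩ := lapse_shift_eq hg hf hx
  rw [h1, h2, h3]
  exact metric_eq_admMatrix hg hf hx

theorem invMetric_eq (hg : IsLorentzianMetric M g) (hf : IsSpatiallyConformallyFlat M g)
    (hx : x ∈ M) (α β : Fin 3) : invMetric g α β x = admInverse (lapse g x) (shift g 0 x)
      (shift g 1 x) (conformalFactor g x) α β := by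
  rw [invMetric, metric_eq hg hf hx, inv_admMatrix (lapse_pos hg hf hx).ne'
    (conformalFactor_pos hg hf hx).ne']

theorem spatialInv_eq (hg : IsLorentzianMetric M g) (hf : IsSpatiallyConformallyFlat M g)
    (hx : x ∈ M) (i j : Fin 2) :
    spatialInv g i j x = if i = j then (conformalFactor g x)⁻¹ else 0 := by
  have hN := (lapse_pos hg hf hx).ne'
  have ha := (conformalFactor_pos hg hf hx).ne'
  simp only [spatialInv, invMetric_eq hg hf hx]
  fin_cases i <;> fin_cases j <;> simp [admInverse] <;> field_simp <;> ring

/-- The condition on the mean curvature is a transport equation for the conformal factor. -/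
theorem e0_conformalFactor (hM : IsOpen M) (hg : IsLorentzianMetric M g)
    (hf : IsSpatiallyConformallyFlat M g) {T : ℝ → ℝ} (hT : HasSliceMeanCurvature M g T)
    (hx : x ∈ M) :
    e0 g (conformalFactor g) x = conformalFactor g x * (pd 1 (shift g 0) x + pd 2 (shift g 1) x)
      - lapse g x * conformalFactor g x * T (x 0) := by
  have h1 := hT x hx
  have hN := (lapse_pos hg hf hx).ne'
  have ha := (conformalFactor_pos hg hf hx).ne'
  have hsm : ∀ i j : Fin 2, ∀ y ∈ M,
      spatialMetric g i j y = if i = j then conformalFactor g y else 0 := by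
    intro i j y hy
    rw [spatialMetric, metric_eq hg hf hy]
    fin_cases i <;> fin_cases j <;> simp [admMatrix]
  have he : ∀ i : Fin 2, e0 g (spatialMetric g i i) x = e0 g (conformalFactor g) x := by
    intro i
    have : Set.EqOn (spatialMetric g i i) (conformalFactor g) M := fun y hy => by
      simp [hsm i i y hy]
    simp only [e0, pd_congr_of_eqOn hM this hx]
  simp only [meanCurvature, spatialInv_eq hg hf hx, Fin.sum_univ_two] at h1
  simp [secondFundamentalForm, he, hsm _ _ x hx] at h1
  rw [← h1]
  field_simp
  ring

end LapseShift

/-! ### Convergence of lapse, shift and conformal factor -/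

section Convergence

variable {M : Set (Coord 2)} {gs : ℕ → TensorField 2} {g : TensorField 2}

/-- The three quantities arise from the covariant components by products, an inverse and a square
root at nonvanishing arguments, operations under which `ConvW12` is stable. -/
theorem convW12_lapse_shift (hM : IsOpen M) (hgs : ∀ k, IsLorentzianMetric M (gs k))
    (hg : IsLorentzianMetric M g) (hgs_flat : ∀ k, IsSpatiallyConformallyFlat M (gs k))
    (hg_flat : IsSpatiallyConformallyFlat M g)
    (h : ∀ α β, ConvW12 M (fun k x => gs k x α β) (fun x => g x α β)) :
    ConvW12 M (fun k => lapse (gs k)) (lapse g) ∧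
      (∀ i, ConvW12 M (fun k => shift (gs k) i) (shift g i)) ∧
      ConvW12 M (fun k => conformalFactor (gs k)) (conformalFactor g) := by
  have hinv : ConvW12 M (fun k x => (gs k x 1 1)⁻¹) (fun x => (g x 1 1)⁻¹) :=
    (h 1 1).inv hM (fun k x hx => (metric_components (hgs k) (hgs_flat k) hx).1.ne')
      fun x hx => (metric_components hg hg_flat hx).1.ne'
  have hsq : ConvW12 M (fun k => lapseSq (gs k)) (lapseSq g) :=
    ((((h 0 1).mul hM (h 0 1)).add hM ((h 0 2).mul hM (h 0 2))).mul hM hinv).add hM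
      ((h 0 0).neg hM)
  refine ⟨?_, fun i => ?_, h 1 1⟩
  · exact (hsq.sqrt hM
      (fun k x hx => (metric_components (hgs k) (hgs_flat k) hx).2.2.2.2.2.2.ne')
      fun x hx => (metric_components hg hg_flat hx).2.2.2.2.2.2.ne').congr hM
      (fun k x hx => (lapse_shift_eq (hgs k) (hgs_flat k) hx).1)
      fun x hx => (lapse_shift_eq hg hg_flat hx).1
  · fin_cases i
    · exact ((h 0 1).mul hM hinv).congr hM
        (fun k x hx => (lapse_shift_eq (hgs k) (hgs_flat k) hx).2.1)
        fun x hx => (lapse_shift_eq hg hg_flat hx).2.1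
    · exact ((h 0 2).mul hM hinv).congr hM
        (fun k x hx => (lapse_shift_eq (hgs k) (hgs_flat k) hx).2.2)
        fun x hx => (lapse_shift_eq hg hg_flat hx).2.2

end Convergence

/-! ### The Ricci tensor as a function of the derivatives of the metric -/

section RicciJet

variable {n : ℕ} {M : Set (Coord n)} {g : TensorField n} {x : Coord n}

/-- The first derivatives `∂_l g_{αβ}` at `x`. -/
def metricJet₁ (g : TensorField n) (x : Coord n) (l α β : Fin (n + 1)) : ℝ :=
  pd l (fun y => g y α β) x

/-- The second derivatives `∂_l ∂_m g_{αβ}` at `x`. -/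
def metricJet₂ (g : TensorField n) (x : Coord n) (l m α β : Fin (n + 1)) : ℝ :=
  pd l (pd m (fun y => g y α β)) x

theorem christoffel_eq_sum (l μ ν : Fin (n + 1)) :
    christoffel g l μ ν x = ∑ s, invMetric g l s x * christoffelJet (metricJet₁ g x) s μ ν := by
  simp only [christoffel, christoffelJet, metricJet₁, Finset.mul_sum]
  exact Finset.sum_congr rfl fun s _ => by ring

theorem contDiffOn_christoffelJet (hM : IsOpen M) (hg : ∀ α β, ContDiffOn ℝ 2 (fun y => g y α β) M)
    (s μ ν : Fin (n + 1)) :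
    ContDiffOn ℝ 1 (fun y => christoffelJet (metricJet₁ g y) s μ ν) M :=
  contDiffOn_const.mul (((contDiffOn_one_pd hM (hg _ _)).add (contDiffOn_one_pd hM (hg _ _))).sub
    (contDiffOn_one_pd hM (hg _ _)))

theorem contDiffOn_christoffel (hM : IsOpen M) (hg : ∀ α β, ContDiffOn ℝ 2 (fun y => g y α β) M)
    (hi : ∀ α β, ContDiffOn ℝ 2 (invMetric g α β) M) (l μ ν : Fin (n + 1)) :
    ContDiffOn ℝ 1 (christoffel g l μ ν) M :=
  (ContDiffOn.sum fun s _ => ((hi l s).of_le (by norm_num)).mul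
    (contDiffOn_christoffelJet hM hg s μ ν)).congr fun y _ => by
      simpa using christoffel_eq_sum l μ ν

theorem pd_christoffelJet (hM : IsOpen M) (hg : ∀ α β, ContDiffOn ℝ 2 (fun y => g y α β) M)
    (hx : x ∈ M) (m s μ ν : Fin (n + 1)) :
    pd m (fun y => christoffelJet (metricJet₁ g y) s μ ν) x
      = christoffelJet (metricJet₂ g x m) s μ ν := by
  have d : ∀ α β γ, DifferentiableAt ℝ (fun y => metricJet₁ g y α β γ) x := fun α β γ =>
    differentiableAt_of_contDiffOn hM (contDiffOn_one_pd hM (hg β γ)) le_rfl hx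
  simp only [christoffelJet]
  rw [pd_const_mul (f := fun y => metricJet₁ g y μ s ν + metricJet₁ g y ν s μ - metricJet₁ g y s μ ν)
      _ (((d _ _ _).add (d _ _ _)).sub (d _ _ _)),
    pd_sub (f := fun y => metricJet₁ g y μ s ν + metricJet₁ g y ν s μ) ((d _ _ _).add (d _ _ _))
      (d _ _ _), pd_add (d _ _ _) (d _ _ _)]
  rfl

/-- The covariant form of the derivative of the Christoffel symbols. -/
theorem pd_christoffel_add (hM : IsOpen M) (hg : ∀ α β, ContDiffOn ℝ 2 (fun y => g y α β) M)
    (hs : ∀ y ∈ M, (g y).IsSymm) (hu : ∀ y ∈ M, IsUnit (g y).det)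
    (hi : ∀ α β, ContDiffOn ℝ 2 (invMetric g α β) M) (hx : x ∈ M) (m l μ ν : Fin (n + 1)) :
    pd m (christoffel g l μ ν) x + ∑ σ, christoffel g l m σ x * christoffel g σ μ ν x
      = ∑ s, invMetric g l s x * (christoffelJet (metricJet₂ g x m) s μ ν
        - ∑ p, christoffelJet (metricJet₁ g x) p m s * christoffel g p μ ν x) := by
  have dg : ∀ α β, DifferentiableAt ℝ (fun y => g y α β) x := fun α β =>
    differentiableAt_of_contDiffOn hM (hg α β) (by norm_num) hx
  have dΓ : ∀ p, DifferentiableAt ℝ (christoffel g p μ ν) x := fun p =>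
    differentiableAt_of_contDiffOn hM (contDiffOn_christoffel hM hg hi p μ ν) le_rfl hx
  have hgi : ∀ y ∈ M, ∀ α β, ∑ s, g y α s * invMetric g s β y = if α = β then 1 else 0 := by
    intro y hy α β
    have := congrFun (congrFun (Matrix.mul_nonsing_inv _ (hu y hy)) α) β
    rwa [Matrix.mul_apply, Matrix.one_apply] at this
  have hig : ∀ y ∈ M, ∀ α β, ∑ s, invMetric g α s y * g y s β = if α = β then 1 else 0 := by
    intro y hy α β
    have := congrFun (congrFun (Matrix.nonsing_inv_mul _ (hu y hy)) α) β
    rwa [Matrix.mul_apply, Matrix.one_apply] at this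
  -- The identity with lowered index is the one to differentiate: then no derivative of the inverse
  -- metric appears.
  have lower : ∀ s, Set.EqOn (fun y => ∑ p, g y s p * christoffel g p μ ν y)
      (fun y => christoffelJet (metricJet₁ g y) s μ ν) M := by
    intro s y hy
    simp only [christoffel_eq_sum, Finset.mul_sum]
    rw [Finset.sum_comm]
    simp_rw [← mul_assoc, ← Finset.sum_mul, hgi y hy]
    simp
  have hder : ∀ s, ∑ p, g x s p * pd m (christoffel g p μ ν) x
      = christoffelJet (metricJet₂ g x m) s μ ν
        - ∑ p, metricJet₁ g x m s p * christoffel g p μ ν x := by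
    intro s
    have h1 := pd_congr_of_eqOn hM (lower s) hx (α := m)
    rw [pd_christoffelJet hM hg hx, pd_sum (F := fun p y => g y s p * christoffel g p μ ν y) _
      fun p _ => (dg s p).mul (dΓ p)] at h1
    have h2 : ∀ p, pd m (fun y => g y s p * christoffel g p μ ν y) x
        = g x s p * pd m (christoffel g p μ ν) x + metricJet₁ g x m s p * christoffel g p μ ν x :=
      fun p => pd_mul (dg s p) (dΓ p)
    simp only [h2, Finset.sum_add_distrib] at h1
    linarith
  have hraise : pd m (christoffel g l μ ν) x
      = ∑ s, invMetric g l s x * ∑ p, g x s p * pd m (christoffel g p μ ν) x := by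
    simp only [Finset.mul_sum]
    rw [Finset.sum_comm]
    simp_rw [← mul_assoc, ← Finset.sum_mul, hig x hx]
    simp
  have hsymm : ∀ α β γ, metricJet₁ g x α β γ = metricJet₁ g x α γ β := by
    intro α β γ
    exact pd_congr_of_eqOn hM (fun y hy => (hs y hy).apply γ β) hx
  -- Metric compatibility, `∂_m g_{sp} = Γ_{s,mp} + Γ_{p,ms}`. One of the two terms cancels the `ΓΓ`
  -- term being added, the other remains.
  have hmj : ∀ s p, metricJet₁ g x m s p = christoffelJet (metricJet₁ g x) s m p
      + christoffelJet (metricJet₁ g x) p m s := by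
    intro s p
    simp only [christoffelJet]
    rw [hsymm m p s, hsymm p s m, hsymm s p m]
    ring
  have hΓ : ∑ σ, christoffel g l m σ x * christoffel g σ μ ν x
      = ∑ s, invMetric g l s x * ∑ p, christoffelJet (metricJet₁ g x) s m p
        * christoffel g p μ ν x := by
    simp only [christoffel_eq_sum (x := x) l m, Finset.mul_sum, Finset.sum_mul, mul_assoc]
    rw [Finset.sum_comm]
  rw [hraise, hΓ, ← Finset.sum_add_distrib]
  refine Finset.sum_congr rfl fun s _ => ?_
  rw [hder, ← mul_add]
  congr 1
  simp only [hmj, add_mul, Finset.sum_add_distrib]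
  ring

/-- Each `∂Γ` is paired with the `ΓΓ` term that makes `pd_christoffel_add` applicable. The result is
an algebraic contraction of the inverse metric with the first and second derivatives of the metric
at one point, so it can be evaluated in any basis. -/
theorem ricci_eq_ricciJet (hM : IsOpen M) (hg : ∀ α β, ContDiffOn ℝ 2 (fun y => g y α β) M)
    (hs : ∀ y ∈ M, (g y).IsSymm) (hu : ∀ y ∈ M, IsUnit (g y).det)
    (hi : ∀ α β, ContDiffOn ℝ 2 (invMetric g α β) M) (hx : x ∈ M) (μ ν : Fin (n + 1)) :
    ricci g μ ν x = ricciJet (fun l s => invMetric g l s x) (metricJet₁ g x) (metricJet₂ g x)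
      μ ν := by
  have h := pd_christoffel_add hM hg hs hu hi hx
  have e : ricci g μ ν x = (∑ l, (pd l (christoffel g l μ ν) x
      + ∑ σ, christoffel g l l σ x * christoffel g σ μ ν x))
      - ∑ l, (pd ν (christoffel g l μ l) x
      + ∑ σ, christoffel g l ν σ x * christoffel g σ μ l x) := by
    simp only [ricci, Finset.sum_add_distrib]
    ring
  rw [e]
  simp only [h, ricciJet]
  rw [← Finset.sum_sub_distrib, ← Finset.sum_add_distrib]
  refine Finset.sum_congr rfl fun l _ => ?_
  rw [← Finset.sum_sub_distrib, ← Finset.sum_add_distrib]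
  refine Finset.sum_congr rfl fun s _ => ?_
  have e2 : ∑ p, ∑ q, invMetric g p q x *
      (christoffelJet (metricJet₁ g x) p ν s * christoffelJet (metricJet₁ g x) q μ l
        - christoffelJet (metricJet₁ g x) p l s * christoffelJet (metricJet₁ g x) q μ ν)
      = (∑ p, christoffelJet (metricJet₁ g x) p ν s * christoffel g p μ l x)
        - ∑ p, christoffelJet (metricJet₁ g x) p l s * christoffel g p μ ν x := by
    rw [← Finset.sum_sub_distrib]
    refine Finset.sum_congr rfl fun p _ => ?_
    rw [christoffel_eq_sum, christoffel_eq_sum, Finset.mul_sum, Finset.mul_sum,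
      ← Finset.sum_sub_distrib]
    exact Finset.sum_congr rfl fun q _ => by ring
  rw [e2]
  ring

end RicciJet

/-! ### Change of basis in the Ricci expression -/

section Frame

variable {G : Fin 3 → Fin 3 → ℝ} {η : Fin 3 → ℝ} {E : Fin 3 → Fin 3 → ℝ}

/-- The components of a trilinear form in the frame `E`. -/
def frameJet₁ (E : Fin 3 → Fin 3 → ℝ) (D : Fin 3 → Fin 3 → Fin 3 → ℝ) (A B C : Fin 3) : ℝ :=
  ∑ l, E A l * ∑ μ, ∑ ν, E B μ * E C ν * D l μ ν

/-- The components of a quadrilinear form in the frame `E`. -/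
def frameJet₂ (E : Fin 3 → Fin 3 → ℝ) (H : Fin 3 → Fin 3 → Fin 3 → Fin 3 → ℝ)
    (A A' B C : Fin 3) : ℝ :=
  ∑ l, ∑ m, E A l * E A' m * ∑ μ, ∑ ν, E B μ * E C ν * H l m μ ν

theorem sum_frame (hG : ∀ l s, G l s = ∑ A, η A * (E A l * E A s)) (F : Fin 3 → Fin 3 → ℝ) :
    ∑ l, ∑ s, G l s * F l s = ∑ A, η A * ∑ l, ∑ s, E A l * E A s * F l s := by
  simp only [hG, Finset.sum_mul, Finset.mul_sum]
  rw [Finset.sum_congr rfl fun l _ => Finset.sum_comm, Finset.sum_comm]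
  simp only [mul_assoc]

theorem christoffelJet_frame (D : Fin 3 → Fin 3 → Fin 3 → ℝ) (A B C : Fin 3) :
    christoffelJet (frameJet₁ E D) A B C
      = ∑ s, ∑ μ, ∑ ν, E A s * E B μ * E C ν * christoffelJet D s μ ν := by
  simp only [christoffelJet, frameJet₁, Fin.sum_univ_three]
  ring

theorem christoffelJet_frame₂ (H : Fin 3 → Fin 3 → Fin 3 → Fin 3 → ℝ) (F A B C : Fin 3) :
    christoffelJet (frameJet₂ E H F) A B C
      = ∑ l, ∑ s, ∑ μ, ∑ ν, E F l * E A s * E B μ * E C ν * christoffelJet (H l) s μ ν := by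
  simp only [christoffelJet, frameJet₂, Fin.sum_univ_three]
  ring

/-- The matrix `E` acts as a linear change of coordinates with constant coefficients, so derivatives
of the frame never enter. The hypothesis `hG` says that the inverse metric is diagonal in this
frame. -/
theorem ricciJet_frame (hG : ∀ l s, G l s = ∑ A, η A * (E A l * E A s))
    (D : Fin 3 → Fin 3 → Fin 3 → ℝ) (H : Fin 3 → Fin 3 → Fin 3 → Fin 3 → ℝ) (B C : Fin 3) :
    ∑ μ, ∑ ν, E B μ * E C ν * ricciJet G D H μ ν
      = ricciJet (fun A A' => if A = A' then η A else 0) (frameJet₁ E D) (frameJet₂ E H) B C := by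
  have lin : ∀ A, ∑ μ, ∑ ν, E B μ * E C ν * ∑ l, ∑ s, E A l * E A s *
      (christoffelJet (H l) s μ ν - christoffelJet (H ν) s μ l)
      = christoffelJet (frameJet₂ E H A) A B C - christoffelJet (frameJet₂ E H C) A B A := by
    intro A
    simp only [christoffelJet_frame₂, Fin.sum_univ_three]
    ring
  have quad : ∀ A P, ∑ μ, ∑ ν, E B μ * E C ν * ∑ l, ∑ s, E A l * E A s * ∑ p, ∑ q, E P p * E P q *
      (christoffelJet D p ν s * christoffelJet D q μ l
        - christoffelJet D p l s * christoffelJet D q μ ν)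
      = christoffelJet (frameJet₁ E D) P C A * christoffelJet (frameJet₁ E D) P B A
        - christoffelJet (frameJet₁ E D) P A A * christoffelJet (frameJet₁ E D) P B C := by
    intro A P
    -- The contraction of the upper index with `E P` is abbreviated to keep the polynomial identity
    -- small.
    obtain ⟨y, hy⟩ : ∃ y : Fin 3 → Fin 3 → ℝ, ∀ ν s, y ν s
      = ∑ p, E P p * christoffelJet D p ν s := ⟨_, fun _ _ => rfl⟩
    have h1 : ∀ F K, christoffelJet (frameJet₁ E D) P F K
        = ∑ ν, ∑ s, E F ν * E K s * y ν s := by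
      intro F K
      simp only [christoffelJet_frame, hy, Fin.sum_univ_three]
      ring
    have h2 : ∀ ν s μ l, ∑ p, ∑ q, E P p * E P q *
      (christoffelJet D p ν s * christoffelJet D q μ l
        - christoffelJet D p l s * christoffelJet D q μ ν) = y ν s * y μ l - y l s * y μ ν := by
      intro ν s μ l
      simp only [hy, Fin.sum_univ_three]
      ring
    simp only [h1, h2]
    simp only [Fin.sum_univ_three]
    ring
  have expand : ∀ μ ν, ricciJet G D H μ ν
      = (∑ A, η A * ∑ l, ∑ s, E A l * E A s *
          (christoffelJet (H l) s μ ν - christoffelJet (H ν) s μ l))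
        + ∑ A, η A * ∑ P, η P * ∑ l, ∑ s, E A l * E A s * ∑ p, ∑ q, E P p * E P q *
          (christoffelJet D p ν s * christoffelJet D q μ l
            - christoffelJet D p l s * christoffelJet D q μ ν) := by
    intro μ ν
    rw [ricciJet, sum_frame hG, sum_frame hG]
    congr 1
    refine Finset.sum_congr rfl fun A _ => ?_
    congr 1
    simp only [sum_frame hG]
    simp only [Finset.mul_sum]
    rw [Finset.sum_congr rfl fun l _ => Finset.sum_comm, Finset.sum_comm]
    refine Finset.sum_congr rfl fun P _ => Finset.sum_congr rfl fun l _ =>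
      Finset.sum_congr rfl fun s _ => Finset.sum_congr rfl fun p _ =>
      Finset.sum_congr rfl fun q _ => by ring
  have rhs : ricciJet (fun A A' => if A = A' then η A else 0) (frameJet₁ E D) (frameJet₂ E H) B C
      = (∑ A, η A * (christoffelJet (frameJet₂ E H A) A B C
          - christoffelJet (frameJet₂ E H C) A B A))
        + ∑ A, η A * ∑ P, η P * (christoffelJet (frameJet₁ E D) P C A *
          christoffelJet (frameJet₁ E D) P B A
        - christoffelJet (frameJet₁ E D) P A A * christoffelJet (frameJet₁ E D) P B C) := by
    simp only [ricciJet, ite_mul, zero_mul, Finset.sum_ite_eq, Finset.mem_univ, if_true]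
  rw [rhs]
  have comm : ∀ X : Fin 3 → Fin 3 → Fin 3 → ℝ,
      ∑ μ, ∑ ν, E B μ * E C ν * ∑ A, η A * X A μ ν
        = ∑ A, η A * ∑ μ, ∑ ν, E B μ * E C ν * X A μ ν := by
    intro X
    simp only [Fin.sum_univ_three]
    ring
  simp only [← lin, ← quad, expand, mul_add, Finset.sum_add_distrib]
  rw [comm, comm]
  simp only [comm]

end Frame

/-! ### The elliptic equations for the lapse, the shift and the conformal factor -/

section FrameAlgebra

/-- The frame `e₀ = ∂₀ - b ∂₁ - c ∂₂, ∂₁, ∂₂`. -/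
def shiftFrame (b c : ℝ) : Fin 3 → Fin 3 → ℝ :=
  ![![1, -b, -c], ![0, 1, 0], ![0, 0, 1]]

/-- First derivatives of the components of `admMatrix`. -/
def admComponentJet₁ (N b c a : ℝ) (n' b' c' a' : Fin 3 → ℝ) (l μ ν : Fin 3) : ℝ :=
  !![-(2 * N * n' l) + (a' l * (b ^ 2 + c ^ 2) + 2 * a * (b * b' l + c * c' l)),
      a * b' l + a' l * b, a * c' l + a' l * c;
    a * b' l + a' l * b, a' l, 0; a * c' l + a' l * c, 0, a' l] μ ν

/-- Second derivatives of the components of `admMatrix`. -/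
def admComponentJet₂ (N b c a : ℝ) (n' b' c' a' : Fin 3 → ℝ) (n'' b'' c'' a'' : Fin 3 → Fin 3 → ℝ)
    (l m μ ν : Fin 3) : ℝ :=
  !![-(2 * (n' l * n' m + N * n'' l m)) + (a'' l m * (b ^ 2 + c ^ 2)
        + 2 * a' l * (b * b' m + c * c' m) + 2 * a' m * (b * b' l + c * c' l)
        + 2 * a * (b' l * b' m + c' l * c' m + b * b'' l m + c * c'' l m)),
      a * b'' l m + a' l * b' m + a' m * b' l + a'' l m * b,
      a * c'' l m + a' l * c' m + a' m * c' l + a'' l m * c;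
    a * b'' l m + a' l * b' m + a' m * b' l + a'' l m * b, a'' l m, 0;
    a * c'' l m + a' l * c' m + a' m * c' l + a'' l m * c, 0, a'' l m] μ ν

/-- Frame components of a gradient. -/
def frameGrad (E : Fin 3 → Fin 3 → ℝ) (n' : Fin 3 → ℝ) (A : Fin 3) : ℝ := ∑ l, E A l * n' l

/-- Frame components of a Hessian. -/
def frameHess (E : Fin 3 → Fin 3 → ℝ) (n'' : Fin 3 → Fin 3 → ℝ) (A A' : Fin 3) : ℝ :=
  ∑ l, ∑ m, E A l * E A' m * n'' l m

variable (N b c a : ℝ) (n' b' c' a' : Fin 3 → ℝ) (n'' b'' c'' a'' : Fin 3 → Fin 3 → ℝ)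

theorem admInverse_eq_sum_shiftFrame (l s : Fin 3) : admInverse N b c a l s
    = ∑ A, (if A = 0 then -(N ^ 2)⁻¹ else a⁻¹) * (shiftFrame b c A l * shiftFrame b c A s) := by
  fin_cases l <;> fin_cases s <;> simp [admInverse, shiftFrame, Fin.sum_univ_three] <;> ring

/-- Evaluating in the frame frozen at the point amounts to a linear shear that makes the shift
vanish there. Only its derivatives survive. -/
theorem frameJet₁_adm : frameJet₁ (shiftFrame b c) (admComponentJet₁ N b c a n' b' c' a')
    = admJet₁ N a (frameGrad (shiftFrame b c) n') (frameGrad (shiftFrame b c) b')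
      (frameGrad (shiftFrame b c) c') (frameGrad (shiftFrame b c) a') := by
  funext A B C
  -- The derivative index is kept arbitrary, so only the two tensor indices need a case distinction.
  generalize hE : shiftFrame b c A = EA
  fin_cases B <;> fin_cases C <;>
    simp [frameJet₁, frameGrad, admJet₁, admComponentJet₁, hE, Fin.sum_univ_three] <;>
    simp [shiftFrame] <;> ring

theorem frameJet₂_adm :
    frameJet₂ (shiftFrame b c) (admComponentJet₂ N b c a n' b' c' a' n'' b'' c'' a'')
    = admJet₂ N a (frameGrad (shiftFrame b c) n') (frameGrad (shiftFrame b c) b')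
      (frameGrad (shiftFrame b c) c') (frameGrad (shiftFrame b c) a')
      (frameHess (shiftFrame b c) n'') (frameHess (shiftFrame b c) b'')
      (frameHess (shiftFrame b c) c'') (frameHess (shiftFrame b c) a'') := by
  funext A A' B C
  generalize hE : shiftFrame b c A = EA
  generalize hE' : shiftFrame b c A' = EA'
  fin_cases B <;> fin_cases C <;>
    simp [frameJet₂, frameGrad, frameHess, admJet₂, admComponentJet₂, hE, hE',
      Fin.sum_univ_three] <;>
    simp [shiftFrame] <;> ring

end FrameAlgebra

/-! ### Derivatives of the metric in terms of lapse, shift and conformal factor -/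

section EllipticEquations

variable {M : Set (Coord 2)} {g : TensorField 2} {N b c a : Coord 2 → ℝ} {x : Coord 2}

theorem pd_pd_congr {n : ℕ} {M : Set (Coord n)} {u v : Coord n → ℝ} {x : Coord n} (hM : IsOpen M)
    (h : Set.EqOn u v M) (hx : x ∈ M) (α β : Fin (n + 1)) :
    pd α (pd β u) x = pd α (pd β v) x :=
  pd_congr_of_eqOn hM (fun _ hy => pd_congr_of_eqOn hM h hy) hx

theorem pd_pd_const_mul {n : ℕ} {M : Set (Coord n)} {u : Coord n → ℝ} {x : Coord n}
    (hM : IsOpen M) (hu : ContDiffOn ℝ 2 u M) (hx : x ∈ M) (r : ℝ) (α β : Fin (n + 1)) :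
    pd α (pd β (fun y => r * u y)) x = r * pd α (pd β u) x := by
  have e : Set.EqOn (pd β (fun y => r * u y)) (fun y => r * pd β u y) M := fun y hy =>
    pd_const_mul r (differentiableAt_of_contDiffOn hM hu (by norm_num) hy)
  rw [pd_congr_of_eqOn hM e hx]
  exact pd_const_mul r (differentiableAt_of_contDiffOn hM (contDiffOn_one_pd hM hu) le_rfl hx)

theorem metricJet_adm (hM : IsOpen M) (hN : ContDiffOn ℝ 2 N M) (hb : ContDiffOn ℝ 2 b M)
    (hc : ContDiffOn ℝ 2 c M) (ha : ContDiffOn ℝ 2 a M)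
    (hg : ∀ y ∈ M, g y = admMatrix (N y) (b y) (c y) (a y)) (hx : x ∈ M) :
    metricJet₁ g x = admComponentJet₁ (N x) (b x) (c x) (a x) (fun l => pd l N x)
        (fun l => pd l b x) (fun l => pd l c x) (fun l => pd l a x) ∧
    metricJet₂ g x = admComponentJet₂ (N x) (b x) (c x) (a x) (fun l => pd l N x)
        (fun l => pd l b x) (fun l => pd l c x) (fun l => pd l a x)
        (fun l m => pd l (pd m N) x) (fun l m => pd l (pd m b) x)
        (fun l m => pd l (pd m c) x) (fun l m => pd l (pd m a) x) := by
  have d : ∀ {u : Coord 2 → ℝ}, ContDiffOn ℝ 2 u M → DifferentiableAt ℝ u x := fun hu =>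
    differentiableAt_of_contDiffOn hM hu (by norm_num) hx
  have e00 : Set.EqOn (fun y => g y 0 0)
      (fun y => (-1) * (N y * N y) + a y * (b y * b y + c y * c y)) M := fun y hy => by
    simp only [hg y hy]; simp [admMatrix]; ring
  have e01 : Set.EqOn (fun y => g y 0 1) (fun y => a y * b y) M := fun y hy => by
    simp only [hg y hy]; simp [admMatrix]
  have e10 : Set.EqOn (fun y => g y 1 0) (fun y => a y * b y) M := fun y hy => by
    simp only [hg y hy]; simp [admMatrix]
  have e02 : Set.EqOn (fun y => g y 0 2) (fun y => a y * c y) M := fun y hy => by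
    simp only [hg y hy]; simp [admMatrix]
  have e20 : Set.EqOn (fun y => g y 2 0) (fun y => a y * c y) M := fun y hy => by
    simp only [hg y hy]; simp [admMatrix]
  have e11 : Set.EqOn (fun y => g y 1 1) a M := fun y hy => by
    simp only [hg y hy]; simp [admMatrix]
  have e22 : Set.EqOn (fun y => g y 2 2) a M := fun y hy => by
    simp only [hg y hy]; simp [admMatrix]
  have e12 : Set.EqOn (fun y => g y 1 2) (fun _ => 0) M := fun y hy => by
    simp only [hg y hy]; simp [admMatrix]
  have e21 : Set.EqOn (fun y => g y 2 1) (fun _ => 0) M := fun y hy => by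
    simp only [hg y hy]; simp [admMatrix]
  have hNN := hN.mul hN
  have hbb := hb.mul hb
  have hcc := hc.mul hc
  have hz : ∀ β : Fin 3, pd (n := 2) β (fun _ => (0 : ℝ)) = fun _ => 0 := fun β =>
    funext fun y => pd_const 0
  constructor
  · funext l μ ν
    have h00 : pd l (fun y => (-1) * (N y * N y) + a y * (b y * b y + c y * c y)) x
        = -(2 * N x * pd l N x) + (pd l a x * (b x ^ 2 + c x ^ 2)
          + 2 * a x * (b x * pd l b x + c x * pd l c x)) := by
      rw [pd_add (f := fun y => (-1) * (N y * N y)) (g := fun y => a y * (b y * b y + c y * c y))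
        ((d hNN).const_mul _) ((d ha).mul ((d hbb).add (d hcc))),
        pd_const_mul (f := fun y => N y * N y) _ (d hNN), pd_mul (d hN) (d hN),
        pd_mul (g := fun y => b y * b y + c y * c y) (d ha) ((d hbb).add (d hcc)),
        pd_add (f := fun y => b y * b y) (g := fun y => c y * c y) (d hbb) (d hcc),
        pd_mul (d hb) (d hb), pd_mul (d hc) (d hc)]
      ring
    fin_cases μ <;> fin_cases ν <;> simp [metricJet₁, admComponentJet₁]
    · rw [pd_congr_of_eqOn hM e00 hx, h00]
    · rw [pd_congr_of_eqOn hM e01 hx, pd_mul (d ha) (d hb)]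
    · rw [pd_congr_of_eqOn hM e02 hx, pd_mul (d ha) (d hc)]
    · rw [pd_congr_of_eqOn hM e10 hx, pd_mul (d ha) (d hb)]
    · rw [pd_congr_of_eqOn hM e11 hx]
    · rw [pd_congr_of_eqOn hM e12 hx, pd_const]
    · rw [pd_congr_of_eqOn hM e20 hx, pd_mul (d ha) (d hc)]
    · rw [pd_congr_of_eqOn hM e21 hx, pd_const]
    · rw [pd_congr_of_eqOn hM e22 hx]
  · funext l m μ ν
    have h00 : pd l (pd m (fun y => (-1) * (N y * N y) + a y * (b y * b y + c y * c y))) x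
        = -(2 * (pd l N x * pd m N x + N x * pd l (pd m N) x))
          + (pd l (pd m a) x * (b x ^ 2 + c x ^ 2)
          + 2 * pd l a x * (b x * pd m b x + c x * pd m c x)
          + 2 * pd m a x * (b x * pd l b x + c x * pd l c x)
          + 2 * a x * (pd l b x * pd m b x + pd l c x * pd m c x + b x * pd l (pd m b) x
            + c x * pd l (pd m c) x)) := by
      rw [pd_pd_add hM (contDiffOn_const.mul hNN) (ha.mul (hbb.add hcc)) hx,
        pd_pd_const_mul hM hNN hx, pd_pd_mul hM hN hN hx,
        pd_pd_mul hM ha (hbb.add hcc) hx, pd_pd_add hM hbb hcc hx, pd_pd_mul hM hb hb hx,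
        pd_pd_mul hM hc hc hx, pd_add (f := fun y => b y * b y) (g := fun y => c y * c y)
          (d hbb) (d hcc), pd_mul (d hb) (d hb), pd_mul (d hc) (d hc),
        pd_add (f := fun y => b y * b y) (g := fun y => c y * c y)
          (d hbb) (d hcc), pd_mul (d hb) (d hb), pd_mul (d hc) (d hc)]
      ring
    fin_cases μ <;> fin_cases ν <;> simp [metricJet₂, admComponentJet₂]
    · rw [pd_pd_congr hM e00 hx, h00]
    · rw [pd_pd_congr hM e01 hx, pd_pd_mul hM ha hb hx]
    · rw [pd_pd_congr hM e02 hx, pd_pd_mul hM ha hc hx]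
    · rw [pd_pd_congr hM e10 hx, pd_pd_mul hM ha hb hx]
    · rw [pd_pd_congr hM e11 hx]
    · rw [pd_pd_congr hM e12 hx, hz, pd_const]
    · rw [pd_pd_congr hM e20 hx, pd_pd_mul hM ha hc hx]
    · rw [pd_pd_congr hM e21 hx, hz, pd_const]
    · rw [pd_pd_congr hM e22 hx]

end EllipticEquations

/-! ### The gauge equations for the Ricci components -/

section RicciEquations

variable {M : Set (Coord 2)} {g : TensorField 2} {x : Coord 2}

theorem contDiffOn_lapse_shift (hM : IsOpen M) (hg : IsLorentzianMetric M g)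
    (hf : IsSpatiallyConformallyFlat M g) : ContDiffOn ℝ 2 (lapse g) M ∧
      (∀ i, ContDiffOn ℝ 2 (shift g i) M) ∧ ContDiffOn ℝ 2 (conformalFactor g) M := by
  -- Regularity is read off from the convergence statement for a constant sequence.
  obtain ⟨h1, h2, h3⟩ := convW12_lapse_shift hM (fun _ : ℕ => hg) hg (fun _ => hf) hf
    fun α β => ConvW12.const (hg.contDiffOn α β) hM
  exact ⟨h1.contDiffOnLim, fun i => (h2 i).contDiffOnLim, h3.contDiffOnLim⟩

theorem contDiffOn_admInverse {N b c a : Coord 2 → ℝ} (hN : ContDiffOn ℝ 2 N M)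
    (hb : ContDiffOn ℝ 2 b M) (hc : ContDiffOn ℝ 2 c M) (ha : ContDiffOn ℝ 2 a M)
    (hN0 : ∀ y ∈ M, N y ≠ 0) (ha0 : ∀ y ∈ M, a y ≠ 0) (α β : Fin 3) :
    ContDiffOn ℝ 2 (fun y => admInverse (N y) (b y) (c y) (a y) α β) M := by
  have hNi := (hN.inv hN0).mul (hN.inv hN0)
  have hai := ha.inv ha0
  fin_cases α <;> fin_cases β
  · exact hNi.neg
  · exact hb.mul hNi
  · exact hc.mul hNi
  · exact hb.mul hNi
  · exact hai.add ((hb.mul hb).mul hNi).neg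
  · exact ((hb.mul hc).mul hNi).neg
  · exact hc.mul hNi
  · exact ((hb.mul hc).mul hNi).neg
  · exact hai.add ((hc.mul hc).mul hNi).neg

theorem contDiffOn_invMetric (hM : IsOpen M) (hg : IsLorentzianMetric M g)
    (hf : IsSpatiallyConformallyFlat M g) (α β : Fin 3) :
    ContDiffOn ℝ 2 (invMetric g α β) M := by
  obtain ⟨hN, hb, ha⟩ := contDiffOn_lapse_shift hM hg hf
  exact (contDiffOn_admInverse hN (hb 0) (hb 1) ha (fun y hy => (lapse_pos hg hf hy).ne')
    (fun y hy => (conformalFactor_pos hg hf hy).ne') α β).congr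
    fun y hy => invMetric_eq hg hf hy α β

/-- The components of the Ricci tensor in the frame `e₀, ∂₁, ∂₂`. -/
def frameRicci (g : TensorField 2) (x : Coord 2) (B C : Fin 3) : ℝ :=
  ∑ μ, ∑ ν, shiftFrame (shift g 0 x) (shift g 1 x) B μ *
    shiftFrame (shift g 0 x) (shift g 1 x) C ν * ricci g μ ν x

theorem frameRicci_eq_ricciJet (hM : IsOpen M) (hg : IsLorentzianMetric M g)
    (hf : IsSpatiallyConformallyFlat M g) (hx : x ∈ M) (B C : Fin 3) :
    frameRicci g x B C = ricciJet (diagJet (lapse g x) (conformalFactor g x))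
      (frameJet₁ (shiftFrame (shift g 0 x) (shift g 1 x)) (metricJet₁ g x))
      (frameJet₂ (shiftFrame (shift g 0 x) (shift g 1 x)) (metricJet₂ g x)) B C := by
  have h := ricci_eq_ricciJet hM hg.contDiffOn (fun y hy => (hg.lorentz y hy).1)
    (fun y hy => (det_neg_of_isLorentzForm (hg.lorentz y hy)).ne.isUnit)
    (contDiffOn_invMetric hM hg hf) hx
  simp only [frameRicci, h]
  exact ricciJet_frame (fun l s => (invMetric_eq hg hf hx l s).trans
    (admInverse_eq_sum_shiftFrame _ _ _ _ l s)) _ _ B C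

/-- The derivative of the transport equation for the conformal factor. -/
theorem pd_e0_conformalFactor (hM : IsOpen M) (hg : IsLorentzianMetric M g)
    (hf : IsSpatiallyConformallyFlat M g) {T : ℝ → ℝ} (hT : HasSliceMeanCurvature M g T) {T' : ℝ}
    (hT' : ∀ t, HasDerivAt T T' t) (hx : x ∈ M) (l : Fin 3) :
    pd l (pd 0 (conformalFactor g)) x - shift g 0 x * pd l (pd 1 (conformalFactor g)) x
        - shift g 1 x * pd l (pd 2 (conformalFactor g)) x
      = pd l (shift g 0) x * pd 1 (conformalFactor g) x
        + pd l (shift g 1) x * pd 2 (conformalFactor g) x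
        + pd l (conformalFactor g) x * (pd 1 (shift g 0) x + pd 2 (shift g 1) x)
        + conformalFactor g x * (pd l (pd 1 (shift g 0)) x + pd l (pd 2 (shift g 1)) x)
        - (pd l (lapse g) x * conformalFactor g x + lapse g x * pd l (conformalFactor g) x)
          * T (x 0)
        - lapse g x * conformalFactor g x * (if l = 0 then T' else 0) := by
  obtain ⟨hN, hβ, ha⟩ := contDiffOn_lapse_shift hM hg hf
  have hb := hβ 0
  have hc := hβ 1
  have d : ∀ {u : Coord 2 → ℝ}, ContDiffOn ℝ 2 u M → DifferentiableAt ℝ u x := fun hu =>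
    differentiableAt_of_contDiffOn hM hu (by norm_num) hx
  have d' : ∀ {u : Coord 2 → ℝ} (α : Fin 3), ContDiffOn ℝ 2 u M → DifferentiableAt ℝ (pd α u) x :=
    fun α hu => differentiableAt_of_contDiffOn hM (contDiffOn_one_pd hM hu) le_rfl hx
  have dp : DifferentiableAt ℝ (fun y : Coord 2 => y 0) x := by fun_prop
  have dT : DifferentiableAt ℝ (fun y : Coord 2 => T (y 0)) x :=
    (hT' (x 0)).differentiableAt.comp x dp
  have e : Set.EqOn (fun y => pd 0 (conformalFactor g) y
      - (shift g 0 y * pd 1 (conformalFactor g) y + shift g 1 y * pd 2 (conformalFactor g) y))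
      (fun y => conformalFactor g y * (pd 1 (shift g 0) y + pd 2 (shift g 1) y)
      - (lapse g y * conformalFactor g y) * T (y 0)) M := fun y hy => by
    have := e0_conformalFactor hM hg hf hT hy
    simpa [e0, Fin.sum_univ_two] using this
  have h := pd_congr_of_eqOn hM e hx (α := l)
  rw [pd_sub (f := pd 0 (conformalFactor g)) (g := fun y => shift g 0 y *
      pd 1 (conformalFactor g) y + shift g 1 y * pd 2 (conformalFactor g) y) (d' _ ha)
      (((d hb).mul (d' _ ha)).add ((d hc).mul (d' _ ha))),
    pd_add (f := fun y => shift g 0 y * pd 1 (conformalFactor g) y) (g := fun y =>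
      shift g 1 y * pd 2 (conformalFactor g) y) ((d hb).mul (d' _ ha)) ((d hc).mul (d' _ ha)),
    pd_mul (d hb) (d' _ ha), pd_mul (d hc) (d' _ ha),
    pd_sub (f := fun y => conformalFactor g y * (pd 1 (shift g 0) y + pd 2 (shift g 1) y))
      (g := fun y => (lapse g y * conformalFactor g y) * T (y 0))
      ((d ha).mul ((d' _ hb).add (d' _ hc))) (((d hN).mul (d ha)).mul dT),
    pd_mul (g := fun y => pd 1 (shift g 0) y + pd 2 (shift g 1) y) (d ha)
      ((d' _ hb).add (d' _ hc)), pd_add (d' _ hb) (d' _ hc),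
    pd_mul (f := fun y => lapse g y * conformalFactor g y) ((d hN).mul (d ha)) dT,
    pd_mul (d hN) (d ha), pd_comp (f := fun y : Coord 2 => y 0) (hT' (x 0)).differentiableAt dp,
    (hT' (x 0)).deriv, pd_apply] at h
  have e2 : (if (0 : Fin (2 + 1)) = l then (1 : ℝ) else 0) * 1 = if l = 0 then 1 else 0 := by
    simp [eq_comm]
  -- `T` depends on `x⁰` alone, so `T'` contributes only to the time derivative.
  have e3 : T' * (if (0 : Fin (2 + 1)) = l then (1 : ℝ) else 0) = if l = 0 then T' else 0 := by
    by_cases hl : l = 0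
    · simp [hl]
    · simp [hl, Ne.symm hl]
  rw [e3] at h
  linarith

/-- The momentum constraint, the lapse equation and the Hamiltonian constraint in the gauge of
constant mean curvature and conformally flat slices. -/
theorem frameRicci_eqs (hM : IsOpen M) (hg : IsLorentzianMetric M g)
    (hf : IsSpatiallyConformallyFlat M g) {T : ℝ → ℝ} (hT : HasSliceMeanCurvature M g T) {T' : ℝ}
    (hT' : ∀ t, HasDerivAt T T' t) (hx : x ∈ M) {N a : ℝ} {n b c s : Fin 3 → ℝ}
    (hN : lapse g x = N) (ha : conformalFactor g x = a) (hn : ∀ i, pd i (lapse g) x = n i)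
    (hb : ∀ i, pd i (shift g 0) x = b i) (hc : ∀ i, pd i (shift g 1) x = c i)
    (hs : ∀ i, pd i (conformalFactor g) x = s i) :
    frameRicci g x 0 1 = -spatialLaplacian (shift g 0) x / 2
        - ((s 1 / a - n 1 / N) * (b 1 - c 2) + (s 2 / a - n 2 / N) * (b 2 + c 1)) / 2 ∧
    frameRicci g x 0 2 = -spatialLaplacian (shift g 1) x / 2
        - ((s 1 / a - n 1 / N) * (b 2 + c 1) - (s 2 / a - n 2 / N) * (b 1 - c 2)) / 2 ∧
    frameRicci g x 0 0 = N * T' + N / a * spatialLaplacian (lapse g) x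
        - ((b 1 - c 2) ^ 2 + (b 2 + c 1) ^ 2) / 2 - N ^ 2 * T (x 0) ^ 2 / 2 ∧
    frameRicci g x 1 1 + frameRicci g x 2 2 = - spatialLaplacian (conformalFactor g) x / a
        + (s 1 ^ 2 + s 2 ^ 2) / a ^ 2 + a * T (x 0) ^ 2
        - a * T' / N - spatialLaplacian (lapse g) x / N := by
  obtain ⟨cN, cβ, ca⟩ := contDiffOn_lapse_shift hM hg hf
  have hN0 : N ≠ 0 := hN ▸ (lapse_pos hg hf hx).ne'
  have ha0 : a ≠ 0 := ha ▸ (conformalFactor_pos hg hf hx).ne'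
  obtain ⟨j1, j2⟩ := metricJet_adm hM cN (cβ 0) (cβ 1) ca (fun y hy => metric_eq hg hf hy) hx
  have hR := frameRicci_eq_ricciJet hM hg hf hx
  rw [j1, j2, frameJet₁_adm, frameJet₂_adm, hN, ha] at hR
  have hgauge := e0_conformalFactor hM hg hf hT hx
  have hd := pd_e0_conformalFactor hM hg hf hT hT' hx
  set E := shiftFrame (shift g 0 x) (shift g 1 x) with hE
  have lap : ∀ u : Coord 2 → ℝ, spatialLaplacian u x
      = frameHess E (fun l m => pd l (pd m u) x) 1 1
        + frameHess E (fun l m => pd l (pd m u) x) 2 2 := by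
    intro u
    simp [spatialLaplacian, frameHess, hE, shiftFrame, Fin.sum_univ_three]
  have grad1 : ∀ u : Coord 2 → ℝ, frameGrad E (fun l => pd l u x) 1 = pd 1 u x := by
    intro u
    simp [frameGrad, hE, shiftFrame, Fin.sum_univ_three]
  have grad2 : ∀ u : Coord 2 → ℝ, frameGrad E (fun l => pd l u x) 2 = pd 2 u x := by
    intro u
    simp [frameGrad, hE, shiftFrame, Fin.sum_univ_three]
  have symm : ∀ u : Coord 2 → ℝ, ContDiffOn ℝ 2 u M → ∀ A A',
      frameHess E (fun l m => pd l (pd m u) x) A A'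
        = frameHess E (fun l m => pd l (pd m u) x) A' A := by
    intro u hu A A'
    simp only [frameHess]
    rw [Finset.sum_comm]
    refine Finset.sum_congr rfl fun l _ => Finset.sum_congr rfl fun m _ => ?_
    rw [pd_comm hM hu hx (α := m) (β := l)]
    ring
  have hs0 : frameGrad E (fun l => pd l (conformalFactor g) x) 0
      = a * (frameGrad E (fun l => pd l (shift g 0) x) 1
        + frameGrad E (fun l => pd l (shift g 1) x) 2) - N * a * T (x 0) := by
    rw [grad1, grad2, ← hN, ← ha, ← hgauge]
    simp [frameGrad, hE, shiftFrame, Fin.sum_univ_three, e0]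
    ring
  -- The derivative of the transport equation, contracted with row `A` of the frame frozen at `x`.
  -- Moving the derivatives of the shift to the right leaves the pure second derivatives of the
  -- conformal factor on the left.
  have hss : ∀ A, frameHess E (fun l m => pd l (pd m (conformalFactor g)) x) A 0
      = frameGrad E (fun l => pd l (shift g 0) x) A
          * frameGrad E (fun l => pd l (conformalFactor g) x) 1
        + frameGrad E (fun l => pd l (shift g 1) x) A
          * frameGrad E (fun l => pd l (conformalFactor g) x) 2
        + frameGrad E (fun l => pd l (conformalFactor g) x) A
          * (frameGrad E (fun l => pd l (shift g 0) x) 1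
            + frameGrad E (fun l => pd l (shift g 1) x) 2)
        + a * (frameHess E (fun l m => pd l (pd m (shift g 0)) x) A 1
          + frameHess E (fun l m => pd l (pd m (shift g 1)) x) A 2)
        - (frameGrad E (fun l => pd l (lapse g) x) A * a
          + N * frameGrad E (fun l => pd l (conformalFactor g) x) A) * T (x 0)
        - N * a * (if A = 0 then T' else 0) := by
    intro A
    have h1 : frameHess E (fun l m => pd l (pd m (conformalFactor g)) x) A 0
        = ∑ l, E A l * (pd l (pd 0 (conformalFactor g)) x
          - shift g 0 x * pd l (pd 1 (conformalFactor g)) x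
          - shift g 1 x * pd l (pd 2 (conformalFactor g)) x) := by
      refine Finset.sum_congr rfl fun l _ => ?_
      simp [hE, shiftFrame, Fin.sum_univ_three]
      ring
    have h2 : ∀ (u : Coord 2 → ℝ), frameHess E (fun l m => pd l (pd m u) x) A 1
        = ∑ l, E A l * pd l (pd 1 u) x := by
      intro u
      refine Finset.sum_congr rfl fun l _ => ?_
      simp [hE, shiftFrame, Fin.sum_univ_three]
    have h3 : ∀ (u : Coord 2 → ℝ), frameHess E (fun l m => pd l (pd m u) x) A 2
        = ∑ l, E A l * pd l (pd 2 u) x := by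
      intro u
      refine Finset.sum_congr rfl fun l _ => ?_
      simp [hE, shiftFrame, Fin.sum_univ_three]
    -- Among the frame vectors only `e₀` has a `∂₀` component, and that component is `1`.
    have h4 : (if A = 0 then T' else 0) = ∑ l, E A l * (if l = 0 then T' else 0) := by
      fin_cases A <;> simp [hE, shiftFrame]
    rw [h1, h2, h3, h4, grad1, grad2, grad1, grad2, ← hN, ← ha]
    simp only [hd, frameGrad, Fin.sum_univ_three]
    ring
  simp only [← hn, ← hb, ← hc, ← hs, lap]
  simp only [← grad1, ← grad2]
  refine ⟨?_, ?_, ?_, ?_⟩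
  · rw [hR]
    exact ricciJet_adm_zero_one hN0 ha0 (symm _ (cβ 1) _ _) (symm _ cN _ _) hs0
      ((hss 1).trans (by simp))
  · rw [hR]
    exact ricciJet_adm_zero_two hN0 ha0 (symm _ (cβ 0) _ _) (symm _ cN _ _) hs0
      ((hss 2).trans (by simp))
  · rw [hR]
    exact ricciJet_adm_zero_zero hN0 ha0 (symm _ (cβ 0) _ _) (symm _ (cβ 1) _ _) hs0
      ((hss 0).trans (by simp))
  · rw [hR, hR]
    exact ricciJet_adm_trace hN0 ha0 (symm _ (cβ 0) _ _) (symm _ (cβ 1) _ _) hs0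
      ((hss 0).trans (by simp))

end RicciEquations

/-! ### Elliptic estimates for the metric components -/

section Domination

variable {n : ℕ} {M : Set (Coord n)} {f g h : ℕ → Coord n → ℝ} {f₀ : Coord n → ℝ}

/-- `|f k| ≤ C h k` on each compact subset of `M`, with `C` independent of `k`. -/
def Dominated (M : Set (Coord n)) (f h : ℕ → Coord n → ℝ) : Prop :=
  ∀ K ⊆ M, IsCompact K → ∃ C : ℝ, 0 ≤ C ∧ ∀ k, ∀ x ∈ K, |f k x| ≤ C * h k x

theorem Dominated.of_le (H : ∀ k, ∀ x ∈ M, |f k x| ≤ h k x) : Dominated M f h :=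
  fun K hK _ => ⟨1, zero_le_one, fun k x hx => by simpa using H k x (hK hx)⟩

theorem Dominated.congr (hf : Dominated M f h) (H : ∀ k, Set.EqOn (g k) (f k) M) :
    Dominated M g h := by
  intro K hK hc
  obtain ⟨C, hC0, hC⟩ := hf K hK hc
  exact ⟨C, hC0, fun k x hx => by rw [H k (hK hx)]; exact hC k x hx⟩

theorem Dominated.add (hf : Dominated M f h) (hg : Dominated M g h) :
    Dominated M (fun k x => f k x + g k x) h := by
  intro K hK hc
  obtain ⟨C, hC0, hC⟩ := hf K hK hc
  obtain ⟨D, hD0, hD⟩ := hg K hK hc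
  refine ⟨C + D, add_nonneg hC0 hD0, fun k x hx => (abs_add_le _ _).trans ?_⟩
  rw [add_mul]
  exact add_le_add (hC k x hx) (hD k x hx)

theorem Dominated.mul (hM : IsOpen M) (hf : ConvC0 M f f₀) (hg : Dominated M g h) :
    Dominated M (fun k x => f k x * g k x) h := by
  intro K hK hc
  obtain ⟨C, hC0, hC⟩ := hf.exists_bound hM hK hc
  obtain ⟨D, hD0, hD⟩ := hg K hK hc
  refine ⟨C * D, mul_nonneg hC0 hD0, fun k x hx => ?_⟩
  rw [abs_mul, mul_assoc]
  exact mul_le_mul (hC k x hx) (hD k x hx) (abs_nonneg _) hC0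

theorem Dominated.const_mul (c : ℝ) (hg : Dominated M g h) :
    Dominated M (fun k x => c * g k x) h := by
  intro K hK hc
  obtain ⟨D, hD0, hD⟩ := hg K hK hc
  refine ⟨|c| * D, by positivity, fun k x hx => ?_⟩
  rw [abs_mul, mul_assoc]
  exact mul_le_mul_of_nonneg_left (hD k x hx) (abs_nonneg c)

theorem Dominated.neg (hf : Dominated M f h) : Dominated M (fun k x => - f k x) h := by
  simpa using hf.const_mul (-1)

theorem Dominated.sub (hf : Dominated M f h) (hg : Dominated M g h) :
    Dominated M (fun k x => f k x - g k x) h := by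
  simpa [sub_eq_add_neg] using hf.add hg.neg

theorem Dominated.sum {ι : Type*} (s : Finset ι) {F : ι → ℕ → Coord n → ℝ}
    (hF : ∀ i, Dominated M (F i) h) : Dominated M (fun k x => ∑ i ∈ s, F i k x) h := by
  intro K hK hc
  choose C hC0 hC using fun i => hF i K hK hc
  refine ⟨∑ i ∈ s, C i, Finset.sum_nonneg fun i _ => hC0 i, fun k x hx => ?_⟩
  rw [Finset.sum_mul]
  exact (Finset.abs_sum_le_sum_abs _ _).trans (Finset.sum_le_sum fun i _ => hC i k x hx)

/-- By `2|fg| ≤ f² + g²`, a majorant of the squared gradients also dominates every quadratic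
expression in the gradients. -/
theorem Dominated.mul_of_sq (hf : Dominated M (fun k x => f k x ^ 2) h)
    (hg : Dominated M (fun k x => g k x ^ 2) h) :
    Dominated M (fun k x => f k x * g k x) h := by
  intro K hK hc
  obtain ⟨C, hC0, hC⟩ := hf.add hg K hK hc
  refine ⟨C, hC0, fun k x hx => le_trans ?_ (hC k x hx)⟩
  rw [abs_of_nonneg (by positivity : 0 ≤ f k x ^ 2 + g k x ^ 2), abs_le]
  constructor <;> nlinarith [sq_nonneg (f k x + g k x), sq_nonneg (f k x - g k x),
    sq_nonneg (f k x), sq_nonneg (g k x)]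

theorem Dominated.sq_add (hf : Dominated M (fun k x => f k x ^ 2) h)
    (hg : Dominated M (fun k x => g k x ^ 2) h) :
    Dominated M (fun k x => (f k x + g k x) ^ 2) h :=
  ((hf.add hg).add ((hf.mul_of_sq hg).const_mul 2)).congr fun k x _ => by ring

theorem Dominated.sq_sub (hf : Dominated M (fun k x => f k x ^ 2) h)
    (hg : Dominated M (fun k x => g k x ^ 2) h) :
    Dominated M (fun k x => (f k x - g k x) ^ 2) h :=
  ((hf.add hg).add ((hf.mul_of_sq hg).const_mul (-2))).congr fun k x _ => by ring

theorem Dominated.sq_mul (hM : IsOpen M) (hf : ConvC0 M f f₀)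
    (hg : Dominated M (fun k x => g k x ^ 2) h) :
    Dominated M (fun k x => (f k x * g k x) ^ 2) h :=
  ((hg.mul hM hf).mul hM hf).congr fun k x _ => by ring

end Domination

/-! ### Laplacian bounds for lapse, shift and conformal factor -/

section Estimates

variable {M : Set (Coord 2)} {gs : ℕ → TensorField 2} {g : TensorField 2}

theorem contDiffOn_christoffel_of_flat (hM : IsOpen M) (hg : IsLorentzianMetric M g)
    (hf : IsSpatiallyConformallyFlat M g) (l μ ν : Fin 3) :
    ContDiffOn ℝ 1 (christoffel g l μ ν) M :=
  contDiffOn_christoffel hM hg.contDiffOn (contDiffOn_invMetric hM hg hf) l μ ν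

theorem continuousOn_ricci (hM : IsOpen M) (hg : IsLorentzianMetric M g)
    (hf : IsSpatiallyConformallyFlat M g) (μ ν : Fin 3) : ContinuousOn (ricci g μ ν) M := by
  have h := contDiffOn_christoffel_of_flat hM hg hf
  exact (((continuousOn_finsetSum _ fun l _ => continuousOn_pd hM (h l μ ν)).sub
    (continuousOn_finsetSum _ fun l _ => continuousOn_pd hM (h l μ l))).add
    (continuousOn_finsetSum _ fun l _ => continuousOn_finsetSum _ fun s _ =>
      (h l l s).continuousOn.mul (h s μ ν).continuousOn)).sub
    (continuousOn_finsetSum _ fun l _ => continuousOn_finsetSum _ fun s _ =>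
      (h l ν s).continuousOn.mul (h s μ l).continuousOn)

/-- The lapse, the shift and the conformal factor. -/
def gaugeFunction (g : TensorField 2) : Fin 4 → Coord 2 → ℝ :=
  ![lapse g, shift g 0, shift g 1, conformalFactor g]

/-- The four Ricci identities are solved for the four Laplacians. All coefficients (`N`, `a`, their
inverses, the shift, `T`) converge in `C⁰_loc` and hence are bounded on compact sets. What remains
is dominated by squared spatial gradients plus `1 + |Ric|`, the form required by
`convLap_of_quadratic_system`. -/
theorem convLap_gaugeFunction (hM : IsOpen M) (hgs : ∀ k, IsLorentzianMetric M (gs k))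
    (hg : IsLorentzianMetric M g) (hgs_flat : ∀ k, IsSpatiallyConformallyFlat M (gs k))
    (hg_flat : IsSpatiallyConformallyFlat M g) {T : ℝ → ℝ} {T' : ℝ}
    (hT' : ∀ t, HasDerivAt T T' t) (hgs_cmc : ∀ k, HasSliceMeanCurvature M (gs k) T)
    (h : ∀ α β, ConvW12 M (fun k x => gs k x α β) (fun x => g x α β))
    (hric : ∀ α β, BddIntegrals M (fun k x => ricci (gs k) α β x ^ 2)) (c : Fin 4) :
    ConvLap M (fun k => gaugeFunction (gs k) c) (gaugeFunction g c) := by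
  obtain ⟨wN, wβ, wa⟩ := convW12_lapse_shift hM hgs hg hgs_flat hg_flat h
  have hu : ∀ c, ConvW12 M (fun k => gaugeFunction (gs k) c) (gaugeFunction g c) := by
    intro c
    fin_cases c
    exacts [wN, wβ 0, wβ 1, wa]
  have hRc := fun k (p : Fin 3 × Fin 3) => continuousOn_ricci hM (hgs k) (hgs_flat k) p.1 p.2
  -- The summand `1` takes care of the terms with `T` and `T'`, which contain neither gradients nor
  -- curvature.
  set F : ℕ → Coord 2 → ℝ := fun k x => 1 + ∑ p : Fin 3 × Fin 3, |ricci (gs k) p.1 p.2 x| with hF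
  have hFc : ∀ k, ContinuousOn (F k) M := fun k =>
    continuousOn_const.add (continuousOn_finsetSum _ fun p _ => (hRc k p).abs)
  have hF2 : BddIntegrals M (fun k x => F k x ^ 2) := by
    have c2 : ∀ (p : Fin 3 × Fin 3) k, ContinuousOn (fun x => ricci (gs k) p.1 p.2 x ^ 2) M :=
      fun p k => (hRc k p).pow 2
    refine ((BddIntegrals.const 1).add (BddIntegrals.sum Finset.univ
      (fun p : Fin 3 × Fin 3 => hric p.1 p.2) c2) (fun _ => continuousOn_const)
      fun k => continuousOn_finsetSum _ fun p _ => c2 p k).of_le (fun k => (hFc k).pow 2)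
      (fun k => continuousOn_const.add (continuousOn_finsetSum _ fun p _ => c2 p k))
      -- `18 = 2 · 9`, from `(1 + S)² ≤ 2 + 2S²` and Cauchy–Schwarz over the nine components.
      fun K hK hc => ⟨18, by norm_num, fun k x hx => ?_⟩
    have h1 := sq_sum_le_card_mul_sum_sq (s := (Finset.univ : Finset (Fin 3 × Fin 3)))
      (f := fun p => |ricci (gs k) p.1 p.2 x|)
    simp only [sq_abs, Finset.card_univ, Fintype.card_prod, Fintype.card_fin] at h1
    push_cast at h1
    simp only [hF]
    nlinarith [sq_nonneg (1 - ∑ p : Fin 3 × Fin 3, |ricci (gs k) p.1 p.2 x|)]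
  refine convLap_of_quadratic_system (F := F) hM hu hF2 hFc ?_ c
  set H : ℕ → Coord 2 → ℝ := fun k x => ∑ p : Fin 4 × Fin 2,
    pd p.2.succ (gaugeFunction (gs k) p.1) x ^ 2 + F k x with hH
  have hF1 : ∀ k x, 1 ≤ F k x := fun k x => by
    have : 0 ≤ ∑ p : Fin 3 × Fin 3, |ricci (gs k) p.1 p.2 x| :=
      Finset.sum_nonneg fun _ _ => abs_nonneg _
    linarith
  have hS0 : ∀ k x, 0 ≤ ∑ p : Fin 4 × Fin 2, pd p.2.succ (gaugeFunction (gs k) p.1) x ^ 2 :=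
    fun k x => Finset.sum_nonneg fun _ _ => sq_nonneg _
  have d1 : Dominated M (fun _ _ => 1) H := .of_le fun k x _ => by
    simpa using (hF1 k x).trans (le_add_of_nonneg_left (hS0 k x))
  have dR : ∀ μ ν, Dominated M (fun k => ricci (gs k) μ ν) H := fun μ ν => .of_le fun k x _ => by
    have h1 := Finset.single_le_sum (f := fun p : Fin 3 × Fin 3 => |ricci (gs k) p.1 p.2 x|)
      (fun _ _ => abs_nonneg _) (Finset.mem_univ (μ, ν))
    have := hS0 k x
    simp only [hH, hF]
    linarith
  have dG : ∀ (v : Fin 4) (i : Fin 2),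
      Dominated M (fun k x => pd i.succ (gaugeFunction (gs k) v) x ^ 2) H := fun v i =>
    .of_le fun k x _ => by
      have h1 := Finset.single_le_sum (f := fun p : Fin 4 × Fin 2 =>
        pd p.2.succ (gaugeFunction (gs k) p.1) x ^ 2)
        (fun _ _ => sq_nonneg _) (Finset.mem_univ (v, i))
      have := hF1 k x
      rw [abs_of_nonneg (sq_nonneg _)]
      simp only [hH]
      linarith
  have pN := fun k x (hx : x ∈ M) => (lapse_pos (hgs k) (hgs_flat k) hx).ne'
  have pa := fun k x (hx : x ∈ M) => (conformalFactor_pos (hgs k) (hgs_flat k) hx).ne'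
  have cN := wN.convC0
  have ca := wa.convC0
  have cNi := (wN.inv hM pN fun x hx => (lapse_pos hg hg_flat hx).ne').convC0
  have cai := (wa.inv hM pa fun x hx => (conformalFactor_pos hg hg_flat hx).ne').convC0
  have cT : ConvC0 M (fun (_ : ℕ) (x : Coord 2) => T (x 0)) (fun x => T (x 0)) := by
    refine .const ?_ hM
    have : Continuous T := continuous_iff_continuousAt.2 fun t => (hT' t).continuousAt
    exact (this.comp (continuous_apply 0)).continuousOn
  have dE : ∀ B C, Dominated M (fun k x => frameRicci (gs k) x B C) H := by
    intro B C
    have cE : ∀ B μ, ∃ e₀, ConvC0 M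
        (fun k x => shiftFrame (shift (gs k) 0 x) (shift (gs k) 1 x) B μ)
        e₀ := by
      intro B μ
      have one := ConvC0.const (f₀ := fun _ : Coord 2 => (1 : ℝ)) continuousOn_const hM
      have zero := ConvC0.const (f₀ := fun _ : Coord 2 => (0 : ℝ)) continuousOn_const hM
      have nb := ((wβ 0).neg hM).convC0
      have nc := ((wβ 1).neg hM).convC0
      fin_cases B <;> fin_cases μ
      exacts [⟨_, one⟩, ⟨_, nb⟩, ⟨_, nc⟩, ⟨_, zero⟩, ⟨_, one⟩, ⟨_, zero⟩, ⟨_, zero⟩, ⟨_, zero⟩,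
        ⟨_, one⟩]
    refine Dominated.sum _ fun μ => Dominated.sum _ fun ν => ?_
    obtain ⟨e₁, h1⟩ := cE B μ
    obtain ⟨e₂, h2⟩ := cE C ν
    exact (dR μ ν).mul hM (h1.mul h2)
  have E := fun k x (hx : x ∈ M) => frameRicci_eqs hM (hgs k) (hgs_flat k) (hgs_cmc k) hT' hx
    rfl rfl (fun _ => rfl) (fun _ => rfl) (fun _ => rfl) (fun _ => rfl)
  have n1 : Dominated M (fun k x => pd 1 (lapse (gs k)) x ^ 2) H := dG 0 0
  have n2 : Dominated M (fun k x => pd 2 (lapse (gs k)) x ^ 2) H := dG 0 1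
  have b1 : Dominated M (fun k x => pd 1 (shift (gs k) 0) x ^ 2) H := dG 1 0
  have b2 : Dominated M (fun k x => pd 2 (shift (gs k) 0) x ^ 2) H := dG 1 1
  have c1 : Dominated M (fun k x => pd 1 (shift (gs k) 1) x ^ 2) H := dG 2 0
  have c2 : Dominated M (fun k x => pd 2 (shift (gs k) 1) x ^ 2) H := dG 2 1
  have s1 : Dominated M (fun k x => pd 1 (conformalFactor (gs k)) x ^ 2) H := dG 3 0
  have s2 : Dominated M (fun k x => pd 2 (conformalFactor (gs k)) x ^ 2) H := dG 3 1
  have q1 := (s1.sq_mul hM cai).sq_sub (n1.sq_mul hM cNi)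
  have q2 := (s2.sq_mul hM cai).sq_sub (n2.sq_mul hM cNi)
  have lb : Dominated M (fun k => spatialLaplacian (shift (gs k) 0)) H := by
    refine (((dE 0 1).const_mul (-2)).add (((q1.mul_of_sq (b1.sq_sub c2)).add
      (q2.mul_of_sq (b2.sq_add c1))).const_mul (-1))).congr fun k x hx => ?_
    obtain ⟨h1, -, -, -⟩ := E k x hx
    simp only [h1]
    ring
  have lc : Dominated M (fun k => spatialLaplacian (shift (gs k) 1)) H := by
    refine (((dE 0 2).const_mul (-2)).add (((q1.mul_of_sq (b2.sq_add c1)).sub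
      (q2.mul_of_sq (b1.sq_sub c2))).const_mul (-1))).congr fun k x hx => ?_
    obtain ⟨-, h1, -, -⟩ := E k x hx
    simp only [h1]
    ring
  have lN : Dominated M (fun k => spatialLaplacian (lapse (gs k))) H := by
    refine (((((dE 0 0).sub ((d1.const_mul T').mul hM cN)).add
      (((b1.sq_sub c2).add (b2.sq_add c1)).const_mul (1 / 2))).add
      ((d1.mul hM ((cN.mul cN).mul (cT.mul cT))).const_mul (1 / 2))).mul hM
        (ca.mul cNi)).congr fun k x hx => ?_
    obtain ⟨-, -, h1, -⟩ := E k x hx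
    have := pN k x hx
    have := pa k x hx
    simp only [h1]
    field_simp
    ring
  -- The trace identity contains the Laplacian of the lapse, so the bound `lN` has to come first.
  have la : Dominated M (fun k => spatialLaplacian (conformalFactor (gs k))) H := by
    refine (((((((dE 1 1).add (dE 2 2)).const_mul (-1)).add ((s1.add s2).mul hM
      (cai.mul cai))).add (d1.mul hM (ca.mul (cT.mul cT)))).sub
      (((d1.const_mul T').mul hM (ca.mul cNi)).add (lN.mul hM cNi))).mul hM ca).congr
        fun k x hx => ?_
    obtain ⟨-, -, -, h1⟩ := E k x hx
    have := pN k x hx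
    have := pa k x hx
    simp only [h1]
    field_simp
    ring
  intro K hK hc
  have hl : ∀ v, Dominated M (fun k => spatialLaplacian (gaugeFunction (gs k) v)) H := by
    intro v
    fin_cases v
    exacts [lN, lb, lc, la]
  choose C hC0 hC using fun v => hl v K hK hc
  refine ⟨∑ v, C v, Finset.sum_nonneg fun v _ => hC0 v, fun v k x hx => (hC v k x hx).trans ?_⟩
  exact mul_le_mul_of_nonneg_right (Finset.single_le_sum (fun v _ => hC0 v) (Finset.mem_univ v))
    (add_nonneg (hS0 k x) (zero_le_one.trans (hF1 k x)))

end Estimates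

/-! ### Strong convergence of first derivatives -/

section StrongConvergence

theorem StrongL4.tendstoInLpLoc {n : ℕ} {M : Set (Coord n)} {f : ℕ → Coord n → ℝ}
    {f₀ : Coord n → ℝ} (h : StrongL4 M f f₀) : TendstoInLpLoc M 4 f f₀ := by
  intro K hK hc
  refine ⟨fun k => memLp_of_continuousOn hc ((h.cont k).mono hK) _,
    memLp_of_continuousOn hc (h.contLim.mono hK) _, ?_⟩
  have e : ∀ k, eLpNorm (f k - f₀) 4 (volume.restrict K)
      = ENNReal.ofReal ((∫ x in K, (f k x - f₀ x) ^ 4) ^ (((4 : ℕ) : ℝ)⁻¹)) := fun k =>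
    eLpNorm_eq_integral_pow (u := f k - f₀) hc (((h.cont k).sub h.contLim).mono hK)
      (p := 4) (by decide) (by norm_num)
  simp only [e]
  have h1 := ((Real.continuousAt_rpow_const (0 : ℝ) ((4 : ℕ) : ℝ)⁻¹
    (Or.inr (by norm_num))).tendsto.comp (h.tendsto K hK hc))
  have h2 := (ENNReal.continuous_ofReal.tendsto _).comp h1
  rwa [Real.zero_rpow (by norm_num), ENNReal.ofReal_zero] at h2

variable {M : Set (Coord 2)} {gs : ℕ → TensorField 2} {g : TensorField 2}

theorem ConvLap.admInverse {N b c a : ℕ → Coord 2 → ℝ} {N₀ b₀ c₀ a₀ : Coord 2 → ℝ}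
    (hM : IsOpen M) (hN : ConvLap M N N₀) (hb : ConvLap M b b₀) (hc : ConvLap M c c₀)
    (ha : ConvLap M a a₀) (hNs : ∀ k, ∀ x ∈ M, N k x ≠ 0) (hN0 : ∀ x ∈ M, N₀ x ≠ 0)
    (has : ∀ k, ∀ x ∈ M, a k x ≠ 0) (ha0 : ∀ x ∈ M, a₀ x ≠ 0) (α β : Fin 3) :
    ConvLap M (fun k x => admInverse (N k x) (b k x) (c k x) (a k x) α β)
      (fun x => EllipticGauge.admInverse (N₀ x) (b₀ x) (c₀ x) (a₀ x) α β) := by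
  have hNi := (hN.inv hM hNs hN0).mul hM (hN.inv hM hNs hN0)
  have hai := ha.inv hM has ha0
  fin_cases α <;> fin_cases β
  · exact hNi.neg hM
  · exact hb.mul hM hNi
  · exact hc.mul hM hNi
  · exact hb.mul hM hNi
  · exact hai.add hM (((hb.mul hM hb).mul hM hNi).neg hM)
  · exact ((hb.mul hM hc).mul hM hNi).neg hM
  · exact hc.mul hM hNi
  · exact ((hb.mul hM hc).mul hM hNi).neg hM
  · exact hai.add hM (((hc.mul hM hc).mul hM hNi).neg hM)

theorem convLap_invMetric (hM : IsOpen M) (hgs : ∀ k, IsLorentzianMetric M (gs k))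
    (hg : IsLorentzianMetric M g) (hgs_flat : ∀ k, IsSpatiallyConformallyFlat M (gs k))
    (hg_flat : IsSpatiallyConformallyFlat M g)
    (h : ∀ c, ConvLap M (fun k => gaugeFunction (gs k) c) (gaugeFunction g c)) (α β : Fin 3) :
    ConvLap M (fun k => invMetric (gs k) α β) (invMetric g α β) :=
  (ConvLap.admInverse hM (h 0) (h 1) (h 2) (h 3)
    (fun k _ hx => (lapse_pos (hgs k) (hgs_flat k) hx).ne')
    (fun _ hx => (lapse_pos hg hg_flat hx).ne')
    (fun k _ hx => (conformalFactor_pos (hgs k) (hgs_flat k) hx).ne')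
    (fun _ hx => (conformalFactor_pos hg hg_flat hx).ne') α β).congr hM
    (fun k _ hx => invMetric_eq (hgs k) (hgs_flat k) hx α β)
    fun _ hx => invMetric_eq hg hg_flat hx α β

theorem convLap_metric (hM : IsOpen M) (hgs : ∀ k, IsLorentzianMetric M (gs k))
    (hg : IsLorentzianMetric M g) (hgs_flat : ∀ k, IsSpatiallyConformallyFlat M (gs k))
    (hg_flat : IsSpatiallyConformallyFlat M g)
    (h : ∀ c, ConvLap M (fun k => gaugeFunction (gs k) c) (gaugeFunction g c)) (α β : Fin 3) :
    ConvLap M (fun k x => gs k x α β) (fun x => g x α β) := by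
  have hN : ConvLap M (fun k => lapse (gs k)) (lapse g) := h 0
  have hb : ConvLap M (fun k => shift (gs k) 0) (shift g 0) := h 1
  have hc : ConvLap M (fun k => shift (gs k) 1) (shift g 1) := h 2
  have ha : ConvLap M (fun k => conformalFactor (gs k)) (conformalFactor g) := h 3
  have zero : ConvLap M (fun _ _ => 0) (fun _ => 0) := ConvLap.const contDiffOn_const hM
  have key : ConvLap M (fun k x => admMatrix (lapse (gs k) x) (shift (gs k) 0 x)
      (shift (gs k) 1 x) (conformalFactor (gs k) x) α β) (fun x => admMatrix (lapse g x)
        (shift g 0 x) (shift g 1 x) (conformalFactor g x) α β) := by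
    fin_cases α <;> fin_cases β
    · refine (((hN.mul hM hN).neg hM).add hM (ha.mul hM ((hb.mul hM hb).add hM
        (hc.mul hM hc)))).congr hM (fun k x _ => ?_) fun x _ => ?_ <;> simp [admMatrix, sq]
    · exact ha.mul hM hb
    · exact ha.mul hM hc
    · exact ha.mul hM hb
    · exact ha
    · exact zero
    · exact ha.mul hM hc
    · exact zero
    · exact ha
  exact key.congr hM
    (fun k x hx => congrFun (congrFun (metric_eq (hgs k) (hgs_flat k) hx) α) β)
    fun x hx => congrFun (congrFun (metric_eq hg hg_flat hx) α) β

/-- The elliptic estimates say nothing about derivatives transversal to the slices. The mean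
curvature equation expresses `e₀ a` by the spatial divergence of the shift, which converges
strongly, and by undifferentiated terms. -/
theorem strongL4_e0_conformalFactor (hM : IsOpen M) (hgs : ∀ k, IsLorentzianMetric M (gs k))
    (hg : IsLorentzianMetric M g) (hgs_flat : ∀ k, IsSpatiallyConformallyFlat M (gs k))
    (hg_flat : IsSpatiallyConformallyFlat M g) {T : ℝ → ℝ} (hT : Continuous T)
    (hgs_cmc : ∀ k, HasSliceMeanCurvature M (gs k) T) (hg_cmc : HasSliceMeanCurvature M g T)
    (h : ∀ c, ConvLap M (fun k => gaugeFunction (gs k) c) (gaugeFunction g c)) :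
    StrongL4 M (fun k => e0 (gs k) (conformalFactor (gs k))) (e0 g (conformalFactor g)) := by
  have hN : ConvLap M (fun k => lapse (gs k)) (lapse g) := h 0
  have hb : ConvLap M (fun k => shift (gs k) 0) (shift g 0) := h 1
  have hc : ConvLap M (fun k => shift (gs k) 1) (shift g 1) := h 2
  have ha : ConvLap M (fun k => conformalFactor (gs k)) (conformalFactor g) := h 3
  have cT : ConvC0 M (fun (_ : ℕ) (x : Coord 2) => -T (x 0)) (fun x => -T (x 0)) :=
    .const (hT.comp (continuous_apply 0)).neg.continuousOn hM
  refine ((((hb.strongL4_pd hM 0).add (hc.strongL4_pd hM 1)).mul hM ha.convC0).add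
    (.of_convC0 hM ((hN.convC0.mul ha.convC0).mul cT))).congr (fun k x hx => ?_) fun x hx => ?_
  · rw [e0_conformalFactor hM (hgs k) (hgs_flat k) (hgs_cmc k) hx]
    simp only [Fin.succ_zero_eq_one, Fin.succ_one_eq_two]
    ring
  · rw [e0_conformalFactor hM hg hg_flat hg_cmc hx]
    simp only [Fin.succ_zero_eq_one, Fin.succ_one_eq_two]
    ring

/-- From `∂₀ a = e₀ a + β^i ∂ᵢ a`. These are the only time derivatives of metric components that are
shown to converge strongly. -/
theorem strongL4_pd_zero_conformalFactor
    (h : ∀ c, ConvLap M (fun k => gaugeFunction (gs k) c) (gaugeFunction g c))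
    (hM : IsOpen M)
    (he : StrongL4 M (fun k => e0 (gs k) (conformalFactor (gs k))) (e0 g (conformalFactor g))) :
    StrongL4 M (fun k => pd 0 (conformalFactor (gs k))) (pd 0 (conformalFactor g)) := by
  have hb : ConvLap M (fun k => shift (gs k) 0) (shift g 0) := h 1
  have hc : ConvLap M (fun k => shift (gs k) 1) (shift g 1) := h 2
  have ha : ConvLap M (fun k => conformalFactor (gs k)) (conformalFactor g) := h 3
  refine (he.add (((ha.strongL4_pd hM 0).mul hM hb.convC0).add
    ((ha.strongL4_pd hM 1).mul hM hc.convC0))).congr (fun k x hx => ?_) fun x hx => ?_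
  · simp [e0, Fin.sum_univ_two]
  · simp [e0, Fin.sum_univ_two]

theorem e0_spatialInv (hM : IsOpen M) (hg : IsLorentzianMetric M g)
    (hf : IsSpatiallyConformallyFlat M g) {x : Coord 2} (hx : x ∈ M) (i j : Fin 2) :
    e0 g (spatialInv g i j) x = if i = j then
      (-1) * ((conformalFactor g x)⁻¹ * (conformalFactor g x)⁻¹) * e0 g (conformalFactor g) x
        else 0 := by
  have e : Set.EqOn (spatialInv g i j) (fun y => if i = j then (conformalFactor g y)⁻¹ else 0) M :=
    fun y hy => spatialInv_eq hg hf hy i j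
  simp only [e0, pd_congr_of_eqOn hM e hx]
  split_ifs with hij
  · have hd : ∀ α, pd α (fun y => (conformalFactor g y)⁻¹) x
        = (-1) * ((conformalFactor g x)⁻¹ * (conformalFactor g x)⁻¹)
          * pd α (conformalFactor g) x := by
      intro α
      rw [pd_comp (φ := fun t => t⁻¹)
        (differentiableAt_inv (conformalFactor_pos hg hf hx).ne')
        (differentiableAt_of_contDiffOn hM (contDiffOn_lapse_shift hM hg hf).2.2 (by norm_num) hx)]
      simp [sq]
    simp only [hd, Fin.sum_univ_two]
    ring
  · simp [pd_const]

theorem strongL4_e0_spatialInv (hM : IsOpen M) (hgs : ∀ k, IsLorentzianMetric M (gs k))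
    (hg : IsLorentzianMetric M g) (hgs_flat : ∀ k, IsSpatiallyConformallyFlat M (gs k))
    (hg_flat : IsSpatiallyConformallyFlat M g)
    (h : ∀ c, ConvLap M (fun k => gaugeFunction (gs k) c) (gaugeFunction g c))
    (he : StrongL4 M (fun k => e0 (gs k) (conformalFactor (gs k))) (e0 g (conformalFactor g)))
    (i j : Fin 2) :
    StrongL4 M (fun k => e0 (gs k) (spatialInv (gs k) i j)) (e0 g (spatialInv g i j)) := by
  have ha : ConvLap M (fun k => conformalFactor (gs k)) (conformalFactor g) := h 3
  by_cases hij : i = j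
  · have hi := (ha.inv hM (fun k _ hx => (conformalFactor_pos (hgs k) (hgs_flat k) hx).ne')
      fun _ hx => (conformalFactor_pos hg hg_flat hx).ne').convC0
    have hm : ConvC0 M (fun (_ : ℕ) (_ : Coord 2) => (-1 : ℝ)) (fun _ => -1) :=
      .const continuousOn_const hM
    refine (he.mul hM (hm.mul (hi.mul hi))).congr (fun k x hx => ?_) fun x hx => ?_
    · rw [e0_spatialInv hM (hgs k) (hgs_flat k) hx, if_pos hij]
    · rw [e0_spatialInv hM hg hg_flat hx, if_pos hij]
  · refine (StrongL4.of_convC0 hM (ConvC0.const (f₀ := fun _ => 0) continuousOn_const hM)).congr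
      (fun k x hx => ?_) fun x hx => ?_
    · rw [e0_spatialInv hM (hgs k) (hgs_flat k) hx, if_neg hij]
    · rw [e0_spatialInv hM hg hg_flat hx, if_neg hij]

end StrongConvergence

/-! ### Weak convergence -/

section Weak

variable {n : ℕ} {M : Set (Coord n)} {f g : ℕ → Coord n → ℝ} {f₀ g₀ : Coord n → ℝ}

/-- Cauchy–Schwarz, from the discriminant of the nonnegative polynomial `t ↦ ∫ (u + t v)²`. -/
theorem sq_setIntegral_mul_le {K : Set (Coord n)} (hK : IsCompact K) {u v : Coord n → ℝ}
    (hu : ContinuousOn u K) (hv : ContinuousOn v K) :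
    (∫ x in K, u x * v x) ^ 2 ≤ (∫ x in K, u x ^ 2) * ∫ x in K, v x ^ 2 := by
  have h : ∀ t : ℝ, 0 ≤ (∫ x in K, v x ^ 2) * (t * t) + (2 * ∫ x in K, u x * v x) * t
      + ∫ x in K, u x ^ 2 := by
    intro t
    have e : ∫ x in K, (u x + t * v x) ^ 2 = (∫ x in K, v x ^ 2) * (t * t)
        + (2 * ∫ x in K, u x * v x) * t + ∫ x in K, u x ^ 2 := by
      have i1 : IntegrableOn (fun x => (t * t) * v x ^ 2) K volume :=
        ((hv.pow 2).integrableOn_compact hK).const_mul _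
      have i2 : IntegrableOn (fun x => (2 * t) * (u x * v x)) K :=
        ((hu.mul hv).integrableOn_compact hK).const_mul _
      have i3 : IntegrableOn (fun x => u x ^ 2) K := (hu.pow 2).integrableOn_compact hK
      have e1 : ∀ x, (u x + t * v x) ^ 2
          = (t * t) * v x ^ 2 + (2 * t) * (u x * v x) + u x ^ 2 := fun x => by ring
      simp only [e1]
      have i4 : IntegrableOn (fun x => (t * t) * v x ^ 2 + (2 * t) * (u x * v x)) K := i1.add i2
      rw [integral_add i4 i3, integral_add i1 i2, integral_const_mul, integral_const_mul]
      ring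
    rw [← e]
    exact integral_nonneg fun x => sq_nonneg _
  have := discrim_le_zero h
  rw [discrim] at this
  nlinarith

theorem tendsto_setIntegral_mul_zero {K : Set (Coord n)} (hK : IsCompact K)
    (hf : ∀ k, ContinuousOn (f k) K) (hg : ∀ k, ContinuousOn (g k) K)
    (h : Tendsto (fun k => ∫ x in K, f k x ^ 2) atTop (𝓝 0)) {C : ℝ}
    (hC : ∀ k, ∫ x in K, g k x ^ 2 ≤ C) :
    Tendsto (fun k => ∫ x in K, f k x * g k x) atTop (𝓝 0) := by
  have h1 := (Real.continuous_sqrt.tendsto _).comp (h.mul_const C)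
  rw [zero_mul, Real.sqrt_zero] at h1
  refine squeeze_zero_norm (fun k => ?_) h1
  rw [Real.norm_eq_abs, ← Real.sqrt_sq_eq_abs]
  refine Real.sqrt_le_sqrt ((sq_setIntegral_mul_le hK (hf k) (hg k)).trans ?_)
  exact mul_le_mul_of_nonneg_left (hC k) (integral_nonneg fun x => sq_nonneg _)

/-- Weak convergence in `L²_loc(M)` of continuous functions. -/
structure WeakL2 (M : Set (Coord n)) (f : ℕ → Coord n → ℝ) (f₀ : Coord n → ℝ) : Prop where
  cont : ∀ k, ContinuousOn (f k) M
  contLim : ContinuousOn f₀ M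
  bdd : BddIntegrals M (fun k x => f k x ^ 2)
  tendsto : ∀ ψ : Coord n → ℝ, ContDiff ℝ 1 ψ → HasCompactSupport ψ → tsupport ψ ⊆ M →
    Tendsto (fun k => ∫ x, ψ x * f k x) atTop (𝓝 (∫ x, ψ x * f₀ x))

theorem StrongL4.tendsto_sq (h : StrongL4 M f f₀) {K : Set (Coord n)} (hK : K ⊆ M)
    (hc : IsCompact K) : Tendsto (fun k => ∫ x in K, (f k x - f₀ x) ^ 2) atTop (𝓝 0) := by
  have hd := fun k => ((h.cont k).sub h.contLim).mono hK
  have h4 : Tendsto (fun k => ∫ x in K, ((f k x - f₀ x) ^ 2) ^ 2) atTop (𝓝 0) := by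
    simpa only [← pow_mul] using h.tendsto K hK hc
  simpa using tendsto_setIntegral_mul_zero (f := fun k x => (f k x - f₀ x) ^ 2)
    (g := fun _ _ => 1) hc (fun k => (hd k).pow 2) (fun _ => continuousOn_const) h4
    (C := ∫ x in K, (1 : ℝ) ^ 2) fun _ => le_rfl

theorem StrongL4.weakL2 (h : StrongL4 M f f₀) : WeakL2 M f f₀ := by
  refine ⟨h.cont, h.contLim, fun K hK hc => ?_, fun ψ hψ hψc hψs => ?_⟩
  · have h1 : ∀ᶠ k in atTop, ∫ x in K, (f k x - f₀ x) ^ 2 ≤ 1 :=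
      (h.tendsto_sq hK hc).eventually_le_const one_pos
    have h2 : ∀ k, ∫ x in K, f k x ^ 2
        ≤ 2 * (∫ x in K, (f k x - f₀ x) ^ 2) + 2 * ∫ x in K, f₀ x ^ 2 := by
      intro k
      have i1 : IntegrableOn (fun x => 2 * (f k x - f₀ x) ^ 2) K :=
        (((((h.cont k).sub h.contLim).pow 2).mono hK).integrableOn_compact hc).const_mul 2
      have i2 : IntegrableOn (fun x => 2 * f₀ x ^ 2) K :=
        (((h.contLim.pow 2).mono hK).integrableOn_compact hc).const_mul 2
      rw [← integral_const_mul, ← integral_const_mul, ← integral_add i1 i2]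
      refine setIntegral_mono_on ((((h.cont k).pow 2).mono hK).integrableOn_compact hc)
        (i1.add i2) hc.measurableSet fun x _ => ?_
      nlinarith [sq_nonneg (f k x - 2 * f₀ x)]
    refine exists_bound_of_eventually (C := 2 * 1 + 2 * ∫ x in K, f₀ x ^ 2) ?_
    filter_upwards [h1] with k hk
    linarith [h2 k]
  · have e : ∀ k, ∫ x, ψ x * f k x = (∫ x in tsupport ψ, (f k x - f₀ x) * ψ x)
        + ∫ x, ψ x * f₀ x := by
      intro k
      rw [← setIntegral_tsupport_eq (ζ := ψ) tsupport_mul_subset',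
        ← setIntegral_tsupport_eq (ζ := ψ) (f := fun x => ψ x * f₀ x) tsupport_mul_subset',
        ← integral_add]
      · exact integral_congr_ae (ae_of_all _ fun x => by ring)
      · exact ((((h.cont k).sub h.contLim).mono hψs).mul
          hψ.continuous.continuousOn).integrableOn_compact hψc
      · exact (hψ.continuous.continuousOn.mul (h.contLim.mono hψs)).integrableOn_compact hψc
    simp only [e]
    simpa using (tendsto_setIntegral_mul_zero (g := fun _ => ψ) hψc
      (fun k => ((h.cont k).sub h.contLim).mono hψs) (fun _ => hψ.continuous.continuousOn)
      (h.tendsto_sq hψs hψc) fun _ => le_rfl).add_const (∫ x, ψ x * f₀ x)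

/-- The integrand is split as `(f k - f₀)(ψ g k) + (ψ f₀) g k`. The first part tends to zero by
Cauchy–Schwarz. In the second, `ψ f₀` is itself an admissible test function, which is the reason for
testing with `C¹` functions and for the regularity required of `f₀`. -/
theorem WeakL2.tendsto_mul (hM : IsOpen M) (hf : StrongL4 M f f₀) (hf₀ : ContDiffOn ℝ 1 f₀ M)
    (hg : WeakL2 M g g₀) {ψ : Coord n → ℝ} (hψ : ContDiff ℝ 1 ψ) (hψc : HasCompactSupport ψ)
    (hψs : tsupport ψ ⊆ M) : Tendsto (fun k => ∫ x, ψ x * (f k x * g k x)) atTop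
      (𝓝 (∫ x, ψ x * (f₀ x * g₀ x))) := by
  have e : ∀ k, ∫ x, ψ x * (f k x * g k x)
      = (∫ x in tsupport ψ, (f k x - f₀ x) * (ψ x * g k x)) + ∫ x, (ψ x * f₀ x) * g k x := by
    intro k
    have e1 : ∫ x, (ψ x * f₀ x) * g k x = ∫ x in tsupport ψ, (ψ x * f₀ x) * g k x := by
      simp only [mul_assoc]
      rw [setIntegral_tsupport_eq tsupport_mul_subset']
    rw [← setIntegral_tsupport_eq (ζ := ψ) tsupport_mul_subset', e1, ← integral_add]
    · exact integral_congr_ae (ae_of_all _ fun x => by ring)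
    · exact ((((hf.cont k).sub hf.contLim).mono hψs).mul
        (hψ.continuous.continuousOn.mul ((hg.cont k).mono hψs))).integrableOn_compact hψc
    · exact ((hψ.continuous.continuousOn.mul (hf.contLim.mono hψs)).mul
        ((hg.cont k).mono hψs)).integrableOn_compact hψc
  have h1 := hg.tendsto _ (contDiff_mul_of_tsupport_subset hM hψ hψs hf₀) hψc.mul_right
    (tsupport_mul_subset'.trans hψs)
  obtain ⟨B, hB⟩ := hψc.exists_bound_of_continuousOn hψ.continuous.continuousOn
  obtain ⟨C, hC⟩ := hg.bdd (tsupport ψ) hψs hψc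
  have h2 := tendsto_setIntegral_mul_zero (g := fun k x => ψ x * g k x) hψc
    (fun k => ((hf.cont k).sub hf.contLim).mono hψs)
    (fun k => hψ.continuous.continuousOn.mul ((hg.cont k).mono hψs))
    (hf.tendsto_sq hψs hψc) (C := B ^ 2 * C) fun k => by
      refine le_trans ?_ (mul_le_mul_of_nonneg_left (hC k) (sq_nonneg B))
      rw [← integral_const_mul]
      have c1 := (hg.cont k).mono hψs
      refine setIntegral_mono_on (((hψ.continuous.continuousOn.mul c1).pow 2).integrableOn_compact
        hψc) (((c1.pow 2).integrableOn_compact hψc).const_mul _) hψc.measurableSet fun x hx => ?_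
      rw [mul_pow]
      have := hB x hx
      rw [Real.norm_eq_abs] at this
      exact mul_le_mul_of_nonneg_right (sq_le_sq' (abs_le.1 this).1 (abs_le.1 this).2)
        (sq_nonneg _)
  simp only [e]
  have e2 : ∫ x, ψ x * (f₀ x * g₀ x) = 0 + ∫ x, (ψ x * f₀ x) * g₀ x := by
    simp only [zero_add, mul_assoc]
  rw [e2]
  exact h2.add h1

theorem WeakL2.mul (hM : IsOpen M) (hf : ConvC0 M f f₀) (hf₀ : ContDiffOn ℝ 1 f₀ M)
    (hg : WeakL2 M g g₀) : WeakL2 M (fun k x => f k x * g k x) (fun x => f₀ x * g₀ x) := by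
  refine ⟨fun k => (hf.cont k).mul (hg.cont k), hf.contLim.mul hg.contLim, ?_,
    fun ψ h1 h2 h3 => hg.tendsto_mul hM (.of_convC0 hM hf) hf₀ h1 h2 h3⟩
  refine hg.bdd.of_le (fun k => ((hf.cont k).mul (hg.cont k)).pow 2) (fun k => (hg.cont k).pow 2)
    fun K hK hc => ?_
  obtain ⟨C, hC0, hC⟩ := hf.exists_bound hM hK hc
  refine ⟨C ^ 2, by positivity, fun k x hx => ?_⟩
  rw [mul_pow]
  exact mul_le_mul_of_nonneg_right
    (sq_le_sq' (abs_le.1 (hC k x hx)).1 (abs_le.1 (hC k x hx)).2) (sq_nonneg _)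

theorem WeakL2.add (hM : IsOpen M) (hf : WeakL2 M f f₀) (hg : WeakL2 M g g₀) :
    WeakL2 M (fun k x => f k x + g k x) (fun x => f₀ x + g₀ x) := by
  refine ⟨fun k => (hf.cont k).add (hg.cont k), hf.contLim.add hg.contLim, ?_,
    fun ψ h1 h2 h3 => ?_⟩
  · refine (hf.bdd.add hg.bdd (fun k => (hf.cont k).pow 2) fun k => (hg.cont k).pow 2).of_le
      (fun k => ((hf.cont k).add (hg.cont k)).pow 2)
      (fun k => ((hf.cont k).pow 2).add ((hg.cont k).pow 2))
      fun K hK hc => ⟨2, by norm_num, fun k x _ => ?_⟩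
    nlinarith [sq_nonneg (f k x - g k x)]
  · have i := fun {u : Coord n → ℝ} (hu : ContinuousOn u M) =>
      integrable_mul_of_tsupport_subset hM h1.continuous h2 h3 hu
    simp only [mul_add]
    rw [integral_add (i hf.contLim) (i hg.contLim)]
    refine ((hf.tendsto ψ h1 h2 h3).add (hg.tendsto ψ h1 h2 h3)).congr fun k => ?_
    rw [integral_add (i (hf.cont k)) (i (hg.cont k))]

theorem WeakL2.const_mul (hM : IsOpen M) (c : ℝ) (hg : WeakL2 M g g₀) :
    WeakL2 M (fun k x => c * g k x) (fun x => c * g₀ x) :=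
  hg.mul hM (ConvC0.const (f₀ := fun _ => c) continuousOn_const hM) contDiffOn_const

theorem WeakL2.zero (hM : IsOpen M) : WeakL2 M (fun _ _ => 0) (fun _ => 0) :=
  (StrongL4.of_convC0 hM (ConvC0.const (f₀ := fun _ : Coord n => (0 : ℝ))
    continuousOn_const hM)).weakL2

theorem WeakL2.sum {ι : Type*} (hM : IsOpen M) (s : Finset ι) {F : ι → ℕ → Coord n → ℝ}
    {F₀ : ι → Coord n → ℝ} (h : ∀ i, WeakL2 M (F i) (F₀ i)) :
    WeakL2 M (fun k x => ∑ i ∈ s, F i k x) (fun x => ∑ i ∈ s, F₀ i x) := by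
  classical
  induction s using Finset.induction_on with
  | empty => simpa using WeakL2.zero hM
  | insert i s hi ih => simpa only [Finset.sum_insert hi] using (h i).add hM ih

theorem StrongL4.sum {ι : Type*} (hM : IsOpen M) (s : Finset ι) {F : ι → ℕ → Coord n → ℝ}
    {F₀ : ι → Coord n → ℝ} (h : ∀ i, StrongL4 M (F i) (F₀ i)) :
    StrongL4 M (fun k x => ∑ i ∈ s, F i k x) (fun x => ∑ i ∈ s, F₀ i x) := by
  classical
  induction s using Finset.induction_on with
  | empty => simpa using StrongL4.of_convC0 hM (ConvC0.const (f₀ := fun _ : Coord n => (0 : ℝ))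
      continuousOn_const hM)
  | insert i s hi ih => simpa only [Finset.sum_insert hi] using (h i).add ih

/-- After integration by parts, uniform convergence of `f k` on the support of the test function
suffices. This covers the time derivatives too, about which nothing stronger is known for lapse and
shift. -/
theorem ConvW12.weakL2_pd (hM : IsOpen M) (hf : ConvW12 M f f₀) (α : Fin (n + 1)) :
    WeakL2 M (fun k => pd α (f k)) (pd α f₀) := by
  refine ⟨fun k => hf.continuousOn_pd hM k α,
    EllipticGauge.continuousOn_pd hM (hf.contDiffOnLim.of_le (by norm_num)), hf.bdd α,
    fun ψ h1 h2 h3 => ?_⟩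
  have key : ∀ u : Coord n → ℝ, ContDiffOn ℝ 2 u M →
      ∫ x, ψ x * pd α u x = - ∫ x, u x * pd α ψ x := fun u hu => by
    simp only [mul_comm (ψ _)]
    exact integral_pd_mul_of_tsupport_subset hM (hu.of_le (by norm_num)) h1 h2 h3
  simp only [key _ hf.contDiffOnLim, fun k => key _ (hf.contDiffOn k)]
  have hs : tsupport (pd α ψ) ⊆ tsupport ψ := tsupport_pd_subset
  have cψ : Continuous (pd α ψ) := (contDiff_pd (m := 0) h1 (by norm_num)).continuous
  have hS := StrongL4.of_convC0 hM hf.convC0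
  have hc : IsCompact (tsupport ψ) := h2
  have e : ∀ u : Coord n → ℝ, ∫ x in tsupport ψ, u x * pd α ψ x = ∫ x, u x * pd α ψ x := fun u =>
    setIntegral_eq_integral_of_forall_compl_eq_zero fun x hx => by
      rw [image_eq_zero_of_notMem_tsupport fun h' => hx (hs h'), mul_zero]
  refine Tendsto.neg ?_
  have h4 := (tendsto_setIntegral_mul_zero (g := fun _ => pd α ψ) hc
    (fun k => ((hS.cont k).sub hS.contLim).mono h3) (fun _ => cψ.continuousOn)
    (hS.tendsto_sq h3 hc) fun _ => le_rfl).add_const (∫ x, f₀ x * pd α ψ x)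
  rw [zero_add] at h4
  refine h4.congr fun k => ?_
  rw [← e (f k), ← e f₀, ← integral_add]
  · refine integral_congr_ae (ae_of_all _ fun x => ?_)
    simp only [Pi.sub_apply]
    ring
  · exact (((hS.cont k).sub hS.contLim).mono h3 |>.mul cψ.continuousOn).integrableOn_compact hc
  · exact ((hS.contLim.mono h3).mul cψ.continuousOn).integrableOn_compact hc

/-- Convergence of continuous functions in the sense of distributions on `M`. -/
structure ConvDistrib (M : Set (Coord n)) (f : ℕ → Coord n → ℝ) (f₀ : Coord n → ℝ) : Prop where
  cont : ∀ k, ContinuousOn (f k) M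
  contLim : ContinuousOn f₀ M
  tendsto : ∀ ψ : Coord n → ℝ, ContDiff ℝ 2 ψ → HasCompactSupport ψ → tsupport ψ ⊆ M →
    Tendsto (fun k => ∫ x, ψ x * f k x) atTop (𝓝 (∫ x, ψ x * f₀ x))

theorem ConvDistrib.tendstoInDistributions (hM : IsOpen M) (h : ConvDistrib M f f₀) :
    TendstoInDistributions M f f₀ := by
  refine ⟨fun k => (h.cont k).locallyIntegrableOn hM.measurableSet,
    h.contLim.locallyIntegrableOn hM.measurableSet, fun φ h1 h2 h3 => ?_⟩
  simpa only [mul_comm] using h.tendsto φ (by exact_mod_cast contDiff_infty.1 h1 2) h2 h3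

theorem ConvDistrib.congr (hf : ConvDistrib M f f₀)
    (h : ∀ k, Set.EqOn (g k) (f k) M) (h₀ : Set.EqOn g₀ f₀ M) : ConvDistrib M g g₀ := by
  refine ⟨fun k => (hf.cont k).congr (h k), hf.contLim.congr h₀, fun ψ h1 h2 h3 => ?_⟩
  have e : ∀ {u v : Coord n → ℝ}, Set.EqOn u v M → ∫ x, ψ x * u x = ∫ x, ψ x * v x := by
    intro u v huv
    refine integral_congr_ae (ae_of_all _ fun x => ?_)
    by_cases hx : x ∈ tsupport ψ
    · simp only [huv (h3 hx)]
    · simp only [image_eq_zero_of_notMem_tsupport hx, zero_mul]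
  rw [e h₀]
  exact (hf.tendsto ψ h1 h2 h3).congr fun k => (e (h k)).symm

theorem ConvDistrib.add (hM : IsOpen M) (hf : ConvDistrib M f f₀) (hg : ConvDistrib M g g₀) :
    ConvDistrib M (fun k x => f k x + g k x) (fun x => f₀ x + g₀ x) := by
  refine ⟨fun k => (hf.cont k).add (hg.cont k), hf.contLim.add hg.contLim, fun ψ h1 h2 h3 => ?_⟩
  have i := fun {u : Coord n → ℝ} (hu : ContinuousOn u M) =>
    integrable_mul_of_tsupport_subset hM h1.continuous h2 h3 hu
  simp only [mul_add]
  rw [integral_add (i hf.contLim) (i hg.contLim)]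
  refine ((hf.tendsto ψ h1 h2 h3).add (hg.tendsto ψ h1 h2 h3)).congr fun k => ?_
  rw [integral_add (i (hf.cont k)) (i (hg.cont k))]

theorem ConvDistrib.neg (hf : ConvDistrib M f f₀) :
    ConvDistrib M (fun k x => - f k x) (fun x => - f₀ x) := by
  refine ⟨fun k => (hf.cont k).neg, hf.contLim.neg, fun ψ h1 h2 h3 => ?_⟩
  simpa only [mul_neg, integral_neg] using (hf.tendsto ψ h1 h2 h3).neg

theorem ConvDistrib.sub (hM : IsOpen M) (hf : ConvDistrib M f f₀) (hg : ConvDistrib M g g₀) :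
    ConvDistrib M (fun k x => f k x - g k x) (fun x => f₀ x - g₀ x) := by
  simpa only [sub_eq_add_neg] using hf.add hM hg.neg

theorem ConvDistrib.zero : ConvDistrib M (fun _ _ => 0) (fun _ => 0) :=
  ⟨fun _ => continuousOn_const, continuousOn_const, fun _ _ _ _ => tendsto_const_nhds⟩

theorem ConvDistrib.sum {ι : Type*} (hM : IsOpen M) (s : Finset ι) {F : ι → ℕ → Coord n → ℝ}
    {F₀ : ι → Coord n → ℝ} (h : ∀ i, ConvDistrib M (F i) (F₀ i)) :
    ConvDistrib M (fun k x => ∑ i ∈ s, F i k x) (fun x => ∑ i ∈ s, F₀ i x) := by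
  classical
  induction s using Finset.induction_on with
  | empty => simpa using ConvDistrib.zero
  | insert i s hi ih => simpa only [Finset.sum_insert hi] using (h i).add hM ih

theorem ConvDistrib.mul (hM : IsOpen M) (hf : StrongL4 M f f₀) (hf₀ : ContDiffOn ℝ 1 f₀ M)
    (hg : WeakL2 M g g₀) : ConvDistrib M (fun k x => f k x * g k x) (fun x => f₀ x * g₀ x) :=
  ⟨fun k => (hf.cont k).mul (hg.cont k), hf.contLim.mul hg.contLim,
    fun _ h1 h2 h3 => hg.tendsto_mul hM hf hf₀ (h1.of_le (by norm_num)) h2 h3⟩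

/-- The derivative of a `C²` test function is a `C¹` one, so the two classes of test functions fit
together. -/
theorem WeakL2.convDistrib_pd (hM : IsOpen M) (hf : WeakL2 M f f₀)
    (hfs : ∀ k, ContDiffOn ℝ 1 (f k) M) (hf₀ : ContDiffOn ℝ 1 f₀ M) (α : Fin (n + 1)) :
    ConvDistrib M (fun k => pd α (f k)) (pd α f₀) := by
  refine ⟨fun k => continuousOn_pd hM (hfs k), continuousOn_pd hM hf₀, fun ψ h1 h2 h3 => ?_⟩
  have key : ∀ u : Coord n → ℝ, ContDiffOn ℝ 1 u M →
      ∫ x, ψ x * pd α u x = - ∫ x, pd α ψ x * u x := fun u hu => by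
    simp only [mul_comm (ψ _), mul_comm (pd α ψ _)]
    exact integral_pd_mul_of_tsupport_subset hM hu (h1.of_le (by norm_num)) h2 h3
  simp only [key _ hf₀, fun k => key _ (hfs k)]
  exact (hf.tendsto _ (contDiff_pd h1 (by norm_num)) (hasCompactSupport_pd h2)
    (tsupport_pd_subset.trans h3)).neg

end Weak

/-! ### Convergence of the Ricci tensor -/

section RicciConvergence

variable {M : Set (Coord 2)} {gs : ℕ → TensorField 2} {g : TensorField 2}

/-- The combination `∂_μ g_{σν} + ∂_ν g_{σμ} - ∂_σ g_{μν}` of derivatives of the metric. -/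
def christoffelBracket (g : TensorField 2) (σ μ ν : Fin 3) (x : Coord 2) : ℝ :=
  pd μ (fun y => g y σ ν) x + pd ν (fun y => g y σ μ) x - pd σ (fun y => g y μ ν) x

theorem weakL2_christoffelBracket (hM : IsOpen M)
    (h : ∀ α β, ConvW12 M (fun k x => gs k x α β) (fun x => g x α β)) (σ μ ν : Fin 3) :
    WeakL2 M (fun k => christoffelBracket (gs k) σ μ ν) (christoffelBracket g σ μ ν) := by
  have := (((h σ ν).weakL2_pd hM μ).add hM ((h σ μ).weakL2_pd hM ν)).add hM
    (((h μ ν).weakL2_pd hM σ).const_mul hM (-1))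
  simp only [neg_one_mul, ← sub_eq_add_neg] at this
  exact this

/-- When one of the lower indices is spatial, time derivatives of `g_{0α}` either do not occur or
cancel by symmetry. Only spatial derivatives and `∂₀ g_{ij}` remain, and these converge strongly. -/
theorem strongL4_christoffelBracket (hM : IsOpen M)
    (hsymm : ∀ k, ∀ x ∈ M, ∀ α β, gs k x α β = gs k x β α)
    (hsymm₀ : ∀ x ∈ M, ∀ α β, g x α β = g x β α)
    (h : ∀ α β, ConvLap M (fun k x => gs k x α β) (fun x => g x α β))
    (h0 : ∀ i j : Fin 2, StrongL4 M (fun k => pd 0 (fun x => gs k x i.succ j.succ))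
      (pd 0 (fun x => g x i.succ j.succ))) (σ : Fin 3) {μ ν : Fin 3} (hμν : μ ≠ 0 ∨ ν ≠ 0) :
    StrongL4 M (fun k => christoffelBracket (gs k) σ μ ν) (christoffelBracket g σ μ ν) := by
  have hs : ∀ (i : Fin 2) α β, StrongL4 M (fun k => pd i.succ (fun x => gs k x α β))
    (pd i.succ (fun x => g x α β)) := fun i α β => (h α β).strongL4_pd hM i
  have neg : ∀ {f : ℕ → Coord 2 → ℝ} {f₀ : Coord 2 → ℝ}, StrongL4 M f f₀ →
      StrongL4 M (fun k x => - f k x) (fun x => - f₀ x) := fun hf => by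
    simpa using hf.mul hM (ConvC0.const (f₀ := fun _ => (-1 : ℝ)) continuousOn_const hM)
  have ds : ∀ k, ∀ x ∈ M, ∀ l α β, pd l (fun y => gs k y α β) x = pd l (fun y => gs k y β α) x :=
    fun k x hx l α β => pd_congr_of_eqOn hM (fun y hy => hsymm k y hy α β) hx
  have ds₀ : ∀ x ∈ M, ∀ l α β, pd l (fun y => g y α β) x = pd l (fun y => g y β α) x :=
    fun x hx l α β => pd_congr_of_eqOn hM (fun y hy => hsymm₀ y hy α β) hx
  -- the case of a spatial second index
  have key : ∀ (σ μ : Fin 3) (j : Fin 2), StrongL4 M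
      (fun k => christoffelBracket (gs k) σ μ j.succ) (christoffelBracket g σ μ j.succ) := by
    intro σ μ j
    rcases Fin.eq_zero_or_eq_succ σ with rfl | ⟨i, rfl⟩ <;>
      rcases Fin.eq_zero_or_eq_succ μ with rfl | ⟨m, rfl⟩
    -- For `σ = μ = 0` the two terms `∂₀ g_{0j}` cancel and `∂ⱼ g₀₀` is left.
    · refine (hs j 0 0).congr (fun k x hx => ?_) fun x hx => ?_ <;>
        simp only [christoffelBracket] <;> ring
    · exact ((hs m 0 j.succ).add (hs j 0 m.succ)).add (neg (h0 m j))
    · exact ((h0 i j).add (hs j i.succ 0)).add (neg (hs i 0 j.succ))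
    · exact ((hs m i.succ j.succ).add (hs j i.succ m.succ)).add (neg (hs i m.succ j.succ))
  rcases Fin.eq_zero_or_eq_succ ν with rfl | ⟨j, rfl⟩
  · obtain ⟨m, rfl⟩ := Fin.exists_succ_eq.2 (hμν.resolve_right (by simp))
    refine (key σ 0 m).congr (fun k x hx => ?_) fun x hx => ?_
    · simp only [christoffelBracket, ds k x hx σ m.succ 0]
      ring
    · simp only [christoffelBracket, ds₀ x hx σ m.succ 0]
      ring
  · exact key σ μ j

/-- The derivative terms converge because differentiation is continuous on distributions. A product
of Christoffel symbols converges as soon as one factor has lower indices other than `(0, 0)`, that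
factor being strongly convergent. -/
theorem convDistrib_ricci (hM : IsOpen M)
    (hΓs : ∀ k l μ ν, ContDiffOn ℝ 1 (christoffel (gs k) l μ ν) M)
    (hΓ : ∀ l μ ν, ContDiffOn ℝ 1 (christoffel g l μ ν) M)
    (hw : ∀ l μ ν, WeakL2 M (fun k => christoffel (gs k) l μ ν) (christoffel g l μ ν))
    (hs : ∀ l μ ν, μ ≠ 0 ∨ ν ≠ 0 →
      StrongL4 M (fun k => christoffel (gs k) l μ ν) (christoffel g l μ ν)) (μ ν : Fin 3) :
    ConvDistrib M (fun k => ricci (gs k) μ ν) (ricci g μ ν) := by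
  have hd : ∀ α l μ ν, ConvDistrib M (fun k => pd α (christoffel (gs k) l μ ν))
      (pd α (christoffel g l μ ν)) := fun α l μ ν =>
    (hw l μ ν).convDistrib_pd hM (fun k => hΓs k l μ ν) (hΓ l μ ν) α
  have hq : ∀ l μ ν l' μ' ν', (μ ≠ 0 ∨ ν ≠ 0) ∨ (μ' ≠ 0 ∨ ν' ≠ 0) → ConvDistrib M
      (fun k x => christoffel (gs k) l μ ν x * christoffel (gs k) l' μ' ν' x)
      (fun x => christoffel g l μ ν x * christoffel g l' μ' ν' x) := by
    rintro l μ ν l' μ' ν' (h | h)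
    · exact .mul hM (hs l μ ν h) (hΓ l μ ν) (hw l' μ' ν')
    · simpa only [mul_comm] using
        ConvDistrib.mul hM (hs l' μ' ν' h) (hΓ l' μ' ν') (hw l μ ν)
  have hdiff : ∀ l σ, ConvDistrib M
      (fun k x => christoffel (gs k) l l σ x * christoffel (gs k) σ μ ν x
        - christoffel (gs k) l ν σ x * christoffel (gs k) σ μ l x)
      (fun x => christoffel g l l σ x * christoffel g σ μ ν x
        - christoffel g l ν σ x * christoffel g σ μ l x) := by
    intro l σ
    -- In either product both factors have lower indices `(0, 0)` exactly when all four indices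
    -- vanish, and then the two products coincide. This is why the difference is treated for each
    -- `l, σ` and not each sum separately.
    by_cases h : (l = 0 ∧ σ = 0) ∧ μ = 0 ∧ ν = 0
    · obtain ⟨⟨rfl, rfl⟩, rfl, rfl⟩ := h
      simpa only [sub_self] using ConvDistrib.zero
    · by_cases h' : l = 0 ∧ σ = 0
      · obtain ⟨rfl, rfl⟩ := h'
        exact (hq _ _ _ _ _ _ (by tauto)).sub hM (hq _ _ _ _ _ _ (by tauto))
      · exact (hq _ _ _ _ _ _ (by tauto)).sub hM (hq _ _ _ _ _ _ (by tauto))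
  refine (((ConvDistrib.sum hM Finset.univ fun l => hd l l μ ν).sub hM
    (.sum hM Finset.univ fun l => hd ν l μ l)).add hM (.sum hM Finset.univ fun l =>
      .sum hM Finset.univ fun σ => hdiff l σ)).congr (fun k x _ => ?_) fun x _ => ?_ <;>
  · simp only [ricci, Finset.sum_sub_distrib]
    ring

theorem tendstoInDistributions_ricci (hM : IsOpen M) (hgs : ∀ k, IsLorentzianMetric M (gs k))
    (hg : IsLorentzianMetric M g) (hgs_flat : ∀ k, IsSpatiallyConformallyFlat M (gs k))
    (hg_flat : IsSpatiallyConformallyFlat M g)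
    (h : ∀ c, ConvLap M (fun k => gaugeFunction (gs k) c) (gaugeFunction g c))
    (ht : StrongL4 M (fun k => pd 0 (conformalFactor (gs k))) (pd 0 (conformalFactor g)))
    (μ ν : Fin 3) :
    TendstoInDistributions M (fun k => ricci (gs k) μ ν) (ricci g μ ν) := by
  have hL := convLap_metric hM hgs hg hgs_flat hg_flat h
  have hI := convLap_invMetric hM hgs hg hgs_flat hg_flat h
  have eq : ∀ {g : TensorField 2}, IsLorentzianMetric M g → IsSpatiallyConformallyFlat M g →
      ∀ i j : Fin 2, Set.EqOn (fun x => g x i.succ j.succ)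
        (if i = j then conformalFactor g else fun _ => 0) M := by
    intro g hg hf i j x hx
    simp only [metric_eq hg hf hx]
    fin_cases i <;> fin_cases j <;> simp [admMatrix]
  have h0 : ∀ i j : Fin 2, StrongL4 M (fun k => pd 0 (fun x => gs k x i.succ j.succ))
      (pd 0 (fun x => g x i.succ j.succ)) := by
    intro i j
    by_cases hij : i = j
    · refine ht.congr (fun k x hx => ?_) fun x hx => ?_
      · rw [pd_congr_of_eqOn hM (eq (hgs k) (hgs_flat k) i j) hx, if_pos hij]
      · rw [pd_congr_of_eqOn hM (eq hg hg_flat i j) hx, if_pos hij]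
    · refine (StrongL4.of_convC0 hM (ConvC0.const (f₀ := fun _ => (0 : ℝ)) continuousOn_const
        hM)).congr (fun k x hx => ?_) fun x hx => ?_
      · rw [pd_congr_of_eqOn hM (eq (hgs k) (hgs_flat k) i j) hx, if_neg hij, pd_const]
      · rw [pd_congr_of_eqOn hM (eq hg hg_flat i j) hx, if_neg hij, pd_const]
  have c1 : ∀ l σ, ContDiffOn ℝ 1 (invMetric g l σ) M := fun l σ =>
    (hI l σ).contDiffOnLim.of_le (by norm_num)
  refine ConvDistrib.tendstoInDistributions hM (convDistrib_ricci hM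
    (fun k => contDiffOn_christoffel_of_flat hM (hgs k) (hgs_flat k))
    (contDiffOn_christoffel_of_flat hM hg hg_flat) (fun l μ ν => ?_) (fun l μ ν hμν => ?_) μ ν)
  · exact (WeakL2.sum hM Finset.univ fun σ => (weakL2_christoffelBracket hM
      (fun α β => (hL α β).toConvW12) σ μ ν).mul hM (hI l σ).convC0 (c1 l σ)).const_mul hM (1 / 2)
  · exact (StrongL4.sum hM Finset.univ fun σ => (strongL4_christoffelBracket hM
      (fun k x hx α β => ((hgs k).lorentz x hx).1.apply β α)
      (fun x hx α β => (hg.lorentz x hx).1.apply β α) hL h0 σ hμν).mul hM (hI l σ).convC0).mul hM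
        (ConvC0.const (f₀ := fun _ => (1 / 2 : ℝ)) continuousOn_const hM)

end RicciConvergence

end

end EllipticGauge

/-! ### Conclusion -/

open EllipticGauge
theorem lemmaA1 (M : Set (Coord 2)) (hM : IsOpen M)
    (gs : ℕ → TensorField 2) (g : TensorField 2)
    (T : ℝ → ℝ) (hT : T = (fun t => t) ∨ T = (fun _ => 0))
    (hgs : ∀ k, IsLorentzianMetric M (gs k))
    (hg : IsLorentzianMetric M g)
    (hgs_flat : ∀ k, IsSpatiallyConformallyFlat M (gs k))
    (hg_flat : IsSpatiallyConformallyFlat M g)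
    (hgs_cmc : ∀ k, HasSliceMeanCurvature M (gs k) T)
    (hg_cmc : HasSliceMeanCurvature M g T)
    (h_conv : ∀ α β, TendstoInC0Loc M (fun k x => gs k x α β) (fun x => g x α β))
    (h_bdd : ∀ α β, BoundedInW1pLoc M 2 (fun k x => gs k x α β))
    (h_ric : ∀ α β, BoundedInLpLoc M 2 (fun k => ricci (gs k) α β)) :
    (∀ α β, BoundedInLpLoc M 2 (fun k => spatialLaplacian (invMetric (gs k) α β))) ∧
    (∀ i j, TendstoInLpLoc M 4 (fun k => e0 (gs k) (spatialInv (gs k) i j))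
      (e0 g (spatialInv g i j))) ∧
    (∀ α β, TendstoInDistributions M (fun k => ricci (gs k) α β) (ricci g α β)) := by
  have sq_iff : ∀ {f : ℕ → Coord 2 → ℝ}, (∀ k, ContinuousOn (f k) M) →
      (BoundedInLpLoc M 2 f ↔ BddIntegrals M (fun k x => f k x ^ 2)) := fun hf =>
    boundedInLpLoc_iff (p := 2) even_two two_ne_zero hf
  -- The two admissible choices of `T` enter only through the fact that `T` has constant derivative.
  obtain ⟨T', hT'⟩ : ∃ T' : ℝ, ∀ t, HasDerivAt T T' t := by
    rcases hT with rfl | rfl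
    · exact ⟨1, fun t => hasDerivAt_id t⟩
    · exact ⟨0, fun t => hasDerivAt_const t 0⟩
  have hTc : Continuous T := continuous_iff_continuousAt.2 fun t => (hT' t).continuousAt
  have hW : ∀ α β, ConvW12 M (fun k x => gs k x α β) (fun x => g x α β) := fun α β =>
    ⟨fun k => (hgs k).contDiffOn α β, hg.contDiffOn α β,
      (ConvC0.of_tendstoInC0Loc hM (fun k => ((hgs k).contDiffOn α β).continuousOn)
        (hg.contDiffOn α β).continuousOn (h_conv α β)).tendsto,
      fun l => (sq_iff fun k => continuousOn_pd hM
        (((hgs k).contDiffOn α β).of_le (by norm_num))).1 ((h_bdd α β).2 l)⟩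
  have hR : ∀ α β, BddIntegrals M (fun k x => ricci (gs k) α β x ^ 2) := fun α β =>
    (sq_iff fun k => continuousOn_ricci hM (hgs k) (hgs_flat k) α β).1 (h_ric α β)
  have hL := convLap_gaugeFunction hM hgs hg hgs_flat hg_flat hT' hgs_cmc hW hR
  have hI := convLap_invMetric hM hgs hg hgs_flat hg_flat hL
  have he := strongL4_e0_conformalFactor hM hgs hg hgs_flat hg_flat hTc hgs_cmc hg_cmc hL
  exact ⟨fun α β => (sq_iff fun k => (hI α β).continuousOn_lap hM k).2 (hI α β).lap,
    fun i j => (strongL4_e0_spatialInv hM hgs hg hgs_flat hg_flat hL he i j).tendstoInLpLoc,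
    tendstoInDistributions_ricci hM hgs hg hgs_flat hg_flat hL
      (strongL4_pd_zero_conformalFactor hL hM he)⟩
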